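/- Let $k$ be a field of characteristic $0$, let $H$ be a Hopf algebra over $k$ with bijective antipode, and let $V$ be a finite-dimensional (left) Yetter--Drinfeld module over $H$ with braiding $c(v\otimes w)=v_{(-1)}w\otimes v_{(0)}$. For $n\ge 0$ let $\Delta_{1^n}:V^{\otimes n}\to V^{\otimes n}$ be the quantum symmetrizer, that is, the component in $V\otimes\cdots\otimes V$ of the iterated braided comultiplication of the tensor algebra $T(V)$, in which $V$ is primitive. The Nichols algebra of $V$ is $\mathcal B(V)=T(V)/\bigoplus_{n\ge2}\ker\Delta_{1^n}$; the Nichols algebra of any braided vector space is defined in the same way. Let $R$ be a subring of $k$ and let $V_R$ be an $R$-order of $V$: a finitely generated projective $R$-submodule $V_R\subseteq V$ such that the canonical map $k\otimes_R V_R\to V$ is bijective, $c(V_R^{\otimes 2})\subseteq V_R^{\otimes 2}$ and $c^{-1}(V_R^{\otimes 2})\subseteq V_R^{\otimes 2}$. Put $$\mathcal B(V_R)=\bigoplus_{n\ge0}\mathcal B^n(V_R),\qquad \mathcal B^n(V_R)=V_R^{\otimes n}/\bigl(V_R^{\otimes n}\cap\ker\Delta_{1^n}\bigr).$$ Let $\mathfrak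 m$ be a maximal ideal of $R$ and let $V_{R,\mathfrak m}=R/\mathfrak m\otimes_R V_R$, which is the degree one part of $B=R/\mathfrak m\otimes_R\mathcal B(V_R)$. Give $B$ the braiding $c_B$ and the comultiplication $\Delta_B$ induced by those of the tensor algebra $T(V_R)$. Let $W\subseteq\bigoplus_{n\ge2}R/\mathfrak m\otimes_R\mathcal B^n(V_R)$ be an $R/\mathfrak m$-subspace that is categorical in $B$, i.e. $c_B(W\otimes B)=B\otimes W$ and $c_B(B\otimes W)=W\otimes B$, and consists of primitive elements, i.e. $\Delta_B(w)=w\otimes1+1\otimes w$ for all $w\in W$. Regard $V_{R,\mathfrak m}\oplus W$ as a braided vector space with the restriction of $c_B$. If the Nichols algebra of $V_{R,\mathfrak m}\oplus W$ is infinite-dimensional over $R/\mathfrak m$, then $\mathcal B(V)$ is infinite-dimensional over $k$. -/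

import Mathlib

open scoped TensorProduct

namespace Nichols

noncomputable section

/-! ### Yetter-Drinfeld modules -/

/-- A (left-left) Yetter-Drinfeld module over the bialgebra `H`: a left `H`-module `V` with a
left coaction `δ : V → H ⊗ V`, `δ v = v₍₋₁₎ ⊗ v₍₀₎`, which is coassociative, counital, and satisfies
`(h₍₁₎ v)₍₋₁₎ h₍₂₎ ⊗ (h₍₁₎ v)₍₀₎ = h₍₁₎ v₍₋₁₎ ⊗ h₍₂₎ v₍₀₎`. -/
class YetterDrinfeld (k H V : Type*) [Field k] [Ring H] [Bialgebra k H]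
    [AddCommGroup V] [Module k V] [Module H V] [IsScalarTower k H V] where
  /-- The coaction. -/
  coact : V →ₗ[k] H ⊗[k] V
  coassoc : (TensorProduct.assoc k H H V).toLinearMap ∘ₗ
      (Coalgebra.comul (R := k) (A := H)).rTensor V ∘ₗ coact = coact.lTensor H ∘ₗ coact
  counit : (TensorProduct.lid k V).toLinearMap ∘ₗ
      (Coalgebra.counit (R := k) (A := H)).rTensor V ∘ₗ coact = LinearMap.id
  compat : ∀ (h : H) (v : V),
      (LinearMap.mul' k H).rTensor V (TensorProduct.rightComm k H V H
        ((coact ∘ₗ (Algebra.lsmul k k V : H →ₐ[k] Module.End k V).toLinearMap.flip v).rTensor H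
          (Coalgebra.comul (R := k) h))) =
      TensorProduct.map (LinearMap.mul' k H)
        (TensorProduct.lift (Algebra.lsmul k k V : H →ₐ[k] Module.End k V).toLinearMap)
        (TensorProduct.tensorTensorTensorComm k H H H V (Coalgebra.comul (R := k) h ⊗ₜ coact v))

/-- The braiding of a Yetter-Drinfeld module, `c (v ⊗ w) = v₍₋₁₎ w ⊗ v₍₀₎`. -/
def ydBraiding (k H V : Type*) [Field k] [Ring H] [Bialgebra k H]
    [AddCommGroup V] [Module k V] [Module H V] [IsScalarTower k H V] [YetterDrinfeld k H V] :
    V ⊗[k] V →ₗ[k] V ⊗[k] V :=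
  (TensorProduct.lift (Algebra.lsmul k k V : H →ₐ[k] Module.End k V).toLinearMap).rTensor V ∘ₗ
    (TensorProduct.rightComm k H V V).toLinearMap ∘ₗ
    (YetterDrinfeld.coact (k := k) (H := H) (V := V)).rTensor V

/-! ### The tensor algebra of a braided module

Throughout, `c : M ⊗ M → M ⊗ M` is the braiding and `T = TensorAlgebra R M`. -/

section TensorAlgebra

variable {R M : Type*} [CommRing R] [AddCommGroup M] [Module R M]

/-- Right multiplication of `T` by a vector, `t ⊗ v ↦ t v`. -/
def mulVec (R M : Type*) [CommRing R] [AddCommGroup M] [Module R M] :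
    TensorAlgebra R M ⊗[R] M →ₗ[R] TensorAlgebra R M :=
  LinearMap.mul' R (TensorAlgebra R M) ∘ₗ (TensorAlgebra.ι R).lTensor (TensorAlgebra R M)

/-- Left multiplication of `T` by a vector, `v ⊗ t ↦ v t`. -/
def vecMul (R M : Type*) [CommRing R] [AddCommGroup M] [Module R M] :
    M ⊗[R] TensorAlgebra R M →ₗ[R] TensorAlgebra R M :=
  LinearMap.mul' R (TensorAlgebra R M) ∘ₗ (TensorAlgebra.ι R).rTensor (TensorAlgebra R M)

/-- One crossing: for `w : M`, the operator `t ⊗ v ↦ ∑ t w' ⊗ v'` on `T ⊗ M`, where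
`c (v ⊗ w) = ∑ w' ⊗ v'`. -/
def crossing (c : M ⊗[R] M →ₗ[R] M ⊗[R] M) :
    M →ₗ[R] Module.End R (TensorAlgebra R M ⊗[R] M) :=
  (TensorProduct.curry
    ((mulVec R M).rTensor M ∘ₗ
      (TensorProduct.assoc R (TensorAlgebra R M) M M).symm.toLinearMap ∘ₗ
      c.lTensor (TensorAlgebra R M) ∘ₗ
      (TensorProduct.assoc R (TensorAlgebra R M) M M).toLinearMap)).flip

/-- The braiding `c_{M,T} : M ⊗ T → T ⊗ M`: the vector is moved through the letters of `t` one
after the other, from left to right. -/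
def vecBraiding (c : M ⊗[R] M →ₗ[R] M ⊗[R] M) :
    M ⊗[R] TensorAlgebra R M →ₗ[R] TensorAlgebra R M ⊗[R] M :=
  TensorProduct.lift
    (((MulOpposite.opLinearEquiv R).symm.toLinearMap ∘ₗ
      (TensorAlgebra.lift R
        ((MulOpposite.opLinearEquiv R).toLinearMap ∘ₗ crossing c)).toLinearMap).flip ∘ₗ
      TensorProduct.mk R (TensorAlgebra R M) M 1)

/-- Left multiplication by `1 ⊗ v` in the braided tensor product algebra `T ⊗ T`, that is
`s ⊗ t ↦ ∑ s' ⊗ v' t`, where `c_{M,T} (v ⊗ s) = ∑ s' ⊗ v'`. -/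
def rightVecMul (c : M ⊗[R] M →ₗ[R] M ⊗[R] M) :
    M →ₗ[R] Module.End R (TensorAlgebra R M ⊗[R] TensorAlgebra R M) :=
  TensorProduct.curry
    ((vecMul R M).lTensor (TensorAlgebra R M) ∘ₗ
      (TensorProduct.assoc R (TensorAlgebra R M) M (TensorAlgebra R M)).toLinearMap ∘ₗ
      (vecBraiding c).rTensor (TensorAlgebra R M) ∘ₗ
      (TensorProduct.assoc R M (TensorAlgebra R M) (TensorAlgebra R M)).symm.toLinearMap)

/-- Left multiplication by `v ⊗ 1` in `T ⊗ T`, that is `s ⊗ t ↦ v s ⊗ t`. -/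
def leftVecMul (R M : Type*) [CommRing R] [AddCommGroup M] [Module R M] :
    M →ₗ[R] Module.End R (TensorAlgebra R M ⊗[R] TensorAlgebra R M) :=
  TensorProduct.curry
    ((vecMul R M).rTensor (TensorAlgebra R M) ∘ₗ
      (TensorProduct.assoc R M (TensorAlgebra R M) (TensorAlgebra R M)).symm.toLinearMap)

/-- The braiding `c_{T,T} : T ⊗ T → T ⊗ T` extending `c`:
`s ⊗ t ↦ (1 ⊗ s) (t ⊗ 1)` in the braided tensor product algebra. -/
def tensorBraiding (c : M ⊗[R] M →ₗ[R] M ⊗[R] M) :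
    TensorAlgebra R M ⊗[R] TensorAlgebra R M →ₗ[R] TensorAlgebra R M ⊗[R] TensorAlgebra R M :=
  TensorProduct.lift
    (LinearMap.lcomp R _ ((TensorProduct.mk R (TensorAlgebra R M) (TensorAlgebra R M)).flip 1) ∘ₗ
      (TensorAlgebra.lift R (rightVecMul c)).toLinearMap)

/-- The comultiplication `Δ : T → T ⊗ T`: the algebra map to the braided tensor product algebra
with `Δ v = v ⊗ 1 + 1 ⊗ v` for `v ∈ M`. Here `Δ (v₁ ⋯ vₙ)` is computed by applying the left
multiplications by `Δ vₙ, …, Δ v₁` to `1 ⊗ 1`. -/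
def comul (c : M ⊗[R] M →ₗ[R] M ⊗[R] M) :
    TensorAlgebra R M →ₗ[R] TensorAlgebra R M ⊗[R] TensorAlgebra R M :=
  LinearMap.applyₗ (1 ⊗ₜ[R] 1) ∘ₗ
    (TensorAlgebra.lift R (leftVecMul R M + rightVecMul c)).toLinearMap

/-- The degree `n` part `Tⁿ(M)` of the tensor algebra. -/
def tensorDegree (R M : Type*) [CommRing R] [AddCommGroup M] [Module R M] (n : ℕ) :
    Submodule R (TensorAlgebra R M) :=
  LinearMap.range (TensorAlgebra.ι R : M →ₗ[R] TensorAlgebra R M) ^ n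

/-- The quantum symmetrizer `Δ_{1ⁿ} : Tⁿ(M) → Tⁿ(M)`, the component of the iterated
comultiplication in `M ⊗ ⋯ ⊗ M` (`n` factors), extended by zero to the other degrees of `T`.
It is computed through `Δ_{1ⁿ⁺¹} = (id ⊗ Δ_{1ⁿ}) Δ_{1,n}`; note that `TensorAlgebra.ιInv` is the
projection of `T` to its degree one part and `TensorAlgebra.algebraMapInv` the one to degree
zero. -/
def symmetrizer (c : M ⊗[R] M →ₗ[R] M ⊗[R] M) :
    ℕ → (TensorAlgebra R M →ₗ[R] TensorAlgebra R M)
  | 0 => Algebra.linearMap R (TensorAlgebra R M) ∘ₗ TensorAlgebra.algebraMapInv.toLinearMap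
  | n + 1 => vecMul R M ∘ₗ TensorProduct.map TensorAlgebra.ιInv (symmetrizer c n) ∘ₗ comul c

/-- `I(M) = ⨁_{n ≥ 2} ker (Δ_{1ⁿ} : Tⁿ(M) → Tⁿ(M))`. -/
def nicholsIdeal (c : M ⊗[R] M →ₗ[R] M ⊗[R] M) : Submodule R (TensorAlgebra R M) :=
  ⨆ n ≥ 2, tensorDegree R M n ⊓ LinearMap.ker (symmetrizer c n)

/-- The Nichols algebra `B(M) = T(M) / I(M)` (only its module structure is needed here). -/
abbrev NicholsAlgebra (c : M ⊗[R] M →ₗ[R] M ⊗[R] M) : Type _ :=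
  TensorAlgebra R M ⧸ nicholsIdeal c

end TensorAlgebra

/-! ### Maps of braided modules -/

section Maps

variable {R K M N : Type*} [CommRing R] [CommRing K] [Algebra R K] [AddCommGroup M] [Module R M]
  [AddCommGroup N] [Module R N] [Module K N] [IsScalarTower R K N]

/-- The map `M ⊗_R M → N ⊗_K N`, `x ⊗ y ↦ f x ⊗ f y`, for an `R`-linear map `f : M → N` into a
module over the `R`-algebra `K`. -/
def tensorSq (K : Type*) [CommRing K] [Algebra R K] [Module K N] [IsScalarTower R K N]
    (f : M →ₗ[R] N) : M ⊗[R] M →ₗ[R] N ⊗[K] N :=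
  TensorProduct.lift ((((TensorProduct.mk K N N).restrictScalars₁₂ R R).compl₂ f) ∘ₗ f)

/-- The `R`-linear map `f : M → N` is compatible with `c` on `M ⊗_R M` and `d` on `N ⊗_K N`. -/
def IsBraidedMap (f : M →ₗ[R] N) (c : M ⊗[R] M →ₗ[R] M ⊗[R] M) (d : N ⊗[K] N →ₗ[K] N ⊗[K] N) :
    Prop :=
  ∀ z : M ⊗[R] M, d (tensorSq K f z) = tensorSq K f (c z)

open Classical in
/-- The restriction of the braiding `d` of `N` along `f : M → N`. It is only used when
`f ⊗ f` is injective and `d` maps the image of `f ⊗ f` to itself, so that the restriction exists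
and is unique. -/
def restrictBraiding (f : M →ₗ[R] N) (d : N ⊗[K] N →ₗ[K] N ⊗[K] N) :
    M ⊗[R] M →ₗ[R] M ⊗[R] M :=
  if h : ∃ c, IsBraidedMap f c d then h.choose else 0

open Classical in
/-- The braiding on `N` induced by the braiding `c` of `M` along `f : M → N`. It is only used when
the image of `f ⊗ f` spans `N ⊗_K N` and `c` is compatible with the relations, so that the induced
braiding exists and is unique. -/
def inducedBraiding (K : Type*) [CommRing K] [Algebra R K] [Module K N] [IsScalarTower R K N]
    (f : M →ₗ[R] N) (c : M ⊗[R] M →ₗ[R] M ⊗[R] M) :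
    N ⊗[K] N →ₗ[K] N ⊗[K] N :=
  if h : ∃ d, IsBraidedMap f c d then h.choose else 0

end Maps

/-- A subspace `U` of the braided vector space `(E, c)` is categorical if
`c (U ⊗ E) = E ⊗ U` and `c (E ⊗ U) = U ⊗ E`. -/
def IsCategorical {K E : Type*} [CommRing K] [AddCommGroup E] [Module K E]
    (c : E ⊗[K] E →ₗ[K] E ⊗[K] E) (U : Submodule K E) : Prop :=
  (LinearMap.range (U.subtype.rTensor E)).map c = LinearMap.range (U.subtype.lTensor E) ∧
  (LinearMap.range (U.subtype.lTensor E)).map c = LinearMap.range (U.subtype.rTensor E)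

/-! ### Orders and their Nichols algebras -/

section Order

variable {k V : Type*} [Field k] [AddCommGroup V] [Module k V]

/-- `VR` is an `R`-order of the braided vector space `(V, c)`. In the last two conditions,
`VR ⊗ VR` is regarded as an `R`-submodule of `V ⊗ V`. -/
structure IsOrder (c : V ⊗[k] V →ₗ[k] V ⊗[k] V) (R : Subring k) (VR : Submodule R V) : Prop where
  finite : Module.Finite R VR
  projective : Module.Projective R VR
  bijective : Function.Bijective (VR.subtype.liftBaseChange k)
  map_le : (LinearMap.range (tensorSq k VR.subtype)).map (c.restrictScalars R) ≤
    LinearMap.range (tensorSq k VR.subtype)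
  comap_le : (LinearMap.range (tensorSq k VR.subtype)).comap (c.restrictScalars R) ≤
    LinearMap.range (tensorSq k VR.subtype)

/-- The canonical map `T(V_R) → T(V)`. -/
def orderTensor (R : Subring k) (VR : Submodule R V) :
    TensorAlgebra R VR →ₐ[R] TensorAlgebra k V :=
  TensorAlgebra.lift R ((TensorAlgebra.ι k).restrictScalars R ∘ₗ VR.subtype)

/-- The elements of `T(V_R)` whose image in `T(V)` lies in `I(V)`, that is
`⨁ₙ (V_R^{⊗ n} ∩ ker Δ_{1ⁿ})`. -/
def orderIdeal (c : V ⊗[k] V →ₗ[k] V ⊗[k] V) (R : Subring k) (VR : Submodule R V) :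
    Submodule R (TensorAlgebra R VR) :=
  ((nicholsIdeal c).restrictScalars R).comap (orderTensor R VR).toLinearMap

/-- The Nichols algebra `B(V_R) = ⨁ₙ V_R^{⊗ n} / (V_R^{⊗ n} ∩ ker Δ_{1ⁿ})` of the order `V_R`. -/
abbrev OrderNichols (c : V ⊗[k] V →ₗ[k] V ⊗[k] V) (R : Subring k) (VR : Submodule R V) : Type _ :=
  TensorAlgebra R VR ⧸ orderIdeal c R VR

/-- The degree `n` part `Bⁿ(V_R)`. -/
def orderDegree (c : V ⊗[k] V →ₗ[k] V ⊗[k] V) (R : Subring k) (VR : Submodule R V) (n : ℕ) :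
    Submodule R (OrderNichols c R VR) :=
  (tensorDegree R VR n).map (orderIdeal c R VR).mkQ

/-- The specialization `K ⊗_R B(V_R)` of the Nichols algebra of `V_R` to an `R`-algebra `K`. -/
abbrev Specialized (c : V ⊗[k] V →ₗ[k] V ⊗[k] V) (R : Subring k) (VR : Submodule R V)
    (K : Type*) [CommRing K] [Algebra R K] : Type _ :=
  K ⊗[R] OrderNichols c R VR

variable (c : V ⊗[k] V →ₗ[k] V ⊗[k] V) (R : Subring k) (VR : Submodule R V)
  (K : Type*) [CommRing K] [Algebra R K]

/-- The canonical map `T(V_R) → K ⊗_R B(V_R)`, `t ↦ 1 ⊗ [t]`. -/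
def specMk : TensorAlgebra R VR →ₗ[R] Specialized c R VR K :=
  TensorProduct.mk R K (OrderNichols c R VR) 1 ∘ₗ (orderIdeal c R VR).mkQ

/-- The part `⨁_{n ≥ d} K ⊗_R Bⁿ(V_R)` of `K ⊗_R B(V_R)`. -/
def specDegreeGE (d : ℕ) : Submodule K (Specialized c R VR K) :=
  ⨆ n ≥ d, (orderDegree c R VR n).baseChange K

/-- The braiding of `V_R`, which is the restriction of `c`. -/
def orderBraiding : VR ⊗[R] VR →ₗ[R] VR ⊗[R] VR :=
  restrictBraiding VR.subtype c

/-- The braiding of `K ⊗_R B(V_R)`, which is induced by the braiding of `T(V_R)`. -/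
def specBraiding : Specialized c R VR K ⊗[K] Specialized c R VR K →ₗ[K]
    Specialized c R VR K ⊗[K] Specialized c R VR K :=
  inducedBraiding K (specMk c R VR K) (tensorBraiding (orderBraiding c R VR))

/-- `D` is compatible with the comultiplication of `T(V_R)`. As the image of `T(V_R)` spans
`K ⊗_R B(V_R)`, there is at most one such `D`. -/
def IsSpecComul (D : Specialized c R VR K →ₗ[K] Specialized c R VR K ⊗[K] Specialized c R VR K) :
    Prop :=
  ∀ t : TensorAlgebra R VR,
    D (specMk c R VR K t) = tensorSq K (specMk c R VR K) (comul (orderBraiding c R VR) t)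

open Classical in
/-- The comultiplication of `K ⊗_R B(V_R)`, which is induced by the comultiplication of `T(V_R)`.
If `R` is so bad that the latter does not pass to the quotient (this never happens for a
Dedekind domain), then it is set to zero, and `0` is the only primitive element of positive
degree. -/
def specComul : Specialized c R VR K →ₗ[K] Specialized c R VR K ⊗[K] Specialized c R VR K :=
  if h : ∃ D, IsSpecComul c R VR K D then h.choose else 0

/-- `x` is a primitive element of `K ⊗_R B(V_R)`: `Δ x = x ⊗ 1 + 1 ⊗ x`. -/
def IsPrimitive (x : Specialized c R VR K) : Prop :=
  specComul c R VR K x = x ⊗ₜ[K] specMk c R VR K 1 + specMk c R VR K 1 ⊗ₜ[K] x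

/-- The canonical map `K ⊗_R V_R → K ⊗_R B(V_R)` onto the degree one part. -/
def specVec : K ⊗[R] VR →ₗ[K] Specialized c R VR K :=
  ((orderIdeal c R VR).mkQ ∘ₗ TensorAlgebra.ι R).baseChange K

/-- The direct sum `V_{R,K} ⊕ W`, where `V_{R,K} = K ⊗_R V_R`, for a subspace `W` of
`K ⊗_R B(V_R)`. -/
abbrev SumSpace (W : Submodule K (Specialized c R VR K)) : Type _ :=
  (K ⊗[R] VR) × W

/-- The braiding of `V_{R,K} ⊕ W`: the restriction of the braiding of `K ⊗_R B(V_R)` along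
`(u, w) ↦ u + w`. -/
def sumBraiding (W : Submodule K (Specialized c R VR K)) :
    SumSpace c R VR K W ⊗[K] SumSpace c R VR K W →ₗ[K]
      SumSpace c R VR K W ⊗[K] SumSpace c R VR K W :=
  restrictBraiding (K := K) (M := SumSpace c R VR K W) (N := Specialized c R VR K)
    ((specVec c R VR K).coprod W.subtype) (specBraiding c R VR K)

/-- The Nichols algebra `B(V_{R,K} ⊕ W)`. -/
abbrev SumNichols (W : Submodule K (Specialized c R VR K)) : Type _ :=
  NicholsAlgebra (M := SumSpace c R VR K W) (sumBraiding c R VR K W)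

end Order

end

end Nichols

/-! The contrapositive is proved. Write `K` for the residue field, `B = K ⊗_R B(V_R)` and `U =
V_{R,K} ⊕ W`. If `B(V)` is finite-dimensional, the quantum symmetrizers of `V` vanish in all large
degrees (`exists_symmetrizer_eq_zero`). They are natural for braided maps (`symmetrizer_tensorMap`)
and `T(V_R) → T(V)` is injective (`tensorMap_injective`), so those of `V_R` vanish as well, the
relations of `B(V_R)` are the intrinsic ones (`IsOrder.orderIdeal_eq`), and `B` is
finite-dimensional over `K`.

It remains to bound `B(U)` by `B`. The Yetter-Drinfeld condition gives the braid equation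
(`isYangBaxter_ydBraiding`), which makes the symmetrizers commute with the braidings of words with
letters. Hence the relations form a two-sided ideal compatible with the braiding, and multiplication
and braiding descend to `B`. When the comultiplication descends too, the letters in `U` are
primitive in `B`, so the evaluation `φ : T(U) → B` is a coalgebra map (`tensorEval_comul`). Choose a
retraction `p : B → U` with `p 1 = 0`. Iterating the comultiplication of `B` and projecting every
leg by `p` recovers, after `φ`, the symmetrizer `Δ_{1ⁿ}` on tensors of degree at most `n`
(`projSymmetrizer_tensorEval`). The images under `φ` of the tensors of degree below `n` form an
ascending chain, which stabilizes. So for large `n` a tensor of degree `n` has the same image as one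
of smaller degree, and `Δ_{1ⁿ}` kills it. This uses no grading of `B`, so `W` need not be
homogeneous.

When the comultiplication does not descend, the convention `specComul = 0` forces `W = 0`, and
naturality along `V_R → V_{R,K}` is enough. -/

namespace Nichols

/-! ### The skew derivation and the recursion for the quantum symmetrizers. -/

section Recursion

variable {R M : Type*} [CommRing R] [AddCommGroup M] [Module R M]

theorem algebraMapInv_ι (v : M) :
    TensorAlgebra.algebraMapInv (TensorAlgebra.ι R v) = (0 : R) := by
  simp [TensorAlgebra.algebraMapInv]

theorem algebraMapInv_algebraMap (r : R) :
    TensorAlgebra.algebraMapInv (algebraMap R (TensorAlgebra R M) r) = r := by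
  simp

/-- The projection to degree one is the second component of an algebra map to the trivial
square-zero extension `R ⊕ M`, whose multiplication is the Leibniz rule. -/
theorem ιInv_mul (x y : TensorAlgebra R M) :
    TensorAlgebra.ιInv (x * y) = TensorAlgebra.algebraMapInv x • TensorAlgebra.ιInv y +
      TensorAlgebra.algebraMapInv y • TensorAlgebra.ιInv x := by
  let : Module Rᵐᵒᵖ M := Module.compHom _ ((RingHom.id R).fromOpposite mul_comm)
  have : IsCentralScalar R M := ⟨fun r m => rfl⟩
  have hfst (z : TensorAlgebra R M) :
      (TensorAlgebra.toTrivSqZeroExt z).fst = TensorAlgebra.algebraMapInv z := by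
    have : (TrivSqZeroExt.fstHom R R M).comp TensorAlgebra.toTrivSqZeroExt =
        TensorAlgebra.algebraMapInv := by
      ext v
      simp [TensorAlgebra.algebraMapInv, TensorAlgebra.toTrivSqZeroExt_ι]
    exact DFunLike.congr_fun this z
  change (TensorAlgebra.toTrivSqZeroExt (x * y)).snd =
    TensorAlgebra.algebraMapInv x • (TensorAlgebra.toTrivSqZeroExt y).snd +
      TensorAlgebra.algebraMapInv y • (TensorAlgebra.toTrivSqZeroExt x).snd
  rw [map_mul, TrivSqZeroExt.snd_mul, hfst, hfst]
  simp

theorem ιInv_ι (v : M) : TensorAlgebra.ιInv (TensorAlgebra.ι R v) = v :=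
  TensorAlgebra.ι_leftInverse v

theorem ιInv_algebraMap (r : R) :
    TensorAlgebra.ιInv (algebraMap R (TensorAlgebra R M) r) = 0 := by
  -- As for any derivation, Leibniz at `1 * 1` gives `d 1 = d 1 + d 1`.
  have h := ιInv_mul (1 : TensorAlgebra R M) 1
  rw [mul_one, map_one (TensorAlgebra.algebraMapInv (R := R) (M := M)), one_smul] at h
  rw [Algebra.algebraMap_eq_smul_one, map_smul, left_eq_add.mp h, smul_zero]

theorem ιInv_one : TensorAlgebra.ιInv (1 : TensorAlgebra R M) = 0 := by
  rw [← map_one (algebraMap R (TensorAlgebra R M)), ιInv_algebraMap]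

theorem ιInv_ι_mul (v : M) (x : TensorAlgebra R M) :
    TensorAlgebra.ιInv (TensorAlgebra.ι R v * x) = TensorAlgebra.algebraMapInv x • v := by
  simp [ιInv_mul, algebraMapInv_ι, ιInv_ι]

theorem ιInv_mul_ι (v : M) (x : TensorAlgebra R M) :
    TensorAlgebra.ιInv (x * TensorAlgebra.ι R v) = TensorAlgebra.algebraMapInv x • v := by
  simp [ιInv_mul, algebraMapInv_ι, ιInv_ι]

/-- Induction on a tensor by prepending letters. -/
theorem tensor_induction_left {P : TensorAlgebra R M → Prop} (x : TensorAlgebra R M)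
    (one : P 1) (smul : ∀ (r : R) x, P x → P (r • x)) (add : ∀ x y, P x → P y → P (x + y))
    (mul : ∀ v x, P x → P (TensorAlgebra.ι R v * x)) : P x := by
  -- The claim is strengthened to all right factors `y`, so that the product case of the induction
  -- closes.
  have key : ∀ x y, P y → P (x * y) := by
    intro x
    induction x using TensorAlgebra.induction with
    | algebraMap r => intro y hy; rw [← Algebra.smul_def]; exact smul r y hy
    | ι v => exact mul v
    | mul a b ha hb => intro y hy; rw [mul_assoc]; exact ha _ (hb _ hy)
    | add a b ha hb => intro y hy; rw [add_mul]; exact add _ _ (ha _ hy) (hb _ hy)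
  simpa using key x 1 one

/-- Induction on a tensor by appending letters. -/
theorem tensor_induction_right {P : TensorAlgebra R M → Prop} (x : TensorAlgebra R M)
    (one : P 1) (smul : ∀ (r : R) x, P x → P (r • x)) (add : ∀ x y, P x → P y → P (x + y))
    (mul : ∀ x v, P x → P (x * TensorAlgebra.ι R v)) : P x := by
  have key : ∀ x y, P y → P (y * x) := by
    intro x
    induction x using TensorAlgebra.induction with
    | algebraMap r =>
      intro y hy; rw [← Algebra.commutes, ← Algebra.smul_def]; exact smul r y hy
    | ι v => exact fun y => mul y v
    | mul a b ha hb => intro y hy; rw [← mul_assoc]; exact hb _ (ha _ hy)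
    | add a b ha hb => intro y hy; rw [mul_add]; exact add _ _ (ha _ hy) (hb _ hy)
  simpa using key x 1 one

variable (c : M ⊗[R] M →ₗ[R] M ⊗[R] M)

@[simp] theorem vecMul_tmul (v : M) (t : TensorAlgebra R M) :
    vecMul R M (v ⊗ₜ t) = TensorAlgebra.ι R v * t := by
  simp [vecMul]

@[simp] theorem mulVec_tmul (t : TensorAlgebra R M) (v : M) :
    mulVec R M (t ⊗ₜ v) = t * TensorAlgebra.ι R v := by
  simp [mulVec]

/-- The braiding of the first two factors of `M ⊗ M ⊗ X`. -/
noncomputable def braidFirst (X : Type*) [AddCommGroup X] [Module R X] :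
    M ⊗[R] (M ⊗[R] X) →ₗ[R] M ⊗[R] (M ⊗[R] X) :=
  (TensorProduct.assoc R M M X).toLinearMap ∘ₗ c.rTensor X ∘ₗ
    (TensorProduct.assoc R M M X).symm.toLinearMap

theorem braidFirst_tmul {X : Type*} [AddCommGroup X] [Module R X] (v u : M) (x : X) :
    braidFirst c X (v ⊗ₜ (u ⊗ₜ x)) = TensorProduct.assoc R M M X (c (v ⊗ₜ u) ⊗ₜ x) := by
  simp [braidFirst]

theorem assoc_lTensor {X Y : Type*} [AddCommGroup X] [Module R X] [AddCommGroup Y] [Module R Y]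
    (f : X →ₗ[R] Y) (p : M ⊗[R] M) (x : X) :
    TensorProduct.assoc R M M Y (p ⊗ₜ f x) =
      (f.lTensor M).lTensor M (TensorProduct.assoc R M M X (p ⊗ₜ x)) := by
  induction p with
  | zero => simp
  | tmul a b => simp
  | add a b ha hb => simp only [TensorProduct.add_tmul, map_add, ha, hb]

theorem braidFirst_lTensor {X Y : Type*} [AddCommGroup X] [Module R X] [AddCommGroup Y]
    [Module R Y] (f : X →ₗ[R] Y) (z : M ⊗[R] (M ⊗[R] X)) :
    braidFirst c Y ((f.lTensor M).lTensor M z) = (f.lTensor M).lTensor M (braidFirst c X z) := by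
  induction z with
  | zero => simp
  | add a b ha hb => simp only [map_add, ha, hb]
  | tmul v z =>
    induction z with
    | zero => simp
    | add a b ha hb => simp only [map_add, TensorProduct.tmul_add, ha, hb]
    | tmul u x => simp [braidFirst_tmul, assoc_lTensor]

/-- The operator `u ⊗ t ↦ ∑ u' ⊗ v' t` on `M ⊗ T`, where `c (v ⊗ u) = ∑ u' ⊗ v'`. -/
noncomputable def letterAct : M →ₗ[R] Module.End R (M ⊗[R] TensorAlgebra R M) :=
  TensorProduct.curry ((vecMul R M).lTensor M ∘ₗ braidFirst c (TensorAlgebra R M))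

theorem letterAct_apply (v : M) (z : M ⊗[R] TensorAlgebra R M) :
    letterAct c v z = (vecMul R M).lTensor M (braidFirst c _ (v ⊗ₜ z)) := rfl

theorem crossing_tmul (u : M) (t : TensorAlgebra R M) (v : M) :
    crossing c u (t ⊗ₜ v) =
      (mulVec R M).rTensor M ((TensorProduct.assoc R _ M M).symm (t ⊗ₜ c (v ⊗ₜ u))) := by
  simp [crossing]

theorem vecBraiding_one (v : M) : vecBraiding c (v ⊗ₜ 1) = 1 ⊗ₜ v := by
  simp [vecBraiding]

theorem vecBraiding_mul_ι (v : M) (t : TensorAlgebra R M) (u : M) :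
    vecBraiding c (v ⊗ₜ (t * TensorAlgebra.ι R u)) = crossing c u (vecBraiding c (v ⊗ₜ t)) := by
  simp [vecBraiding]

theorem rightVecMul_tmul (v : M) (s t : TensorAlgebra R M) :
    rightVecMul c v (s ⊗ₜ t) = (vecMul R M).lTensor _
      (TensorProduct.assoc R _ M _ (vecBraiding c (v ⊗ₜ s) ⊗ₜ t)) := by
  simp [rightVecMul]

theorem leftVecMul_tmul (v : M) (s t : TensorAlgebra R M) :
    leftVecMul R M v (s ⊗ₜ t) = (TensorAlgebra.ι R v * s) ⊗ₜ t := by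
  simp [leftVecMul]

theorem comul_one : comul c 1 = 1 ⊗ₜ 1 := by simp [comul]

theorem comul_ι_mul (v : M) (x : TensorAlgebra R M) :
    comul c (TensorAlgebra.ι R v * x) =
      leftVecMul R M v (comul c x) + rightVecMul c v (comul c x) := by
  simp [comul]

/-- Each crossing leaves a letter in the tensor algebra factor, so only the scalar part of `s`
survives the counit. -/
theorem counit_vecBraiding (v : M) (s : TensorAlgebra R M) :
    (TensorAlgebra.algebraMapInv (R := R) (M := M)).toLinearMap.rTensor M
      (vecBraiding c (v ⊗ₜ s)) = TensorAlgebra.algebraMapInv s ⊗ₜ v := by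
  induction s using tensor_induction_right with
  | one => simp [vecBraiding_one]
  | smul r x hx => rw [TensorProduct.tmul_smul, map_smul, map_smul, hx, map_smul,
      TensorProduct.smul_tmul']
  | add x y hx hy => simp only [TensorProduct.tmul_add, map_add, hx, hy, TensorProduct.add_tmul]
  | mul x u hx =>
    rw [vecBraiding_mul_ι, map_mul, algebraMapInv_ι, mul_zero, TensorProduct.zero_tmul]
    generalize vecBraiding c (v ⊗ₜ x) = z
    induction z with
    | zero => simp
    | add a b ha hb => simp only [map_add, ha, hb, add_zero]
    | tmul t w =>
      rw [crossing_tmul]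
      generalize c (w ⊗ₜ u) = p
      induction p with
      | zero => simp
      | add a b ha hb => simp only [map_add, TensorProduct.tmul_add, ha, hb, add_zero]
      | tmul a b => simp [algebraMapInv_ι]

theorem ιInv_vecBraiding (v : M) (s : TensorAlgebra R M) :
    (TensorAlgebra.ιInv (R := R) (M := M)).rTensor M (vecBraiding c (v ⊗ₜ s)) =
      c (v ⊗ₜ TensorAlgebra.ιInv s) := by
  induction s using tensor_induction_right with
  | one => simp [vecBraiding_one, ιInv_one]
  | smul r x hx => simp only [TensorProduct.tmul_smul, map_smul, hx]
  | add x y hx hy => simp only [TensorProduct.tmul_add, map_add, hx, hy]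
  | mul x u _ =>
    have key (z : TensorAlgebra R M ⊗[R] M) :
        (TensorAlgebra.ιInv (R := R) (M := M)).rTensor M (crossing c u z) =
          c ((TensorProduct.lid R M
            ((TensorAlgebra.algebraMapInv (R := R) (M := M)).toLinearMap.rTensor M z)) ⊗ₜ u) := by
      induction z with
      | zero => simp
      | add a b ha hb => simp only [map_add, ha, hb, TensorProduct.add_tmul]
      | tmul t w =>
        rw [crossing_tmul]
        simp only [LinearMap.rTensor_tmul, AlgHom.toLinearMap_apply, TensorProduct.lid_tmul,
          ← TensorProduct.smul_tmul', map_smul]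
        generalize c (w ⊗ₜ u) = p
        induction p with
        | zero => simp
        | add a b ha hb => simp only [map_add, TensorProduct.tmul_add, ha, hb, smul_add]
        | tmul a b => simp [ιInv_mul_ι, TensorProduct.smul_tmul']
    rw [vecBraiding_mul_ι, key, counit_vecBraiding, ιInv_mul_ι, TensorProduct.lid_tmul,
      ← TensorProduct.smul_tmul', TensorProduct.tmul_smul]

/-- The skew derivation `∂ = Δ_{1,*} : T → M ⊗ T`. -/
noncomputable def skewDer : TensorAlgebra R M →ₗ[R] M ⊗[R] TensorAlgebra R M :=
  (TensorAlgebra.ιInv (R := R) (M := M)).rTensor (TensorAlgebra R M) ∘ₗ comul c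

theorem counit_comul (x : TensorAlgebra R M) :
    (TensorAlgebra.algebraMapInv (R := R) (M := M)).toLinearMap.rTensor _ (comul c x) =
      1 ⊗ₜ x := by
  induction x using tensor_induction_left with
  | one => simp [comul_one]
  | smul r x hx => simp only [map_smul, hx, TensorProduct.tmul_smul]
  | add x y hx hy => simp only [map_add, hx, hy, TensorProduct.tmul_add]
  | mul v x hx =>
    have key (z : TensorAlgebra R M ⊗[R] TensorAlgebra R M) :
        (TensorAlgebra.algebraMapInv (R := R) (M := M)).toLinearMap.rTensor _
          (leftVecMul R M v z + rightVecMul c v z) =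
        (LinearMap.mulLeft R (TensorAlgebra.ι R v)).lTensor R
          ((TensorAlgebra.algebraMapInv (R := R) (M := M)).toLinearMap.rTensor _ z) := by
      induction z with
      | zero => simp
      | add a b ha hb =>
        rw [map_add (leftVecMul R M v), map_add (rightVecMul c v), add_add_add_comm, map_add, ha, hb, map_add,
          map_add]
      | tmul s t =>
        have h2 (y : TensorAlgebra R M ⊗[R] M) :
            (TensorAlgebra.algebraMapInv (R := R) (M := M)).toLinearMap.rTensor _
              ((vecMul R M).lTensor _ (TensorProduct.assoc R _ M _ (y ⊗ₜ t))) =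
            (vecMul R M).lTensor R (TensorProduct.assoc R R M _
            ((TensorAlgebra.algebraMapInv (R := R) (M := M)).toLinearMap.rTensor M y ⊗ₜ t)) := by
          induction y with
          | zero => simp
          | add a b ha hb => simp only [map_add, TensorProduct.add_tmul, ha, hb]
          | tmul a b => simp
        rw [leftVecMul_tmul, rightVecMul_tmul, map_add, h2, counit_vecBraiding]
        simp [algebraMapInv_ι]
    rw [comul_ι_mul, key, hx]
    simp

@[simp] theorem skewDer_one : skewDer c 1 = 0 := by
  simp [skewDer, comul_one, ιInv_one]

theorem skewDer_algebraMap (r : R) : skewDer c (algebraMap R _ r) = 0 := by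
  simp [Algebra.algebraMap_eq_smul_one]

/-- Expand `Δ(v) Δ(x)` and keep degree one in the left leg. The factor `v ⊗ 1` pairs with the degree
zero part of that leg, where the counit axiom applies; the factor `1 ⊗ v` crosses a single letter,
by `c` itself. This product rule replaces `comul` in most of the arguments on symmetrizers. -/
theorem skewDer_ι_mul (v : M) (x : TensorAlgebra R M) :
    skewDer c (TensorAlgebra.ι R v * x) = v ⊗ₜ x + letterAct c v (skewDer c x) := by
  have h1 (z : TensorAlgebra R M ⊗[R] TensorAlgebra R M) :
      (TensorAlgebra.ιInv (R := R) (M := M)).rTensor _ (leftVecMul R M v z) =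
      v ⊗ₜ TensorProduct.lid R _
        ((TensorAlgebra.algebraMapInv (R := R) (M := M)).toLinearMap.rTensor _ z) := by
    induction z with
    | zero => simp
    | add a b ha hb => simp only [map_add, TensorProduct.tmul_add, ha, hb]
    | tmul s t => simp [leftVecMul_tmul, ιInv_ι_mul, TensorProduct.smul_tmul]
  have h2 (z : TensorAlgebra R M ⊗[R] TensorAlgebra R M) :
      (TensorAlgebra.ιInv (R := R) (M := M)).rTensor _ (rightVecMul c v z) =
      letterAct c v ((TensorAlgebra.ιInv (R := R) (M := M)).rTensor _ z) := by
    induction z with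
    | zero => simp
    | add a b ha hb => simp only [map_add, ha, hb]
    | tmul s t =>
      have h3 (y : TensorAlgebra R M ⊗[R] M) :
          (TensorAlgebra.ιInv (R := R) (M := M)).rTensor _
            ((vecMul R M).lTensor _ (TensorProduct.assoc R _ M _ (y ⊗ₜ t))) =
          (vecMul R M).lTensor _ (TensorProduct.assoc R M M _
            ((TensorAlgebra.ιInv (R := R) (M := M)).rTensor M y ⊗ₜ t)) := by
        induction y with
        | zero => simp
        | add a b ha hb => simp only [map_add, TensorProduct.add_tmul, ha, hb]
        | tmul a b => simp
      rw [rightVecMul_tmul, h3, ιInv_vecBraiding, LinearMap.rTensor_tmul, letterAct_apply,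
        braidFirst_tmul]
  simp only [skewDer, LinearMap.comp_apply]
  rw [comul_ι_mul, map_add, h1, h2, counit_comul]
  simp

/-- Splitting off the first letter. -/
theorem skewDer_zero_vecMul (z : M ⊗[R] TensorAlgebra R M) :
    skewDer (0 : M ⊗[R] M →ₗ[R] M ⊗[R] M) (vecMul R M z) = z := by
  induction z with
  | zero => simp
  | add a b ha hb => simp only [map_add, ha, hb]
  | tmul v x =>
    rw [vecMul_tmul, skewDer_ι_mul, letterAct_apply]
    have : braidFirst (0 : M ⊗[R] M →ₗ[R] M ⊗[R] M) (TensorAlgebra R M) = 0 := by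
      simp [braidFirst]
    simp [this]

/-- For the zero braiding the skew derivation just splits off the first letter, which inverts
`vecMul` on one side. -/
theorem vecMul_injective : Function.Injective (vecMul R M) :=
  Function.LeftInverse.injective skewDer_zero_vecMul

theorem symmetrizer_zero_apply (x : TensorAlgebra R M) :
    symmetrizer c 0 x = algebraMap R _ (TensorAlgebra.algebraMapInv x) := rfl

theorem symmetrizer_succ_apply (n : ℕ) (x : TensorAlgebra R M) :
    symmetrizer c (n + 1) x = vecMul R M ((symmetrizer c n).lTensor M (skewDer c x)) := by
  rw [skewDer, LinearMap.comp_apply, ← LinearMap.comp_apply (LinearMap.lTensor _ _),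
    LinearMap.lTensor_comp_rTensor]
  rfl

end Recursion

/-! ### Degrees in the tensor algebra and the relations of the Nichols algebra. -/

section Grading

variable {R M : Type*} [CommRing R] [AddCommGroup M] [Module R M]

/-- The image of `M ⊗ P` in `M ⊗ X` for a submodule `P` of `X`. -/
def lTensorRange (M : Type*) [AddCommGroup M] [Module R M] {X : Type*} [AddCommGroup X]
    [Module R X] (P : Submodule R X) : Submodule R (M ⊗[R] X) :=
  LinearMap.range (P.subtype.lTensor M)

/-- The image of `P ⊗ M` in `X ⊗ M` for a submodule `P` of `X`. -/
def rTensorRange (M : Type*) [AddCommGroup M] [Module R M] {X : Type*} [AddCommGroup X]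
    [Module R X] (P : Submodule R X) : Submodule R (X ⊗[R] M) :=
  LinearMap.range (P.subtype.rTensor M)

section TensorRange

variable {X : Type*} [AddCommGroup X] [Module R X] {P : Submodule R X}

theorem tmul_mem_lTensorRange (v : M) {x : X} (hx : x ∈ P) : v ⊗ₜ[R] x ∈ lTensorRange M P :=
  ⟨v ⊗ₜ ⟨x, hx⟩, by simp⟩

theorem tmul_mem_rTensorRange (v : M) {x : X} (hx : x ∈ P) : x ⊗ₜ[R] v ∈ rTensorRange M P :=
  ⟨⟨x, hx⟩ ⊗ₜ v, by simp⟩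

theorem lTensorRange_le {Q : Submodule R (M ⊗[R] X)} (h : ∀ v, ∀ x ∈ P, v ⊗ₜ x ∈ Q) :
    lTensorRange M P ≤ Q := by
  rintro _ ⟨z, rfl⟩
  induction z with
  | zero => simp
  | add a b ha hb => rw [map_add]; exact Q.add_mem ha hb
  | tmul v x => simpa using h v x x.2

theorem rTensorRange_le {Q : Submodule R (X ⊗[R] M)} (h : ∀ v, ∀ x ∈ P, x ⊗ₜ v ∈ Q) :
    rTensorRange M P ≤ Q := by
  rintro _ ⟨z, rfl⟩
  induction z with
  | zero => simp
  | add a b ha hb => rw [map_add]; exact Q.add_mem ha hb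
  | tmul x v => simpa using h v x x.2

theorem lTensorRange_mono {Q : Submodule R X} (h : P ≤ Q) :
    lTensorRange M P ≤ lTensorRange M Q :=
  lTensorRange_le fun v _ hx => tmul_mem_lTensorRange v (h hx)

end TensorRange

variable (c : M ⊗[R] M →ₗ[R] M ⊗[R] M)

theorem ι_mul_mem_tensorDegree (v : M) {n : ℕ} {x : TensorAlgebra R M}
    (hx : x ∈ tensorDegree R M n) : TensorAlgebra.ι R v * x ∈ tensorDegree R M (n + 1) := by
  rw [tensorDegree, pow_succ']
  exact Submodule.mul_mem_mul ⟨v, rfl⟩ hx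

theorem mul_ι_mem_tensorDegree (v : M) {n : ℕ} {x : TensorAlgebra R M}
    (hx : x ∈ tensorDegree R M n) : x * TensorAlgebra.ι R v ∈ tensorDegree R M (n + 1) := by
  rw [tensorDegree, pow_succ]
  exact Submodule.mul_mem_mul hx ⟨v, rfl⟩

theorem one_mem_tensorDegree_zero : (1 : TensorAlgebra R M) ∈ tensorDegree R M 0 := by
  simp [tensorDegree]

theorem mem_tensorDegree_zero {x : TensorAlgebra R M} (hx : x ∈ tensorDegree R M 0) :
    ∃ r, algebraMap R _ r = x := by
  simpa [tensorDegree, Submodule.mem_one] using hx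

theorem tensorDegree_succ_le {n : ℕ} {P : Submodule R (TensorAlgebra R M)}
    (h : ∀ v, ∀ x ∈ tensorDegree R M n, TensorAlgebra.ι R v * x ∈ P) :
    tensorDegree R M (n + 1) ≤ P := by
  rw [tensorDegree, pow_succ', Submodule.mul_le]
  rintro _ ⟨v, rfl⟩ x hx
  exact h v x hx

theorem tensorDegree_succ_le' {n : ℕ} {P : Submodule R (TensorAlgebra R M)}
    (h : ∀ v, ∀ x ∈ tensorDegree R M n, x * TensorAlgebra.ι R v ∈ P) :
    tensorDegree R M (n + 1) ≤ P := by
  rw [tensorDegree, pow_succ, Submodule.mul_le]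
  rintro x hx _ ⟨v, rfl⟩
  exact h v x hx

theorem exists_vecMul_eq {n : ℕ} {x : TensorAlgebra R M} (hx : x ∈ tensorDegree R M (n + 1)) :
    ∃ z ∈ lTensorRange M (tensorDegree R M n), vecMul R M z = x := by
  have : tensorDegree R M (n + 1) ≤ (lTensorRange M (tensorDegree R M n)).map (vecMul R M) :=
    tensorDegree_succ_le fun v x hx => ⟨_, tmul_mem_lTensorRange v hx, by simp⟩
  exact this hx

/-- The operator only rearranges letters and prepends one to the tail. Two submodules are allowed so
that the lemma serves both consecutive degrees and the relations with a larger candidate ideal. -/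
theorem letterAct_mem (v : M) {P Q : Submodule R (TensorAlgebra R M)}
    (h : ∀ u, ∀ x ∈ P, TensorAlgebra.ι R u * x ∈ Q) {z : M ⊗[R] TensorAlgebra R M}
    (hz : z ∈ lTensorRange M P) : letterAct c v z ∈ lTensorRange M Q := by
  suffices H : lTensorRange M P ≤ (lTensorRange M Q).comap (letterAct c v) from H hz
  refine lTensorRange_le fun u x hx => ?_
  rw [Submodule.mem_comap, letterAct_apply, braidFirst_tmul]
  generalize c (v ⊗ₜ u) = p
  induction p with
  | zero => simp
  | add a b ha hb =>
    rw [TensorProduct.add_tmul, map_add, map_add]; exact Submodule.add_mem _ ha hb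
  | tmul a b => simpa using tmul_mem_lTensorRange a (h b x hx)

theorem skewDer_mem {n : ℕ} {x : TensorAlgebra R M} (hx : x ∈ tensorDegree R M (n + 1)) :
    skewDer c x ∈ lTensorRange M (tensorDegree R M n) := by
  suffices H : tensorDegree R M (n + 1) ≤ (lTensorRange M (tensorDegree R M n)).comap (skewDer c)
    from H hx
  clear x hx
  induction n with
  | zero =>
    refine tensorDegree_succ_le fun v x hx => ?_
    rw [Submodule.mem_comap, skewDer_ι_mul]
    obtain ⟨r, rfl⟩ := mem_tensorDegree_zero hx
    rw [skewDer_algebraMap, map_zero, add_zero]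
    exact tmul_mem_lTensorRange v hx
  | succ n ih =>
    refine tensorDegree_succ_le fun v x hx => ?_
    rw [Submodule.mem_comap, skewDer_ι_mul]
    exact Submodule.add_mem _ (tmul_mem_lTensorRange v hx)
      (letterAct_mem c v (fun u y hy => ι_mul_mem_tensorDegree u hy) (ih hx))

theorem algebraMapInv_eq_zero {n : ℕ} {x : TensorAlgebra R M}
    (hx : x ∈ tensorDegree R M (n + 1)) : TensorAlgebra.algebraMapInv x = 0 := by
  suffices H : tensorDegree R M (n + 1) ≤
    LinearMap.ker (TensorAlgebra.algebraMapInv (R := R) (M := M)).toLinearMap from H hx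
  refine tensorDegree_succ_le fun v x _ => ?_
  simp [algebraMapInv_ι]

theorem ιInv_eq_zero {n : ℕ} (hn : n ≠ 1) {x : TensorAlgebra R M}
    (hx : x ∈ tensorDegree R M n) : TensorAlgebra.ιInv x = 0 := by
  match n, hn with
  | 0, _ =>
    obtain ⟨r, rfl⟩ := mem_tensorDegree_zero hx
    exact ιInv_algebraMap r
  | n + 2, _ =>
    suffices H : tensorDegree R M (n + 1 + 1) ≤
      LinearMap.ker (TensorAlgebra.ιInv (R := R) (M := M)) from H hx
    refine tensorDegree_succ_le fun v x hx => ?_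
    rw [LinearMap.mem_ker, ιInv_ι_mul, algebraMapInv_eq_zero hx, zero_smul]

/-- The skew derivation lowers the degree by exactly one, so a mismatch of degrees persists down to
the counit or to a derivative of a scalar. -/
theorem symmetrizer_eq_zero_of_ne {n m : ℕ} (hmn : m ≠ n) {x : TensorAlgebra R M}
    (hx : x ∈ tensorDegree R M m) : symmetrizer c n x = 0 := by
  induction n generalizing m x with
  | zero =>
    obtain ⟨k, rfl⟩ := Nat.exists_eq_succ_of_ne_zero hmn
    rw [symmetrizer_zero_apply, algebraMapInv_eq_zero hx, map_zero]
  | succ n ih =>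
    rw [symmetrizer_succ_apply]
    match m with
    | 0 =>
      obtain ⟨r, rfl⟩ := mem_tensorDegree_zero hx
      rw [skewDer_algebraMap, map_zero, map_zero]
    | k + 1 =>
      suffices H : lTensorRange M (tensorDegree R M k) ≤
          LinearMap.ker ((symmetrizer c n).lTensor M) by
        rw [LinearMap.mem_ker.mp (H (skewDer_mem c hx)), map_zero]
      refine lTensorRange_le fun v y hy => ?_
      rw [LinearMap.mem_ker, LinearMap.lTensor_tmul, ih (by omega) hy, TensorProduct.tmul_zero]

theorem symmetrizer_zero_eq_self {x : TensorAlgebra R M} (hx : x ∈ tensorDegree R M 0) :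
    symmetrizer c 0 x = x := by
  obtain ⟨r, rfl⟩ := mem_tensorDegree_zero hx
  rw [symmetrizer_zero_apply, algebraMapInv_algebraMap]

/-- In the product rule the braided term always carries a letter in its tail, and `symmetrizer c 0`
kills it. -/
theorem symmetrizer_one_apply (x : TensorAlgebra R M) :
    symmetrizer c 1 x = TensorAlgebra.ι R (TensorAlgebra.ιInv x) := by
  induction x using tensor_induction_left with
  | one => simp [symmetrizer_succ_apply, ιInv_one]
  | smul r x hx => simp only [map_smul, hx]
  | add x y hx hy => simp only [map_add, hx, hy]
  | mul v x _ =>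
    have h (z : M ⊗[R] TensorAlgebra R M) :
        (symmetrizer c 0).lTensor M (letterAct c v z) = 0 := by
      rw [letterAct_apply]
      generalize braidFirst c _ (v ⊗ₜ z) = y
      induction y with
      | zero => simp
      | add a b ha hb => simp only [map_add, ha, hb, add_zero]
      | tmul a y =>
        induction y with
        | zero => simp
        | add a b ha hb => simp only [map_add, TensorProduct.tmul_add, ha, hb, add_zero]
        | tmul b y => simp [symmetrizer_zero_apply, algebraMapInv_ι]
    rw [symmetrizer_succ_apply, skewDer_ι_mul, map_add, h, add_zero, ιInv_ι_mul]
    simp [symmetrizer_zero_apply, Algebra.algebraMap_eq_smul_one]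

theorem ι_ιInv {x : TensorAlgebra R M} (hx : x ∈ tensorDegree R M 1) :
    TensorAlgebra.ι R (TensorAlgebra.ιInv x) = x := by
  rw [tensorDegree, pow_one] at hx
  obtain ⟨v, rfl⟩ := hx
  rw [ιInv_ι]

/-- The homogeneous components of a tensor. -/
theorem exists_tensor_components (x : TensorAlgebra R M) : ∃ (s : Finset ℕ)
    (y : ℕ → TensorAlgebra R M), (∀ n, y n ∈ tensorDegree R M n) ∧ (∀ n ∉ s, y n = 0) ∧
      ∑ n ∈ s, y n = x := by
  classical
  let 𝒜 : ℕ → Submodule R (TensorAlgebra R M) := tensorDegree R M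
  let : GradedAlgebra 𝒜 := TensorAlgebra.gradedAlgebra
  refine ⟨(DirectSum.decompose 𝒜 x).support, fun n => DirectSum.decompose 𝒜 x n,
    fun n => (DirectSum.decompose 𝒜 x n).2, fun n hn => ?_, DirectSum.sum_support_decompose 𝒜 x⟩
  simpa using hn

theorem symmetrizer_sum {s : Finset ℕ} {y : ℕ → TensorAlgebra R M}
    (hy : ∀ n, y n ∈ tensorDegree R M n) (hs : ∀ n ∉ s, y n = 0) (n : ℕ) :
    symmetrizer c n (∑ m ∈ s, y m) = symmetrizer c n (y n) := by
  rw [map_sum, Finset.sum_eq_single n]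
  · exact fun m _ hm => symmetrizer_eq_zero_of_ne c hm (hy m)
  · intro hn
    rw [hs n hn, map_zero]

/-- A criterion that does not mention degrees. Testing `n = 0` and `n = 1` is harmless: these
symmetrizers are the identity on their degrees, so they force the components missing from the
supremum over `n ≥ 2` to vanish. -/
theorem mem_nicholsIdeal {x : TensorAlgebra R M} :
    x ∈ nicholsIdeal c ↔ ∀ n, symmetrizer c n x = 0 := by
  constructor
  · intro hx n
    suffices H : nicholsIdeal c ≤ LinearMap.ker (symmetrizer c n) from H hx
    refine iSup₂_le fun m hm z hz => ?_
    by_cases h : m = n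
    · subst h; exact hz.2
    · exact symmetrizer_eq_zero_of_ne c h hz.1
  · intro hx
    obtain ⟨s, y, hy, hs, rfl⟩ := exists_tensor_components x
    refine Submodule.sum_mem _ fun n _ => ?_
    have hn := hx n
    rw [symmetrizer_sum c hy hs] at hn
    match n with
    | 0 =>
      rw [symmetrizer_zero_eq_self c (hy 0)] at hn
      rw [hn]; exact Submodule.zero_mem _
    | 1 =>
      rw [symmetrizer_one_apply, ι_ιInv (hy 1)] at hn
      rw [hn]; exact Submodule.zero_mem _
    | n + 2 =>
      exact Submodule.mem_iSup_of_mem (n + 2)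
        (Submodule.mem_iSup_of_mem (by omega) ⟨hy _, hn⟩)

theorem algebraMapInv_eq_zero_of_mem_nicholsIdeal {x : TensorAlgebra R M}
    (hx : x ∈ nicholsIdeal c) : TensorAlgebra.algebraMapInv x = 0 := by
  have := (mem_nicholsIdeal c).mp hx 0
  rwa [symmetrizer_zero_apply, TensorAlgebra.algebraMap_eq_zero_iff] at this

theorem ιInv_eq_zero_of_mem_nicholsIdeal {x : TensorAlgebra R M}
    (hx : x ∈ nicholsIdeal c) : TensorAlgebra.ιInv x = 0 := by
  have := (mem_nicholsIdeal c).mp hx 1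
  rwa [symmetrizer_one_apply, TensorAlgebra.ι_eq_zero_iff] at this

/-- A submodule on which the counit vanishes and which is stable under the skew derivation lies in
the ideal of relations of the Nichols algebra. -/
theorem le_nicholsIdeal {P : Submodule R (TensorAlgebra R M)}
    (h0 : ∀ x ∈ P, TensorAlgebra.algebraMapInv x = 0)
    (h1 : ∀ x ∈ P, skewDer c x ∈ lTensorRange M P) : P ≤ nicholsIdeal c := by
  intro x hx
  rw [mem_nicholsIdeal]
  intro n
  induction n generalizing x with
  | zero => rw [symmetrizer_zero_apply, h0 x hx, map_zero]
  | succ n ih =>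
    rw [symmetrizer_succ_apply]
    suffices H : lTensorRange M P ≤ LinearMap.ker ((symmetrizer c n).lTensor M) by
      rw [LinearMap.mem_ker.mp (H (h1 x hx)), map_zero]
    refine lTensorRange_le fun v y hy => ?_
    rw [LinearMap.mem_ker, LinearMap.lTensor_tmul, ih hy, TensorProduct.tmul_zero]

/-- The tensors of degree less than `N`. -/
def tensorDegreeLT (R M : Type*) [CommRing R] [AddCommGroup M] [Module R M] (N : ℕ) :
    Submodule R (TensorAlgebra R M) :=
  ⨆ n ∈ Finset.range N, tensorDegree R M n

theorem tensorDegree_le_tensorDegreeLT {n N : ℕ} (h : n < N) :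
    tensorDegree R M n ≤ tensorDegreeLT R M N :=
  le_iSup₂_of_le n (Finset.mem_range.mpr h) le_rfl

theorem tensorDegreeLT_mono : Monotone (tensorDegreeLT R M) := fun _ _ h =>
  iSup₂_le fun _ hn => tensorDegree_le_tensorDegreeLT
    ((Finset.mem_range.mp hn).trans_le h)

theorem exists_mem_tensorDegreeLT (x : TensorAlgebra R M) : ∃ N, x ∈ tensorDegreeLT R M N := by
  obtain ⟨s, y, hy, -, rfl⟩ := exists_tensor_components x
  refine ⟨s.sup id + 1, Submodule.sum_mem _ fun n hn => ?_⟩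
  exact tensorDegree_le_tensorDegreeLT (Nat.lt_succ_of_le (Finset.le_sup (f := id) hn)) (hy n)

theorem symmetrizer_eq_zero_of_mem_tensorDegreeLT {n N : ℕ} (h : N ≤ n) {x : TensorAlgebra R M}
    (hx : x ∈ tensorDegreeLT R M N) : symmetrizer c n x = 0 := by
  suffices H : tensorDegreeLT R M N ≤ LinearMap.ker (symmetrizer c n) from H hx
  refine iSup₂_le fun m hm z hz => symmetrizer_eq_zero_of_ne c ?_ hz
  have := Finset.mem_range.mp hm
  omega

theorem tensorDegree_fg [Module.Finite R M] (n : ℕ) : (tensorDegree R M n).FG :=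
  Submodule.FG.pow (by rw [LinearMap.range_eq_map]; exact Module.Finite.fg_top.map _) n

/-- If a quotient of the tensor algebra kills all large degrees, then it is finitely generated. -/
theorem finite_quotient_of_tensorDegree_le [Module.Finite R M]
    {J : Submodule R (TensorAlgebra R M)} {N : ℕ} (h : ∀ n ≥ N, tensorDegree R M n ≤ J) :
    Module.Finite R (TensorAlgebra R M ⧸ J) := by
  have hfg : (tensorDegreeLT R M N).FG :=
    Submodule.fg_biSup _ _ fun n _ => tensorDegree_fg n
  have htop : (tensorDegreeLT R M N).map J.mkQ = ⊤ := by
    rw [eq_top_iff]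
    rintro z -
    obtain ⟨x, rfl⟩ := J.mkQ_surjective z
    obtain ⟨s, y, hy, -, rfl⟩ := exists_tensor_components x
    rw [map_sum]
    refine Submodule.sum_mem _ fun n _ => ?_
    by_cases hn : n < N
    · exact ⟨_, tensorDegree_le_tensorDegreeLT hn (hy n), rfl⟩
    · have : J.mkQ (y n) = 0 := by
        rw [Submodule.mkQ_apply, Submodule.Quotient.mk_eq_zero]
        exact h n (not_lt.mp hn) (hy n)
      rw [this]; exact Submodule.zero_mem _
  exact ⟨htop ▸ hfg.map _⟩

theorem nicholsAlgebra_finite [Module.Finite R M] {N : ℕ}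
    (h : ∀ n ≥ N, ∀ x ∈ tensorDegree R M n, symmetrizer c n x = 0) :
    Module.Finite R (NicholsAlgebra c) := by
  refine finite_quotient_of_tensorDegree_le (N := N) fun n hn x hx => ?_
  rw [mem_nicholsIdeal]
  intro m
  by_cases hm : n = m
  · subst hm; exact h n hn x hx
  · exact symmetrizer_eq_zero_of_ne c hm hx

/-- Representatives of finitely many generators have bounded degree, so every tensor is congruent
modulo the relations to one of degree below `N`. For `n ≥ N` the `n`-th symmetrizer kills both the
relations and these representatives. -/
theorem exists_symmetrizer_eq_zero (h : Module.Finite R (NicholsAlgebra c)) :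
    ∃ N, ∀ n ≥ N, ∀ x, symmetrizer c n x = 0 := by
  classical
  obtain ⟨s, hs⟩ := h.fg_top
  choose g hg using fun z : NicholsAlgebra c => (nicholsIdeal c).mkQ_surjective z
  choose d hd using fun x : TensorAlgebra R M => exists_mem_tensorDegreeLT x
  refine ⟨s.sup fun z => d (g z), fun n hn x => ?_⟩
  set N := s.sup fun z => d (g z)
  have hmem : (nicholsIdeal c).mkQ x ∈ (tensorDegreeLT R M N).map (nicholsIdeal c).mkQ := by
    have : (⊤ : Submodule R (NicholsAlgebra c)) ≤
        (tensorDegreeLT R M N).map (nicholsIdeal c).mkQ := by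
      rw [← hs, Submodule.span_le]
      intro z hz
      exact ⟨g z, tensorDegreeLT_mono (Finset.le_sup (f := fun z => d (g z)) hz) (hd _), hg z⟩
    exact this trivial
  obtain ⟨y, hy, hyx⟩ := hmem
  have hI : x - y ∈ nicholsIdeal c := by
    rw [← Submodule.Quotient.mk_eq_zero, Submodule.Quotient.mk_sub, sub_eq_zero]
    exact hyx.symm
  have := (mem_nicholsIdeal c).mp hI n
  rw [map_sub, symmetrizer_eq_zero_of_mem_tensorDegreeLT c hn hy, sub_zero] at this
  exact this

end Grading

/-! ### The braided tensor product of an algebra with itself. -/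

section BraidedProduct

variable {R A : Type*} [CommRing R] [AddCommGroup A] [Module R A]

/-- For a multiplication `μ` and a braiding `d` of `A`, the left multiplication by `1 ⊗ a` in the
braided tensor product `A ⊗ A`, that is `s ⊗ t ↦ ∑ s' ⊗ a' t`, where `d (a ⊗ s) = ∑ s' ⊗ a'`. -/
noncomputable def brRight (μ : A →ₗ[R] A →ₗ[R] A) (d : A ⊗[R] A →ₗ[R] A ⊗[R] A) :
    A →ₗ[R] Module.End R (A ⊗[R] A) :=
  TensorProduct.curry ((TensorProduct.lift μ).lTensor A ∘ₗ
    (TensorProduct.assoc R A A A).toLinearMap ∘ₗ d.rTensor A ∘ₗ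
    (TensorProduct.assoc R A A A).symm.toLinearMap)

/-- The multiplication of the braided tensor product `A ⊗ A`. -/
noncomputable def brProd (μ : A →ₗ[R] A →ₗ[R] A) (d : A ⊗[R] A →ₗ[R] A ⊗[R] A) :
    A ⊗[R] A →ₗ[R] Module.End R (A ⊗[R] A) :=
  LinearMap.mul' R (Module.End R (A ⊗[R] A)) ∘ₗ
    TensorProduct.map (LinearMap.rTensorHom A ∘ₗ μ) (brRight μ d)

variable (μ : A →ₗ[R] A →ₗ[R] A) (d : A ⊗[R] A →ₗ[R] A ⊗[R] A)

/-- The multiplication is a bare bilinear map, so the same formulas apply to the tensor algebra and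
to its specialization, where only the existence of a suitable `μ` is established. -/
theorem brRight_tmul (a s t : A) :
    brRight μ d a (s ⊗ₜ t) = (μ.flip t).lTensor A (d (a ⊗ₜ s)) := by
  have (z : A ⊗[R] A) : (TensorProduct.lift μ).lTensor A
      (TensorProduct.assoc R A A A (z ⊗ₜ t)) = (μ.flip t).lTensor A z := by
    induction z with
    | zero => simp
    | add a b ha hb => simp only [map_add, TensorProduct.add_tmul, ha, hb]
    | tmul a b => simp
  simp [brRight, this]

theorem brProd_tmul (a b : A) (z : A ⊗[R] A) :
    brProd μ d (a ⊗ₜ b) z = (μ a).rTensor A (brRight μ d b z) := by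
  simp [brProd]

end BraidedProduct

/-! ### Hexagon identities and multiplicativity of the comultiplication. -/

section Hexagon

variable {R M : Type*} [CommRing R] [AddCommGroup M] [Module R M]
  (c : M ⊗[R] M →ₗ[R] M ⊗[R] M)

local notation "T" => TensorAlgebra R M

theorem crossing_mulLeft (u : M) (s : T) (z : T ⊗[R] M) :
    crossing c u ((LinearMap.mulLeft R s).rTensor M z) =
      (LinearMap.mulLeft R s).rTensor M (crossing c u z) := by
  induction z with
  | zero => simp
  | add a b ha hb => simp only [map_add, ha, hb]
  | tmul t v =>
    rw [LinearMap.rTensor_tmul, crossing_tmul, crossing_tmul]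
    generalize c (v ⊗ₜ u) = p
    induction p with
    | zero => simp
    | add a b ha hb => simp only [map_add, TensorProduct.tmul_add, ha, hb]
    | tmul a b => simp [mul_assoc]

/-- The operator `s ⊗ v ↦ ∑ s t' ⊗ v'`, where `c_{M,T} (v ⊗ t) = ∑ t' ⊗ v'`. -/
noncomputable def vecBraidingTail (t : T) : T ⊗[R] M →ₗ[R] T ⊗[R] M :=
  (LinearMap.mul' R T).rTensor M ∘ₗ (TensorProduct.assoc R T T M).symm.toLinearMap ∘ₗ
    (vecBraiding c ∘ₗ (TensorProduct.mk R M T).flip t).lTensor T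

theorem vecBraidingTail_tmul (t s : T) (v : M) :
    vecBraidingTail c t (s ⊗ₜ v) =
      (LinearMap.mulLeft R s).rTensor M (vecBraiding c (v ⊗ₜ t)) := by
  have (z : T ⊗[R] M) : (LinearMap.mul' R T).rTensor M
      ((TensorProduct.assoc R T T M).symm (s ⊗ₜ z)) = (LinearMap.mulLeft R s).rTensor M z := by
    induction z with
    | zero => simp
    | add a b ha hb => simp only [map_add, TensorProduct.tmul_add, ha, hb]
    | tmul a b => simp
  simp [vecBraidingTail, this]

theorem vecBraidingTail_add (t t' : T) (z : T ⊗[R] M) :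
    vecBraidingTail c (t + t') z = vecBraidingTail c t z + vecBraidingTail c t' z := by
  simp [vecBraidingTail, LinearMap.comp_add, LinearMap.lTensor_add]

theorem vecBraidingTail_smul (r : R) (t : T) (z : T ⊗[R] M) :
    vecBraidingTail c (r • t) z = r • vecBraidingTail c t z := by
  simp [vecBraidingTail, LinearMap.comp_smul, LinearMap.lTensor_smul]

/-- Hexagon identity: `v` passes through `s` and then through `t`. Crossings act at the right end of
the word already passed, hence commute with multiplication by a prefix. -/
theorem vecBraiding_mul (v : M) (s t : T) :
    vecBraiding c (v ⊗ₜ (s * t)) = vecBraidingTail c t (vecBraiding c (v ⊗ₜ s)) := by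
  induction t using tensor_induction_right with
  | one =>
    rw [mul_one]
    generalize vecBraiding c (v ⊗ₜ s) = z
    induction z with
    | zero => simp
    | add a b ha hb => rw [map_add, ← ha, ← hb]
    | tmul a b => simp [vecBraidingTail_tmul, vecBraiding_one]
  | smul r x hx => rw [mul_smul_comm, TensorProduct.tmul_smul, map_smul, hx, vecBraidingTail_smul]
  | add x y hx hy =>
    rw [mul_add, TensorProduct.tmul_add, map_add, hx, hy, vecBraidingTail_add]
  | mul x u hx =>
    rw [← mul_assoc, vecBraiding_mul_ι, hx]
    generalize vecBraiding c (v ⊗ₜ s) = z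
    induction z with
    | zero => simp
    | add a b ha hb => simp only [map_add, ha, hb]
    | tmul a b =>
      rw [vecBraidingTail_tmul, vecBraidingTail_tmul, vecBraiding_mul_ι, crossing_mulLeft]

theorem vecBraiding_ι (v a : M) :
    vecBraiding c (v ⊗ₜ TensorAlgebra.ι R a) =
      (TensorAlgebra.ι R).rTensor M (c (v ⊗ₜ a)) := by
  rw [← one_mul (TensorAlgebra.ι R a), vecBraiding_mul_ι, vecBraiding_one, crossing_tmul]
  generalize c (v ⊗ₜ a) = p
  induction p with
  | zero => simp
  | add a b ha hb => simp only [map_add, TensorProduct.tmul_add, ha, hb]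
  | tmul a b => simp

/-- The operator `u ⊗ t ⊗ v ↦ u t ⊗ v`. -/
noncomputable def vecMulFst (R M : Type*) [CommRing R] [AddCommGroup M] [Module R M] :
    M ⊗[R] (TensorAlgebra R M ⊗[R] M) →ₗ[R] TensorAlgebra R M ⊗[R] M :=
  (vecMul R M).rTensor M ∘ₗ (TensorProduct.assoc R M (TensorAlgebra R M) M).symm.toLinearMap

theorem vecMulFst_tmul (u : M) (z : T ⊗[R] M) :
    vecMulFst R M (u ⊗ₜ z) = (LinearMap.mulLeft R (TensorAlgebra.ι R u)).rTensor M z := by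
  induction z with
  | zero => simp
  | add a b ha hb => simp only [map_add, TensorProduct.tmul_add, ha, hb]
  | tmul a b => simp [vecMulFst]

/-- The braiding is defined by peeling letters from the right. This form peels the first letter,
which is what the recursion for `skewDer` needs. -/
theorem vecBraiding_ι_mul (v a : M) (x : T) :
    vecBraiding c (v ⊗ₜ (TensorAlgebra.ι R a * x)) =
      vecMulFst R M ((vecBraiding c).lTensor M (braidFirst c T (v ⊗ₜ (a ⊗ₜ x)))) := by
  rw [vecBraiding_mul, vecBraiding_ι, braidFirst_tmul]
  generalize c (v ⊗ₜ a) = p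
  induction p with
  | zero => simp
  | add a b ha hb => simp only [map_add, TensorProduct.add_tmul, ha, hb]
  | tmul a b => simp [vecBraidingTail_tmul, vecMulFst_tmul]

/-- The algebra map `T → End (T ⊗ T)` sending `x` to the left multiplication by `1 ⊗ x`. -/
noncomputable def rightAct : T →ₐ[R] Module.End R (T ⊗[R] T) :=
  TensorAlgebra.lift R (rightVecMul c)

theorem rightAct_ι (v : M) : rightAct c (TensorAlgebra.ι R v) = rightVecMul c v := by
  simp [rightAct]

theorem tensorBraiding_tmul (s t : T) :
    tensorBraiding c (s ⊗ₜ t) = rightAct c s (t ⊗ₜ 1) := by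
  simp [tensorBraiding, rightAct]

theorem rightVecMul_mulRight (v : M) (t : T) (z : T ⊗[R] T) :
    rightVecMul c v ((LinearMap.mulRight R t).lTensor T z) =
      (LinearMap.mulRight R t).lTensor T (rightVecMul c v z) := by
  induction z with
  | zero => simp
  | add a b ha hb => simp only [map_add, ha, hb]
  | tmul s x =>
    rw [LinearMap.lTensor_tmul, rightVecMul_tmul, rightVecMul_tmul]
    generalize vecBraiding c (v ⊗ₜ s) = y
    induction y with
    | zero => simp
    | add a b ha hb => simp only [map_add, TensorProduct.add_tmul, ha, hb]
    | tmul a b => simp [mul_assoc]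

theorem rightAct_mulRight (x t : T) (z : T ⊗[R] T) :
    rightAct c x ((LinearMap.mulRight R t).lTensor T z) =
      (LinearMap.mulRight R t).lTensor T (rightAct c x z) := by
  induction x using tensor_induction_left with
  | one => simp
  | smul r x hx => simp only [map_smul, LinearMap.smul_apply, hx]
  | add x y hx hy => simp only [map_add, LinearMap.add_apply, hx, hy]
  | mul v x hx =>
    rw [map_mul, Module.End.mul_apply, hx, Module.End.mul_apply, rightAct_ι,
      rightVecMul_mulRight]

/-- Identifies the abstract braided product built from `tensorBraiding` with the operators that
define `comul`. Right multiplication on the second leg commutes with them, so they are determined on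
`t ⊗ 1`. -/
theorem brRight_tensorBraiding (x : T) :
    brRight (LinearMap.mul R T) (tensorBraiding c) x = rightAct c x := by
  refine TensorProduct.ext' fun s t => ?_
  rw [brRight_tmul, tensorBraiding_tmul]
  have : (LinearMap.mul R T).flip t = LinearMap.mulRight R t := rfl
  rw [this, ← rightAct_mulRight]
  simp

/-- The left multiplications of the braided tensor product algebra `T ⊗ T`. -/
noncomputable abbrev tensorProd : T ⊗[R] T →ₗ[R] Module.End R (T ⊗[R] T) :=
  brProd (LinearMap.mul R T) (tensorBraiding c)

theorem tensorProd_tmul (a b : T) (z : T ⊗[R] T) :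
    tensorProd c (a ⊗ₜ b) z = (LinearMap.mulLeft R a).rTensor T (rightAct c b z) := by
  rw [brProd_tmul, brRight_tensorBraiding]
  rfl

theorem tensorProd_mulRight (z : T ⊗[R] T) (b : T) (y : T ⊗[R] T) :
    tensorProd c ((LinearMap.mulRight R b).lTensor T z) y =
      tensorProd c z (rightAct c b y) := by
  induction z with
  | zero => simp
  | add a b ha hb => simp only [map_add, LinearMap.add_apply, ha, hb]
  | tmul s t =>
    rw [LinearMap.lTensor_tmul, tensorProd_tmul, tensorProd_tmul, LinearMap.mulRight_apply, map_mul,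
      Module.End.mul_apply]

/-- An instance of associativity in `T ⊗ T`, for the factors `1 ⊗ v`, `s ⊗ 1` and `z`. It amounts to
the hexagon `vecBraiding_mul`. -/
theorem rightVecMul_mulLeft (v : M) (s : T) (z : T ⊗[R] T) :
    rightVecMul c v ((LinearMap.mulLeft R s).rTensor T z) =
      tensorProd c (rightVecMul c v (s ⊗ₜ 1)) z := by
  induction z with
  | zero => simp
  | add a b ha hb => simp only [map_add, ha, hb]
  | tmul a t =>
    rw [LinearMap.rTensor_tmul, rightVecMul_tmul, rightVecMul_tmul, LinearMap.mulLeft_apply,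
      vecBraiding_mul]
    generalize vecBraiding c (v ⊗ₜ s) = y
    induction y with
    | zero => simp
    | add a b ha hb => simp only [map_add, TensorProduct.add_tmul, LinearMap.add_apply, ha, hb]
    | tmul s' v' =>
      rw [vecBraidingTail_tmul, TensorProduct.assoc_tmul, LinearMap.lTensor_tmul, tensorProd_tmul,
        vecMul_tmul, mul_one, rightAct_ι, rightVecMul_tmul]
      generalize vecBraiding c (v' ⊗ₜ a) = y
      induction y with
      | zero => simp
      | add a b ha hb => simp only [map_add, TensorProduct.add_tmul, ha, hb]
      | tmul a b => simp

theorem tensorProd_rightVecMul (v : M) (z y : T ⊗[R] T) :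
    tensorProd c (rightVecMul c v z) y = rightVecMul c v (tensorProd c z y) := by
  induction z with
  | zero => simp
  | add a b ha hb => simp only [map_add, LinearMap.add_apply, ha, hb]
  | tmul s t =>
    have h : (s ⊗ₜ t : T ⊗[R] T) = (LinearMap.mulRight R t).lTensor T (s ⊗ₜ 1) := by simp
    rw [h, rightVecMul_mulRight, tensorProd_mulRight, ← rightVecMul_mulLeft, tensorProd_mulRight,
      tensorProd_tmul, map_one, Module.End.one_apply]

theorem tensorProd_leftVecMul (v : M) (z y : T ⊗[R] T) :
    tensorProd c (leftVecMul R M v z) y = leftVecMul R M v (tensorProd c z y) := by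
  induction z with
  | zero => simp
  | add a b ha hb => simp only [map_add, LinearMap.add_apply, ha, hb]
  | tmul s t =>
    rw [leftVecMul_tmul, tensorProd_tmul, tensorProd_tmul]
    generalize rightAct c t y = z
    induction z with
    | zero => simp
    | add a b ha hb => simp only [map_add, ha, hb]
    | tmul a b => simp [leftVecMul_tmul]

theorem rightAct_mulLeft (x s : T) (z : T ⊗[R] T) :
    rightAct c x ((LinearMap.mulLeft R s).rTensor T z) =
      tensorProd c (rightAct c x (s ⊗ₜ 1)) z := by
  induction x using tensor_induction_left with
  | one => simp [tensorProd_tmul]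
  | smul r x hx => simp only [map_smul, LinearMap.smul_apply, hx]
  | add x y hx hy => simp only [map_add, LinearMap.add_apply, hx, hy]
  | mul v x hx =>
    rw [map_mul, Module.End.mul_apply, Module.End.mul_apply, hx, rightAct_ι,
      tensorProd_rightVecMul]

/-- The comultiplication is multiplicative for the braided tensor product. -/
theorem comul_mul (x y : T) : comul c (x * y) = tensorProd c (comul c x) (comul c y) := by
  induction x using tensor_induction_left with
  | one => rw [one_mul, comul_one, tensorProd_tmul]; simp
  | smul r x hx => rw [smul_mul_assoc, map_smul, hx, map_smul, map_smul, LinearMap.smul_apply]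
  | add x y hx hy => simp only [add_mul, map_add, LinearMap.add_apply, hx, hy]
  | mul v x hx =>
    rw [mul_assoc, comul_ι_mul, comul_ι_mul, hx, map_add, LinearMap.add_apply,
      tensorProd_leftVecMul, tensorProd_rightVecMul]

theorem comul_ι (v : M) : comul c (TensorAlgebra.ι R v) =
    TensorAlgebra.ι R v ⊗ₜ 1 + 1 ⊗ₜ TensorAlgebra.ι R v := by
  rw [← mul_one (TensorAlgebra.ι R v), comul_ι_mul, comul_one, leftVecMul_tmul, rightVecMul_tmul,
    vecBraiding_one]
  simp

theorem tensorBraiding_mul_right (x s t : T) :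
    tensorBraiding c (x ⊗ₜ (s * t)) = tensorProd c (tensorBraiding c (x ⊗ₜ s)) (t ⊗ₜ 1) := by
  rw [tensorBraiding_tmul, tensorBraiding_tmul, ← rightAct_mulLeft]
  simp

theorem tensorBraiding_mul_left (x y t : T) :
    tensorBraiding c ((x * y) ⊗ₜ t) = rightAct c x (tensorBraiding c (y ⊗ₜ t)) := by
  rw [tensorBraiding_tmul, tensorBraiding_tmul, map_mul, Module.End.mul_apply]

theorem tensorBraiding_one_left (t : T) : tensorBraiding c (1 ⊗ₜ t) = t ⊗ₜ 1 := by
  rw [tensorBraiding_tmul, map_one, Module.End.one_apply]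

theorem tensorBraiding_one_right (x : T) : tensorBraiding c (x ⊗ₜ 1) = 1 ⊗ₜ x := by
  rw [tensorBraiding_tmul]
  induction x using tensor_induction_left with
  | one => simp
  | smul r x hx => simp only [map_smul, LinearMap.smul_apply, hx, TensorProduct.tmul_smul]
  | add x y hx hy => simp only [map_add, LinearMap.add_apply, hx, hy, TensorProduct.tmul_add]
  | mul v x hx =>
    rw [map_mul, Module.End.mul_apply, hx, rightAct_ι, rightVecMul_tmul, vecBraiding_one]
    simp

theorem tensorBraiding_ι_left (v : M) (t : T) :
    tensorBraiding c (TensorAlgebra.ι R v ⊗ₜ t) =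
      (TensorAlgebra.ι R).lTensor T (vecBraiding c (v ⊗ₜ t)) := by
  rw [tensorBraiding_tmul, rightAct_ι, rightVecMul_tmul]
  generalize vecBraiding c (v ⊗ₜ t) = z
  induction z with
  | zero => simp
  | add a b ha hb => simp only [map_add, TensorProduct.add_tmul, ha, hb]
  | tmul a b => simp

/-- The algebra map `T → End (M ⊗ T)` extending `letterAct`. -/
noncomputable def tensorAct : T →ₐ[R] Module.End R (M ⊗[R] T) :=
  TensorAlgebra.lift R (letterAct c)

theorem tensorAct_ι (v : M) : tensorAct c (TensorAlgebra.ι R v) = letterAct c v := by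
  simp [tensorAct]

/-- The braiding `c_{T,M} : T ⊗ M → M ⊗ T`. -/
noncomputable def braidingVec : T ⊗[R] M →ₗ[R] M ⊗[R] T :=
  TensorProduct.lift (LinearMap.lcomp R _ ((TensorProduct.mk R M T).flip 1) ∘ₗ
    (tensorAct c).toLinearMap)

theorem braidingVec_tmul (x : T) (u : M) :
    braidingVec c (x ⊗ₜ u) = tensorAct c x (u ⊗ₜ 1) := by
  simp [braidingVec]

/-- A single letter remains a single letter when others cross it, so the action on `T ⊗ T` restricts
to `M ⊗ T`. -/
theorem rightAct_ι_rTensor (x : T) (z : M ⊗[R] T) :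
    rightAct c x ((TensorAlgebra.ι R).rTensor T z) =
      (TensorAlgebra.ι R).rTensor T (tensorAct c x z) := by
  induction x using tensor_induction_left with
  | one => simp
  | smul r x hx => simp only [map_smul, LinearMap.smul_apply, hx]
  | add x y hx hy => simp only [map_add, LinearMap.add_apply, hx, hy]
  | mul v x hx =>
    rw [map_mul, map_mul, Module.End.mul_apply, Module.End.mul_apply, hx, rightAct_ι, tensorAct_ι]
    generalize tensorAct c x z = z
    induction z with
    | zero => simp
    | add a b ha hb => simp only [map_add, ha, hb]
    | tmul u t =>
      rw [LinearMap.rTensor_tmul, rightVecMul_tmul, vecBraiding_ι, letterAct_apply,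
        braidFirst_tmul]
      generalize c (v ⊗ₜ u) = p
      induction p with
      | zero => simp
      | add a b ha hb => simp only [map_add, TensorProduct.add_tmul, ha, hb]
      | tmul a b => simp

theorem tensorBraiding_ι_right (x : T) (u : M) :
    tensorBraiding c (x ⊗ₜ TensorAlgebra.ι R u) =
      (TensorAlgebra.ι R).rTensor T (braidingVec c (x ⊗ₜ u)) := by
  rw [tensorBraiding_tmul, braidingVec_tmul, ← rightAct_ι_rTensor]
  simp

theorem letterAct_mulRight (v : M) (t : T) (z : M ⊗[R] T) :
    letterAct c v ((LinearMap.mulRight R t).lTensor M z) =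
      (LinearMap.mulRight R t).lTensor M (letterAct c v z) := by
  induction z with
  | zero => simp
  | add a b ha hb => simp only [map_add, ha, hb]
  | tmul u s =>
    rw [LinearMap.lTensor_tmul, letterAct_apply, letterAct_apply, braidFirst_tmul,
      braidFirst_tmul]
    generalize c (v ⊗ₜ u) = p
    induction p with
    | zero => simp
    | add a b ha hb => simp only [map_add, TensorProduct.add_tmul, ha, hb]
    | tmul a b => simp [mul_assoc]

theorem tensorAct_mulRight (x t : T) (z : M ⊗[R] T) :
    tensorAct c x ((LinearMap.mulRight R t).lTensor M z) =
      (LinearMap.mulRight R t).lTensor M (tensorAct c x z) := by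
  induction x using tensor_induction_left with
  | one => simp
  | smul r x hx => simp only [map_smul, LinearMap.smul_apply, hx]
  | add x y hx hy => simp only [map_add, LinearMap.add_apply, hx, hy]
  | mul v x hx =>
    rw [map_mul, Module.End.mul_apply, hx, Module.End.mul_apply, tensorAct_ι, letterAct_mulRight]

/-- The twisted Leibniz rule for arbitrary words; it is what makes the relations a right ideal. -/
theorem skewDer_mul (x t : T) :
    skewDer c (x * t) = (LinearMap.mulRight R t).lTensor M (skewDer c x) +
      tensorAct c x (skewDer c t) := by
  induction x using tensor_induction_left with
  | one => simp
  | smul r x hx => simp only [smul_mul_assoc, map_smul, LinearMap.smul_apply, hx, smul_add]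
  | add x y hx hy => simp only [add_mul, map_add, LinearMap.add_apply, hx, hy]; abel
  | mul v x hx =>
    rw [mul_assoc, skewDer_ι_mul, hx, skewDer_ι_mul, map_mul, Module.End.mul_apply, map_add,
      map_add, letterAct_mulRight, tensorAct_ι]
    simp [add_assoc]

/-- The part of total degree `m` of `T ⊗ T`. -/
def bidegree (R M : Type*) [CommRing R] [AddCommGroup M] [Module R M] (m : ℕ) :
    Submodule R (TensorAlgebra R M ⊗[R] TensorAlgebra R M) :=
  Submodule.span R {z | ∃ i j, i + j = m ∧ ∃ s ∈ tensorDegree R M i, ∃ t ∈ tensorDegree R M j,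
    s ⊗ₜ t = z}

theorem tmul_mem_bidegree {i j m : ℕ} (h : i + j = m) {s t : T} (hs : s ∈ tensorDegree R M i)
    (ht : t ∈ tensorDegree R M j) : s ⊗ₜ t ∈ bidegree R M m :=
  Submodule.subset_span ⟨i, j, h, s, hs, t, ht, rfl⟩

theorem vecBraiding_mem (v : M) {i : ℕ} {s : T} (hs : s ∈ tensorDegree R M i) :
    vecBraiding c (v ⊗ₜ s) ∈ rTensorRange M (tensorDegree R M i) := by
  suffices H : tensorDegree R M i ≤ (rTensorRange M (tensorDegree R M i)).comap
    (vecBraiding c ∘ₗ TensorProduct.mk R M T v) from H hs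
  clear s hs
  induction i with
  | zero =>
    intro x hx
    obtain ⟨r, rfl⟩ := mem_tensorDegree_zero hx
    simp only [Submodule.mem_comap, LinearMap.comp_apply, TensorProduct.mk_apply,
      Algebra.algebraMap_eq_smul_one, map_smul, vecBraiding_one]
    exact Submodule.smul_mem _ _ (tmul_mem_rTensorRange v one_mem_tensorDegree_zero)
  | succ i ih =>
    refine tensorDegree_succ_le' fun u x hx => ?_
    have := ih hx
    simp only [Submodule.mem_comap, LinearMap.comp_apply, TensorProduct.mk_apply] at this ⊢
    rw [vecBraiding_mul_ι]
    suffices H : rTensorRange M (tensorDegree R M i) ≤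
      (rTensorRange M (tensorDegree R M (i + 1))).comap (crossing c u) from H this
    refine rTensorRange_le fun w y hy => ?_
    rw [Submodule.mem_comap, crossing_tmul]
    generalize c (w ⊗ₜ u) = p
    induction p with
    | zero => simp
    | add a b ha hb =>
      simp only [map_add, TensorProduct.tmul_add]; exact Submodule.add_mem _ ha hb
    | tmul a b => simpa using tmul_mem_rTensorRange b (mul_ι_mem_tensorDegree a hy)

/-- Multiplication by `v ⊗ 1` or by `1 ⊗ v` raises the total degree by one, since braiding with a
letter preserves the length of a word. -/
theorem comul_mem_bidegree {m : ℕ} {x : T} (hx : x ∈ tensorDegree R M m) :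
    comul c x ∈ bidegree R M m := by
  suffices H : tensorDegree R M m ≤ (bidegree R M m).comap (comul c) from H hx
  clear x hx
  induction m with
  | zero =>
    intro x hx
    obtain ⟨r, rfl⟩ := mem_tensorDegree_zero hx
    simp only [Submodule.mem_comap, Algebra.algebraMap_eq_smul_one, map_smul, comul_one]
    exact Submodule.smul_mem _ _
      (tmul_mem_bidegree (zero_add 0) one_mem_tensorDegree_zero one_mem_tensorDegree_zero)
  | succ m ih =>
    refine tensorDegree_succ_le fun v x hx => ?_
    rw [Submodule.mem_comap, comul_ι_mul]
    have h : comul c x ∈ bidegree R M m := ih hx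
    generalize comul c x = z at h
    rw [bidegree] at h
    induction h using Submodule.span_induction with
    | zero => rw [map_zero, map_zero, add_zero]; exact Submodule.zero_mem _
    | add a b _ _ ha hb =>
      rw [map_add, map_add, add_add_add_comm]; exact Submodule.add_mem _ ha hb
    | smul r a _ ha => rw [map_smul, map_smul, ← smul_add]; exact Submodule.smul_mem _ _ ha
    | mem z hz =>
      obtain ⟨i, j, rfl, s, hs, t, ht, rfl⟩ := hz
      refine Submodule.add_mem _ ?_ ?_
      · rw [leftVecMul_tmul]
        exact tmul_mem_bidegree (by omega) (ι_mul_mem_tensorDegree v hs) ht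
      · rw [rightVecMul_tmul]
        have h := vecBraiding_mem c v hs
        obtain ⟨y, hy⟩ := h
        rw [← hy]
        clear hy
        induction y with
        | zero => simp
        | add a b ha hb =>
          simp only [map_add, TensorProduct.add_tmul]; exact Submodule.add_mem _ ha hb
        | tmul y w =>
          simpa using tmul_mem_bidegree (by omega) y.2 (ι_mul_mem_tensorDegree w ht)

end Hexagon

/-! ### The braid equation and the commutation of symmetrizers with the braiding. -/

section YangBaxter

variable {R M : Type*} [CommRing R] [AddCommGroup M] [Module R M]
  {c : M ⊗[R] M →ₗ[R] M ⊗[R] M}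

local notation "T" => TensorAlgebra R M

/-- The braid equation `c₁ c₂ c₁ = c₂ c₁ c₂` on `M ⊗ M ⊗ M`. -/
def IsYangBaxter (c : M ⊗[R] M →ₗ[R] M ⊗[R] M) : Prop :=
  ∀ z : M ⊗[R] (M ⊗[R] M), braidFirst c M (c.lTensor M (braidFirst c M z)) =
    c.lTensor M (braidFirst c M (c.lTensor M z))

theorem IsYangBaxter.braidFirst (hc : IsYangBaxter c) {X : Type*} [AddCommGroup X] [Module R X]
    (z : M ⊗[R] (M ⊗[R] (M ⊗[R] X))) :
    braidFirst c (M ⊗[R] X) ((braidFirst c X).lTensor M (braidFirst c (M ⊗[R] X) z)) =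
    (Nichols.braidFirst c X).lTensor M
      (Nichols.braidFirst c (M ⊗[R] X) ((Nichols.braidFirst c X).lTensor M z)) := by
  -- Freezing the last factor at `x` embeds the three-strand picture, intertwines both braidings,
  -- and reaches all pure tensors.
  let J (x : X) : M ⊗[R] (M ⊗[R] M) →ₗ[R] M ⊗[R] (M ⊗[R] (M ⊗[R] X)) :=
    (((TensorProduct.mk R M X).flip x).lTensor M).lTensor M
  have h1 (x : X) (w : M ⊗[R] (M ⊗[R] M)) :
      Nichols.braidFirst c (M ⊗[R] X) (J x w) = J x (Nichols.braidFirst c M w) :=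
    braidFirst_lTensor c _ w
  have h2 (x : X) (w : M ⊗[R] (M ⊗[R] M)) :
      (Nichols.braidFirst c X).lTensor M (J x w) = J x (c.lTensor M w) := by
    have (p : M ⊗[R] M) : TensorProduct.assoc R M M X (p ⊗ₜ x) =
        ((TensorProduct.mk R M X).flip x).lTensor M p := by
      induction p with
      | zero => simp
      | add a b ha hb => simp only [map_add, TensorProduct.add_tmul, ha, hb]
      | tmul a b => simp
    have h3 : Nichols.braidFirst c X ∘ₗ ((TensorProduct.mk R M X).flip x).lTensor M =
        ((TensorProduct.mk R M X).flip x).lTensor M ∘ₗ c := by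
      refine TensorProduct.ext' fun a b => ?_
      simp [braidFirst_tmul, this]
    simp only [J]
    rw [← LinearMap.comp_apply, ← LinearMap.lTensor_comp, h3, LinearMap.lTensor_comp,
      LinearMap.comp_apply]
  have h4 (x : X) (w : M ⊗[R] (M ⊗[R] M)) : Nichols.braidFirst c (M ⊗[R] X)
      ((Nichols.braidFirst c X).lTensor M (Nichols.braidFirst c (M ⊗[R] X) (J x w))) =
      (Nichols.braidFirst c X).lTensor M
      (Nichols.braidFirst c (M ⊗[R] X) ((Nichols.braidFirst c X).lTensor M (J x w))) := by
    rw [h1, h2, h1, h2, h1, h2, hc]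
  induction z with
  | zero => simp
  | add a b ha hb => simp only [map_add, ha, hb]
  | tmul v z =>
    induction z with
    | zero => simp
    | add a b ha hb => simp only [map_add, TensorProduct.tmul_add, ha, hb]
    | tmul u z =>
      induction z with
      | zero => simp
      | add a b ha hb => simp only [map_add, TensorProduct.tmul_add, ha, hb]
      | tmul w x => simpa [J] using h4 x (v ⊗ₜ (u ⊗ₜ w))

theorem skewDer_letterAct (v : M) (y : M ⊗[R] T) :
    (skewDer c).lTensor M (letterAct c v y) = braidFirst c T (v ⊗ₜ y) +
      ((vecMul R M).lTensor M).lTensor M ((braidFirst c T).lTensor M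
        (braidFirst c (M ⊗[R] T) (v ⊗ₜ (skewDer c).lTensor M y))) := by
  induction y with
  | zero => simp
  | add a b ha hb => simp only [map_add, TensorProduct.tmul_add, ha, hb]; abel
  | tmul u t =>
    rw [letterAct_apply, braidFirst_tmul, LinearMap.lTensor_tmul, braidFirst_tmul]
    generalize c (v ⊗ₜ u) = p
    induction p with
    | zero => simp
    | add a b ha hb => simp only [map_add, TensorProduct.add_tmul, ha, hb]; abel
    | tmul a b => simp [skewDer_ι_mul, letterAct_apply, TensorProduct.tmul_add]

/-- The operator `b ↦ tensorAct b z`. -/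
noncomputable def tensorActOn (c : M ⊗[R] M →ₗ[R] M ⊗[R] M) (z : M ⊗[R] T) :
    T →ₗ[R] M ⊗[R] T :=
  (tensorAct c).toLinearMap.flip z

theorem tensorActOn_apply (z : M ⊗[R] T) (b : T) : tensorActOn c z b = tensorAct c b z := rfl

theorem tensorActOn_vecMul (z : M ⊗[R] T) (w : M ⊗[R] T) :
    tensorActOn c z (vecMul R M w) =
      (vecMul R M).lTensor M (braidFirst c T ((tensorActOn c z).lTensor M w)) := by
  induction w with
  | zero => simp
  | add a b ha hb => simp only [map_add, ha, hb]
  | tmul a b =>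
    rw [vecMul_tmul, tensorActOn_apply, map_mul, Module.End.mul_apply, tensorAct_ι,
      letterAct_apply, LinearMap.lTensor_tmul, tensorActOn_apply]

/-- The one place where the braid equation enters the treatment of `c_{T,M}`: the strands are `v`,
the head of `w`, and the letter that crosses both. -/
theorem braidFirst_letterAct (hc : IsYangBaxter c) (v : M) (z : M ⊗[R] T) (w : M ⊗[R] T) :
    ((vecMul R M).lTensor M).lTensor M ((braidFirst c T).lTensor M
        (braidFirst c (M ⊗[R] T) (v ⊗ₜ braidFirst c T ((tensorActOn c z).lTensor M w)))) =
      braidFirst c T ((tensorActOn c z).lTensor M (letterAct c v w)) := by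
  induction w with
  | zero => simp
  | add a b ha hb => simp only [map_add, TensorProduct.tmul_add, ha, hb]
  | tmul a b =>
    have h1 : (v ⊗ₜ braidFirst c T ((tensorActOn c z).lTensor M (a ⊗ₜ b)) :
        M ⊗[R] (M ⊗[R] (M ⊗[R] T))) =
        (braidFirst c T).lTensor M (v ⊗ₜ (a ⊗ₜ tensorAct c b z)) := by
      simp [tensorActOn_apply]
    rw [h1, ← hc.braidFirst, ← braidFirst_lTensor, letterAct_apply, braidFirst_tmul,
      braidFirst_tmul]
    congr 1
    generalize c (v ⊗ₜ a) = p
    induction p with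
    | zero => simp
    | add a b ha hb => simp only [map_add, TensorProduct.add_tmul, ha, hb]
    | tmul a b => simp [tensorActOn_apply, tensorAct_ι, letterAct_apply]

/-- Compatibility of `Δ_{1,*}` with the braiding: differentiating `x` after it has crossed `u`
agrees with splitting off a letter first and letting tail and letter cross `u` in turn. -/
theorem skewDer_braidingVec (hc : IsYangBaxter c) (x : T) (u : M) :
    (skewDer c).lTensor M (tensorAct c x (u ⊗ₜ 1)) =
      braidFirst c T ((tensorActOn c (u ⊗ₜ 1)).lTensor M (skewDer c x)) := by
  induction x using tensor_induction_left with
  | one => simp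
  | smul r x hx => simp only [map_smul, LinearMap.smul_apply, hx]
  | add x y hx hy => simp only [map_add, LinearMap.add_apply, hx, hy]
  | mul v x hx =>
    rw [map_mul, Module.End.mul_apply, tensorAct_ι, skewDer_letterAct, hx,
      braidFirst_letterAct hc, skewDer_ι_mul, map_add, map_add, LinearMap.lTensor_tmul,
      tensorActOn_apply]

/-- Induction along the recursion, with `skewDer_braidingVec` for the derivative. As a consequence,
kernels of symmetrizers are stable under crossing a letter. -/
theorem symmetrizer_braidingVec (hc : IsYangBaxter c) (n : ℕ) (x : T) (u : M) :
    (symmetrizer c n).lTensor M (braidingVec c (x ⊗ₜ u)) =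
      braidingVec c (symmetrizer c n x ⊗ₜ u) := by
  rw [braidingVec_tmul, braidingVec_tmul]
  induction n generalizing x with
  | zero =>
    induction x using tensor_induction_left with
    | one => simp [symmetrizer_zero_apply]
    | smul r x hx => simp only [map_smul, LinearMap.smul_apply, hx]
    | add x y hx hy => simp only [map_add, LinearMap.add_apply, hx, hy]
    | mul v x _ =>
      have h : (symmetrizer c 0) ∘ₗ vecMul R M = 0 := by
        refine TensorProduct.ext' fun a b => ?_
        simp [symmetrizer_zero_apply, algebraMapInv_ι]
      rw [map_mul, Module.End.mul_apply, tensorAct_ι, letterAct_apply, ← LinearMap.comp_apply,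
        ← LinearMap.lTensor_comp, h]
      simp [symmetrizer_zero_apply, algebraMapInv_ι]
  | succ n ih =>
    have h1 : symmetrizer c (n + 1) = vecMul R M ∘ₗ (symmetrizer c n).lTensor M ∘ₗ skewDer c :=
      LinearMap.ext fun y => symmetrizer_succ_apply c n y
    have h2 : (symmetrizer c n).lTensor M ∘ₗ tensorActOn c (u ⊗ₜ 1) =
        tensorActOn c (u ⊗ₜ 1) ∘ₗ symmetrizer c n := LinearMap.ext ih
    have h3 := tensorActOn_vecMul (c := c) (u ⊗ₜ 1) ((symmetrizer c n).lTensor M (skewDer c x))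
    rw [tensorActOn_apply, ← LinearMap.comp_apply (LinearMap.lTensor M (tensorActOn c _)),
      ← LinearMap.lTensor_comp, ← h2, LinearMap.lTensor_comp, LinearMap.comp_apply,
      braidFirst_lTensor, ← skewDer_braidingVec hc] at h3
    rw [symmetrizer_succ_apply, h3, h1]
    simp only [LinearMap.lTensor_comp, LinearMap.comp_apply]

/-- The skew derivation acting on the first factor of `T ⊗ M`. -/
noncomputable def skewDerFst (c : M ⊗[R] M →ₗ[R] M ⊗[R] M) :
    T ⊗[R] M →ₗ[R] M ⊗[R] (T ⊗[R] M) :=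
  (TensorProduct.assoc R M T M).toLinearMap ∘ₗ (skewDer c).rTensor M

theorem skewDerFst_vecMulFst (a : M) (y : T ⊗[R] M) :
    skewDerFst c (vecMulFst R M (a ⊗ₜ y)) =
      a ⊗ₜ y + (vecMulFst R M).lTensor M (braidFirst c _ (a ⊗ₜ skewDerFst c y)) := by
  induction y with
  | zero => simp
  | add x y hx hy => simp only [map_add, TensorProduct.tmul_add, hx, hy]; abel
  | tmul s w =>
    simp only [skewDerFst, vecMulFst_tmul, LinearMap.comp_apply, LinearMap.rTensor_tmul,
      LinearMap.mulLeft_apply, skewDer_ι_mul, LinearEquiv.coe_coe, TensorProduct.add_tmul, map_add,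
      TensorProduct.assoc_tmul]
    congr 1
    generalize skewDer c s = z
    induction z with
    | zero => simp
    | add x y hx hy => simp only [map_add, TensorProduct.tmul_add, TensorProduct.add_tmul, hx, hy]
    | tmul u t =>
      rw [letterAct_apply, braidFirst_tmul, TensorProduct.assoc_tmul, braidFirst_tmul]
      generalize c (a ⊗ₜ u) = p
      induction p with
      | zero => simp
      | add x y hx hy => simp only [map_add, TensorProduct.add_tmul, hx, hy]
      | tmul a b => simp [vecMulFst_tmul]

theorem vecBraiding_comp_vecMul :
    vecBraiding c ∘ₗ (vecMul R M).lTensor M =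
      vecMulFst R M ∘ₗ (vecBraiding c).lTensor M ∘ₗ braidFirst c T := by
  refine TensorProduct.ext' fun v z => ?_
  induction z with
  | zero => simp
  | add x y hx hy => simp only [map_add, TensorProduct.tmul_add, hx, hy]
  | tmul a x => simp [vecBraiding_ι_mul]

/-- Mirror image of `skewDer_braidingVec`. Both sides satisfy a product rule in the first letter of
`x`, and the braid equation matches the remaining terms. -/
theorem skewDer_vecBraiding (hc : IsYangBaxter c) (v : M) (x : T) :
    skewDerFst c (vecBraiding c (v ⊗ₜ x)) =
      (vecBraiding c).lTensor M (braidFirst c T (v ⊗ₜ skewDer c x)) := by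
  induction x using tensor_induction_left generalizing v with
  | one => simp [vecBraiding_one, skewDerFst]
  | smul r x hx => simp only [map_smul, TensorProduct.tmul_smul, hx]
  | add x y hx hy => simp only [map_add, TensorProduct.tmul_add, hx, hy]
  | mul a x hx =>
    have h1 (q : M ⊗[R] M) : skewDerFst c (vecMulFst R M ((vecBraiding c).lTensor M
        (TensorProduct.assoc R M M T (q ⊗ₜ x)))) =
        (vecBraiding c).lTensor M (TensorProduct.assoc R M M T (q ⊗ₜ x)) +
        (vecMulFst R M).lTensor M (((vecBraiding c).lTensor M).lTensor M
          (braidFirst c _ ((braidFirst c T).lTensor M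
            (TensorProduct.assoc R M M _ (q ⊗ₜ skewDer c x))))) := by
      induction q with
      | zero => simp
      | add x y hx hy => simp only [map_add, TensorProduct.add_tmul, hx, hy]; abel
      | tmul a' v' =>
        rw [← braidFirst_lTensor]
        simp only [TensorProduct.assoc_tmul, LinearMap.lTensor_tmul]
        rw [skewDerFst_vecMulFst, hx]
    rw [vecBraiding_ι_mul, braidFirst_tmul, h1, skewDer_ι_mul, TensorProduct.tmul_add, map_add,
      map_add, ← braidFirst_tmul, ← braidFirst_tmul, hc.braidFirst]
    congr 1
    have h2 : (v ⊗ₜ letterAct c a (skewDer c x) : M ⊗[R] (M ⊗[R] T)) =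
        ((vecMul R M).lTensor M).lTensor M
          ((braidFirst c T).lTensor M (v ⊗ₜ (a ⊗ₜ skewDer c x))) := by
      simp [letterAct_apply]
    rw [h2, braidFirst_lTensor, ← LinearMap.comp_apply (LinearMap.lTensor M (vecBraiding c)),
      ← LinearMap.lTensor_comp, vecBraiding_comp_vecMul]
    simp only [LinearMap.lTensor_comp, LinearMap.comp_apply]

theorem symmetrizer_vecBraiding (hc : IsYangBaxter c) (n : ℕ) (v : M) (x : T) :
    (symmetrizer c n).rTensor M (vecBraiding c (v ⊗ₜ x)) =
      vecBraiding c (v ⊗ₜ symmetrizer c n x) := by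
  induction n generalizing v x with
  | zero =>
    have h : (symmetrizer c 0).rTensor M = (Algebra.linearMap R T).rTensor M ∘ₗ
        (TensorAlgebra.algebraMapInv (R := R) (M := M)).toLinearMap.rTensor M := by
      rw [← LinearMap.rTensor_comp]; rfl
    rw [h, LinearMap.comp_apply, counit_vecBraiding, symmetrizer_zero_apply,
      Algebra.algebraMap_eq_smul_one, TensorProduct.tmul_smul, map_smul, vecBraiding_one,
      LinearMap.rTensor_tmul, Algebra.linearMap_apply, Algebra.algebraMap_eq_smul_one,
      TensorProduct.smul_tmul']
  | succ n ih =>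
    have h1 (y : T ⊗[R] M) : (symmetrizer c (n + 1)).rTensor M y =
        vecMulFst R M (((symmetrizer c n).rTensor M).lTensor M (skewDerFst c y)) := by
      induction y with
      | zero => simp
      | add x y hx hy => simp only [map_add, hx, hy]
      | tmul s w =>
        simp only [skewDerFst, LinearMap.comp_apply, LinearMap.rTensor_tmul,
          symmetrizer_succ_apply, LinearEquiv.coe_coe]
        generalize skewDer c s = z
        induction z with
        | zero => simp
        | add x y hx hy => simp only [map_add, TensorProduct.add_tmul, hx, hy]
        | tmul a b => simp [vecMulFst_tmul]
    have h2 : (symmetrizer c n).rTensor M ∘ₗ vecBraiding c =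
        vecBraiding c ∘ₗ (symmetrizer c n).lTensor M := TensorProduct.ext' fun a b => ih a b
    rw [h1, skewDer_vecBraiding hc, ← LinearMap.comp_apply (LinearMap.lTensor M _),
      ← LinearMap.lTensor_comp, h2, LinearMap.lTensor_comp, LinearMap.comp_apply,
      ← braidFirst_lTensor, symmetrizer_succ_apply, LinearMap.lTensor_tmul]
    have := LinearMap.congr_fun (vecBraiding_comp_vecMul (c := c))
      (v ⊗ₜ (symmetrizer c n).lTensor M (skewDer c x))
    simpa using this.symm

end YangBaxter

/-! ### The relations form a braided two-sided ideal. -/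

section Stable

variable {R M : Type*} [CommRing R] [AddCommGroup M] [Module R M]

/-- A finitely generated projective module is a retract of `Rⁿ`, so `z` is a sum of vectors tensored
with coordinates of `z`, and these are contractions by functionals on `M`. The criterion handles the
infinitely many symmetrizers at once. -/
theorem mem_lTensorRange_of_dual [Module.Finite R M] [Module.Projective R M] {X : Type*}
    [AddCommGroup X] [Module R X] {P : Submodule R X} {z : M ⊗[R] X}
    (h : ∀ φ : M →ₗ[R] R, TensorProduct.lid R X (φ.rTensor X z) ∈ P) : z ∈ lTensorRange M P := by
  obtain ⟨n, π, hπ⟩ := Module.Finite.exists_fin' R M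
  obtain ⟨s, hs⟩ := Module.projective_lifting_property π LinearMap.id hπ
  have h1 (y : (Fin n → R) ⊗[R] X) : y = ∑ i, (Pi.single i (1 : R) : Fin n → R) ⊗ₜ
      TensorProduct.lid R X ((LinearMap.proj i : (Fin n → R) →ₗ[R] R).rTensor X y) := by
    induction y with
    | zero => simp
    | add a b ha hb =>
      simp only [map_add, TensorProduct.tmul_add, Finset.sum_add_distrib]
      rw [← ha, ← hb]
    | tmul f x =>
      simp only [LinearMap.rTensor_tmul, LinearMap.proj_apply, TensorProduct.lid_tmul,
        ← TensorProduct.smul_tmul, ← TensorProduct.sum_tmul]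
      congr 1
      ext j
      simp [Finset.sum_apply, Pi.single_apply]
  have h2 : z = π.rTensor X (s.rTensor X z) := by
    rw [← LinearMap.comp_apply, ← LinearMap.rTensor_comp, hs, LinearMap.rTensor_id,
      LinearMap.id_apply]
  rw [h2, h1 (s.rTensor X z), map_sum]
  refine Submodule.sum_mem _ fun i _ => ?_
  rw [LinearMap.rTensor_tmul, ← LinearMap.comp_apply, ← LinearMap.rTensor_comp]
  exact tmul_mem_lTensorRange _ (h _)

variable {c : M ⊗[R] M →ₗ[R] M ⊗[R] M}

local notation "T" => TensorAlgebra R M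

theorem mem_lTensorRange_nicholsIdeal [Module.Finite R M] [Module.Projective R M]
    {z : M ⊗[R] T} (h : ∀ n, (symmetrizer c n).lTensor M z = 0) :
    z ∈ lTensorRange M (nicholsIdeal c) := by
  refine mem_lTensorRange_of_dual fun φ => (mem_nicholsIdeal c).mpr fun n => ?_
  have : symmetrizer c n (TensorProduct.lid R T (φ.rTensor T z)) =
      TensorProduct.lid R T (φ.rTensor T ((symmetrizer c n).lTensor M z)) := by
    clear h
    induction z with
    | zero => simp
    | add a b ha hb => simp only [map_add, ha, hb]
    | tmul v t => simp
  rw [this, h, map_zero, map_zero]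

theorem mem_rTensorRange_nicholsIdeal [Module.Finite R M] [Module.Projective R M]
    {z : T ⊗[R] M} (h : ∀ n, (symmetrizer c n).rTensor M z = 0) :
    z ∈ rTensorRange M (nicholsIdeal c) := by
  have h1 : TensorProduct.comm R T M z ∈ lTensorRange M (nicholsIdeal c) := by
    refine mem_lTensorRange_nicholsIdeal fun n => ?_
    have h0 : (symmetrizer c n).lTensor M (TensorProduct.comm R T M z) =
        TensorProduct.comm R T M ((symmetrizer c n).rTensor M z) := by
      clear h
      induction z with
      | zero => simp
      | add a b ha hb => simp only [map_add, ha, hb]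
      | tmul v t => simp
    rw [h0, h, map_zero]
  have h2 : lTensorRange M (nicholsIdeal c) ≤
      (rTensorRange M (nicholsIdeal c)).comap (TensorProduct.comm R M T).toLinearMap :=
    lTensorRange_le fun v x hx => by simpa using tmul_mem_rTensorRange v hx
  simpa using h2 h1

variable [Module.Finite R M] [Module.Projective R M]

/-- Since `vecMul` is injective, the vanishing of `Δ_{1ⁿ⁺¹}` on `x` is the vanishing of `id ⊗
Δ_{1ⁿ}` on the derivative. Conversely, `le_nicholsIdeal` puts stable submodules without constant
terms inside the relations. -/
theorem skewDer_mem_nicholsIdeal {x : T} (hx : x ∈ nicholsIdeal c) :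
    skewDer c x ∈ lTensorRange M (nicholsIdeal c) := by
  refine mem_lTensorRange_nicholsIdeal fun n => vecMul_injective ?_
  rw [← symmetrizer_succ_apply, (mem_nicholsIdeal c).mp hx, map_zero]

theorem braidingVec_mem_nicholsIdeal (hc : IsYangBaxter c) {x : T} (hx : x ∈ nicholsIdeal c)
    (u : M) : braidingVec c (x ⊗ₜ u) ∈ lTensorRange M (nicholsIdeal c) := by
  refine mem_lTensorRange_nicholsIdeal fun n => ?_
  rw [symmetrizer_braidingVec hc, (mem_nicholsIdeal c).mp hx, TensorProduct.zero_tmul, map_zero]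

theorem vecBraiding_mem_nicholsIdeal (hc : IsYangBaxter c) {x : T} (hx : x ∈ nicholsIdeal c)
    (v : M) : vecBraiding c (v ⊗ₜ x) ∈ rTensorRange M (nicholsIdeal c) := by
  refine mem_rTensorRange_nicholsIdeal fun n => ?_
  rw [symmetrizer_vecBraiding hc, (mem_nicholsIdeal c).mp hx, TensorProduct.tmul_zero, map_zero]

theorem ι_mul_mem_nicholsIdeal {x : T} (hx : x ∈ nicholsIdeal c) (v : M) :
    TensorAlgebra.ι R v * x ∈ nicholsIdeal c := by
  -- By the product rule the derivative of `v x` lies in `M ⊗ I + M ⊗ M I`, so `P = I + M I` is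
  -- stable under the skew derivation. No braid equation is needed on this side.
  let P : Submodule R T := nicholsIdeal c ⊔ (lTensorRange M (nicholsIdeal c)).map (vecMul R M)
  have hP (v : M) {x : T} (hx : x ∈ nicholsIdeal c) : TensorAlgebra.ι R v * x ∈ P :=
    Submodule.mem_sup_right ⟨_, tmul_mem_lTensorRange v hx, by simp⟩
  refine (le_nicholsIdeal (P := P) c ?_ ?_) (hP v hx)
  · suffices H : P ≤ LinearMap.ker (TensorAlgebra.algebraMapInv (R := R) (M := M)).toLinearMap from
      fun x hx => H hx
    refine sup_le (fun x hx => algebraMapInv_eq_zero_of_mem_nicholsIdeal c hx) ?_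
    rw [Submodule.map_le_iff_le_comap]
    refine lTensorRange_le fun v x hx => ?_
    simp [algebraMapInv_ι]
  · suffices H : P ≤ (lTensorRange M P).comap (skewDer c) from fun x hx => H hx
    refine sup_le (fun x hx => lTensorRange_mono le_sup_left (skewDer_mem_nicholsIdeal hx)) ?_
    rw [Submodule.map_le_iff_le_comap]
    refine lTensorRange_le fun v x hx => ?_
    rw [Submodule.mem_comap, vecMul_tmul, Submodule.mem_comap, skewDer_ι_mul]
    exact Submodule.add_mem _ (tmul_mem_lTensorRange v (Submodule.mem_sup_left hx))
      (letterAct_mem c v (fun u y hy => hP u hy) (skewDer_mem_nicholsIdeal hx))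

theorem mul_mem_nicholsIdeal_left (t : T) {x : T} (hx : x ∈ nicholsIdeal c) :
    t * x ∈ nicholsIdeal c := by
  induction t using tensor_induction_left with
  | one => rwa [one_mul]
  | smul r t ht => rw [smul_mul_assoc]; exact Submodule.smul_mem _ _ ht
  | add s t hs ht => rw [add_mul]; exact Submodule.add_mem _ hs ht
  | mul v t ht => rw [mul_assoc]; exact ι_mul_mem_nicholsIdeal ht v

/-- The product `I T` is stable under the skew derivation: by the twisted Leibniz rule one term
differentiates the relation, and the other moves it past a letter, which keeps it a relation. -/
theorem mul_mem_nicholsIdeal_right (hc : IsYangBaxter c) {x : T} (hx : x ∈ nicholsIdeal c)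
    (t : T) : x * t ∈ nicholsIdeal c := by
  have hle (t : T) : lTensorRange M (nicholsIdeal c) ≤
      (lTensorRange M (nicholsIdeal c * ⊤)).comap ((LinearMap.mulRight R t).lTensor M) := by
    refine lTensorRange_le fun v y hy => ?_
    rw [Submodule.mem_comap, LinearMap.lTensor_tmul]
    exact tmul_mem_lTensorRange v (Submodule.mul_mem_mul hy trivial)
  refine (le_nicholsIdeal (P := nicholsIdeal c * ⊤) c ?_ ?_) (Submodule.mul_mem_mul hx trivial)
  · suffices H : nicholsIdeal c * ⊤ ≤
      LinearMap.ker (TensorAlgebra.algebraMapInv (R := R) (M := M)).toLinearMap from fun x hx => H hx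
    refine Submodule.mul_le.mpr fun x hx t _ => ?_
    simp [algebraMapInv_eq_zero_of_mem_nicholsIdeal c hx]
  · suffices H : nicholsIdeal c * ⊤ ≤ (lTensorRange M (nicholsIdeal c * ⊤)).comap (skewDer c) from
      fun x hx => H hx
    refine Submodule.mul_le.mpr fun x hx t _ => ?_
    rw [Submodule.mem_comap, skewDer_mul]
    refine Submodule.add_mem _ (hle t (skewDer_mem_nicholsIdeal hx)) ?_
    generalize skewDer c t = z
    induction z with
    | zero => rw [map_zero]; exact Submodule.zero_mem _
    | add a b ha hb => rw [map_add]; exact Submodule.add_mem _ ha hb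
    | tmul u s =>
      have := tensorAct_mulRight c x s (u ⊗ₜ 1)
      rw [LinearMap.lTensor_tmul, LinearMap.mulRight_apply, one_mul] at this
      rw [this, ← braidingVec_tmul]
      exact hle s (braidingVec_mem_nicholsIdeal hc hx u)

theorem tensorBraiding_nicholsIdeal_left (hc : IsYangBaxter c) {x : T} (hx : x ∈ nicholsIdeal c)
    (t : T) : tensorBraiding c (x ⊗ₜ t) ∈ lTensorRange T (nicholsIdeal c) := by
  induction t using tensor_induction_left generalizing x with
  | one => rw [tensorBraiding_one_right]; exact tmul_mem_lTensorRange 1 hx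
  | smul r t ht => rw [TensorProduct.tmul_smul, map_smul]; exact Submodule.smul_mem _ _ (ht hx)
  | add s t hs ht =>
    rw [TensorProduct.tmul_add, map_add]; exact Submodule.add_mem _ (hs hx) (ht hx)
  | mul v t ht =>
    rw [tensorBraiding_mul_right, tensorBraiding_ι_right]
    obtain ⟨y, hy⟩ := braidingVec_mem_nicholsIdeal hc hx v
    rw [← hy]
    clear hy
    induction y with
    | zero => simp
    | add a b ha hb =>
      simp only [map_add, LinearMap.add_apply]; exact Submodule.add_mem _ ha hb
    | tmul a y =>
      rw [LinearMap.lTensor_tmul, Submodule.subtype_apply, LinearMap.rTensor_tmul,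
        tensorProd_tmul, ← tensorBraiding_tmul]
      have hle : lTensorRange T (nicholsIdeal c) ≤ (lTensorRange T (nicholsIdeal c)).comap
          ((LinearMap.mulLeft R (TensorAlgebra.ι R a)).rTensor T) :=
        lTensorRange_le fun s z hz => by
          rw [Submodule.mem_comap, LinearMap.rTensor_tmul]
          exact tmul_mem_lTensorRange _ hz
      exact hle (ht y.2)

theorem tensorBraiding_nicholsIdeal_right (hc : IsYangBaxter c) (t : T) {x : T}
    (hx : x ∈ nicholsIdeal c) :
    tensorBraiding c (t ⊗ₜ x) ∈ rTensorRange T (nicholsIdeal c) := by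
  have hle (v : M) : rTensorRange T (nicholsIdeal c) ≤
      (rTensorRange T (nicholsIdeal c)).comap (rightVecMul c v) := by
    refine rTensorRange_le fun s x hx => ?_
    rw [Submodule.mem_comap, rightVecMul_tmul]
    obtain ⟨y, hy⟩ := vecBraiding_mem_nicholsIdeal hc hx v
    rw [← hy]
    clear hy
    induction y with
    | zero => simp
    | add a b ha hb =>
      simp only [map_add, TensorProduct.add_tmul]; exact Submodule.add_mem _ ha hb
    | tmul y a => simpa using tmul_mem_rTensorRange _ y.2
  induction t using tensor_induction_left with
  | one => rw [tensorBraiding_one_left]; exact tmul_mem_rTensorRange 1 hx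
  | smul r t ht =>
    rw [← TensorProduct.smul_tmul', map_smul]; exact Submodule.smul_mem _ _ ht
  | add s t hs ht =>
    rw [TensorProduct.add_tmul, map_add]; exact Submodule.add_mem _ hs ht
  | mul v t ht =>
    rw [tensorBraiding_mul_left, rightAct_ι]
    exact hle v ht

end Stable

section TensorSq

variable {R K M N : Type*} [CommRing R] [CommRing K] [Algebra R K] [AddCommGroup M] [Module R M]
  [AddCommGroup N] [Module R N] [Module K N] [IsScalarTower R K N]

@[simp] theorem tensorSq_tmul (f : M →ₗ[R] N) (x y : M) :
    tensorSq K f (x ⊗ₜ y) = f x ⊗ₜ f y := by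
  simp [tensorSq]

end TensorSq

/-! ### Nichols algebras of spaces of primitive elements in a braided bialgebra. -/

section Primitive

variable {K U B : Type*} [CommRing K] [AddCommGroup U] [Module K U] [AddCommGroup B] [Module K B]

/-- The map `u₁ ⋯ uₙ ↦ f u₁ ⋯ f uₙ` from the tensor algebra, for a multiplication `μ` of `B`. -/
noncomputable def tensorEval (μ : B →ₗ[K] B →ₗ[K] B) (e : B) (f : U →ₗ[K] B) :
    TensorAlgebra K U →ₗ[K] B :=
  LinearMap.applyₗ e ∘ₗ
    (TensorAlgebra.lift K (A := Module.End K B) (μ ∘ₗ f)).toLinearMap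

variable {μ : B →ₗ[K] B →ₗ[K] B} {e : B} {f : U →ₗ[K] B}

theorem tensorEval_one : tensorEval μ e f 1 = e := by simp [tensorEval]

theorem tensorEval_ι_mul (u : U) (x : TensorAlgebra K U) :
    tensorEval μ e f (TensorAlgebra.ι K u * x) = μ (f u) (tensorEval μ e f x) := by
  simp [tensorEval]

theorem tensorEval_mul_ι (hassoc : ∀ a b c, μ (μ a b) c = μ a (μ b c)) (hone : ∀ a, μ e a = a)
    (hone' : ∀ a, μ a e = a) (x : TensorAlgebra K U) (u : U) :
    tensorEval μ e f (x * TensorAlgebra.ι K u) = μ (tensorEval μ e f x) (f u) := by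
  induction x using tensor_induction_left with
  | one =>
    rw [one_mul, ← mul_one (TensorAlgebra.ι K u), tensorEval_ι_mul, tensorEval_one, hone, hone']
  | smul r x hx => rw [smul_mul_assoc, map_smul, map_smul, hx, map_smul, LinearMap.smul_apply]
  | add x y hx hy => simp only [add_mul, map_add, LinearMap.add_apply, hx, hy]
  | mul v x hx => rw [mul_assoc, tensorEval_ι_mul, hx, tensorEval_ι_mul, hassoc]

variable {c : U ⊗[K] U →ₗ[K] U ⊗[K] U} {d : B ⊗[K] B →ₗ[K] B ⊗[K] B}

/-- The braidings agree on letters by `hf`; the hexagon `hd'` in `B` carries this to words, one last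
letter at a time. -/
theorem tensorEval_vecBraiding (hassoc : ∀ a b c, μ (μ a b) c = μ a (μ b c))
    (hone : ∀ a, μ e a = a) (hone' : ∀ a, μ a e = a)
    (hd : ∀ a, d (a ⊗ₜ e) = e ⊗ₜ a)
    (hd' : ∀ a b b', d (a ⊗ₜ μ b b') = brProd μ d (d (a ⊗ₜ b)) (b' ⊗ₜ e))
    (hf : IsBraidedMap f c d) (u : U) (x : TensorAlgebra K U) :
    d (f u ⊗ₜ tensorEval μ e f x) =
      TensorProduct.map (tensorEval μ e f) f (vecBraiding c (u ⊗ₜ x)) := by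
  induction x using tensor_induction_right with
  | one => simp [tensorEval_one, hd, vecBraiding_one]
  | smul r x hx => simp only [map_smul, TensorProduct.tmul_smul, hx]
  | add x y hx hy => simp only [map_add, TensorProduct.tmul_add, hx, hy]
  | mul x w hx =>
    rw [tensorEval_mul_ι hassoc hone hone', hd', hx, vecBraiding_mul_ι]
    generalize vecBraiding c (u ⊗ₜ x) = z
    induction z with
    | zero => simp
    | add a b ha hb => simp only [map_add, LinearMap.add_apply, ha, hb]
    | tmul s v =>
      have hflip : μ.flip e = LinearMap.id := LinearMap.ext hone'
      have hf' := hf (v ⊗ₜ w)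
      rw [tensorSq_tmul] at hf'
      rw [TensorProduct.map_tmul, brProd_tmul, brRight_tmul, hflip, LinearMap.lTensor_id,
        LinearMap.id_apply, hf', crossing_tmul]
      generalize c (v ⊗ₜ w) = p
      induction p with
      | zero => simp
      | add a b ha hb => simp only [map_add, TensorProduct.tmul_add, ha, hb]
      | tmul a b => simp [tensorEval_mul_ι hassoc hone hone']

/-- The hypothesis `hD'` says that `D` is multiplicative against a primitive letter, which is the
recursion defining `comul`. -/
theorem tensorEval_comul (hassoc : ∀ a b c, μ (μ a b) c = μ a (μ b c))
    (hone : ∀ a, μ e a = a) (hone' : ∀ a, μ a e = a)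
    (hd : ∀ a, d (a ⊗ₜ e) = e ⊗ₜ a)
    (hd' : ∀ a b b', d (a ⊗ₜ μ b b') = brProd μ d (d (a ⊗ₜ b)) (b' ⊗ₜ e))
    (hf : IsBraidedMap f c d) {D : B →ₗ[K] B ⊗[K] B} (hD : D e = e ⊗ₜ e)
    (hD' : ∀ u b, D (μ (f u) b) = (μ (f u)).rTensor B (D b) + brRight μ d (f u) (D b))
    (x : TensorAlgebra K U) :
    D (tensorEval μ e f x) =
      TensorProduct.map (tensorEval μ e f) (tensorEval μ e f) (comul c x) := by
  induction x using tensor_induction_left with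
  | one => simp [tensorEval_one, hD, comul_one]
  | smul r x hx => simp only [map_smul, hx]
  | add x y hx hy => simp only [map_add, hx, hy]
  | mul u x hx =>
    rw [tensorEval_ι_mul, hD', hx, comul_ι_mul, map_add]
    generalize comul c x = z
    congr 1
    · induction z with
      | zero => simp
      | add a b ha hb => simp only [map_add, ha, hb]
      | tmul s t => simp [leftVecMul_tmul, tensorEval_ι_mul]
    · induction z with
      | zero => simp
      | add a b ha hb => simp only [map_add, ha, hb]
      | tmul s t =>
        rw [TensorProduct.map_tmul, brRight_tmul,
          tensorEval_vecBraiding hassoc hone hone' hd hd' hf, rightVecMul_tmul]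
        generalize vecBraiding c (u ⊗ₜ s) = z
        induction z with
        | zero => simp
        | add a b ha hb => simp only [map_add, TensorProduct.add_tmul, ha, hb]
        | tmul a b => simp [tensorEval_ι_mul]

/-- The analogue of the quantum symmetrizer for a coalgebra `B` with a projection `p` to a space of
primitive elements. -/
noncomputable def projSymmetrizer (ε : B →ₗ[K] K) (p : B →ₗ[K] U) (D : B →ₗ[K] B ⊗[K] B) :
    ℕ → (B →ₗ[K] TensorAlgebra K U)
  | 0 => Algebra.linearMap K (TensorAlgebra K U) ∘ₗ ε
  | n + 1 => vecMul K U ∘ₗ TensorProduct.map p (projSymmetrizer ε p D n) ∘ₗ D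

/-- The projection `p` need not kill products of letters. The bound `m ≤ n` compensates: if the left
leg takes two or more letters, too few remain on the right for the symmetrizer to be nonzero. A left
leg of degree zero is killed by `p e = 0`. -/
theorem projSymmetrizer_tensorEval {ε : B →ₗ[K] K} {p : B →ₗ[K] U} {D : B →ₗ[K] B ⊗[K] B}
    (hone' : ∀ a, μ a e = a) (hε : ε e = 1) (hp : p e = 0) (hpf : ∀ u, p (f u) = u)
    (hD : ∀ x, D (tensorEval μ e f x) =
      TensorProduct.map (tensorEval μ e f) (tensorEval μ e f) (comul c x))
    {n m : ℕ} (hmn : m ≤ n) {x : TensorAlgebra K U} (hx : x ∈ tensorDegree K U m) :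
    projSymmetrizer ε p D n (tensorEval μ e f x) = symmetrizer c n x := by
  induction n generalizing m x with
  | zero =>
    obtain rfl : m = 0 := by omega
    obtain ⟨r, rfl⟩ := mem_tensorDegree_zero hx
    rw [symmetrizer_zero_apply, algebraMapInv_algebraMap, Algebra.algebraMap_eq_smul_one, map_smul,
      tensorEval_one]
    simp [projSymmetrizer, hε, Algebra.algebraMap_eq_smul_one]
  | succ n ih =>
    change vecMul K U (TensorProduct.map p (projSymmetrizer ε p D n) (D (tensorEval μ e f x))) =
      vecMul K U (TensorProduct.map TensorAlgebra.ιInv (symmetrizer c n) (comul c x))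
    rw [hD]
    congr 1
    have h := comul_mem_bidegree c hx
    generalize comul c x = z at h
    rw [bidegree] at h
    induction h using Submodule.span_induction with
    | zero => simp only [map_zero]
    | add a b _ _ ha hb => simp only [map_add, ha, hb]
    | smul r a _ ha => simp only [map_smul, ha]
    | mem z hz =>
      obtain ⟨i, j, rfl, s, hs, t, ht, rfl⟩ := hz
      rw [TensorProduct.map_tmul, TensorProduct.map_tmul, TensorProduct.map_tmul]
      match i with
      | 0 =>
        obtain ⟨r, rfl⟩ := mem_tensorDegree_zero hs
        rw [ιInv_algebraMap, Algebra.algebraMap_eq_smul_one, map_smul, tensorEval_one, map_smul, hp,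
          smul_zero, TensorProduct.zero_tmul, TensorProduct.zero_tmul]
      | 1 =>
        rw [ih (by omega) ht, ← ι_ιInv hs, ιInv_ι, ← mul_one (TensorAlgebra.ι K _),
          tensorEval_ι_mul, tensorEval_one, hone', hpf]
      -- Here `i + 2 + j ≤ n + 1` forces `j < n`, so the right leg vanishes whatever `p` does on the
      -- left.
      | i + 2 =>
        rw [ih (by omega) ht, symmetrizer_eq_zero_of_ne c (by omega) ht, TensorProduct.tmul_zero,
          TensorProduct.tmul_zero]

/-- If a noetherian braided bialgebra `B` contains the braided space `U` as a direct summand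
complementary to the unit, consisting of primitive elements, then the Nichols algebra of `U` is
finitely generated. -/
theorem nicholsAlgebra_finite_of_primitive [IsNoetherian K B] [Module.Finite K U]
    (hassoc : ∀ a b c, μ (μ a b) c = μ a (μ b c))
    (hone : ∀ a, μ e a = a) (hone' : ∀ a, μ a e = a)
    (hd : ∀ a, d (a ⊗ₜ e) = e ⊗ₜ a)
    (hd' : ∀ a b b', d (a ⊗ₜ μ b b') = brProd μ d (d (a ⊗ₜ b)) (b' ⊗ₜ e))
    (hf : IsBraidedMap f c d) {D : B →ₗ[K] B ⊗[K] B} (hD : D e = e ⊗ₜ e)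
    (hD' : ∀ u b, D (μ (f u) b) = (μ (f u)).rTensor B (D b) + brRight μ d (f u) (D b))
    {ε : B →ₗ[K] K} {p : B →ₗ[K] U} (hε : ε e = 1) (hp : p e = 0) (hpf : ∀ u, p (f u) = u) :
    Module.Finite K (NicholsAlgebra c) := by
  have hφ := tensorEval_comul hassoc hone hone' hd hd' hf hD hD'
  let F : ℕ →o Submodule K B :=
    ⟨fun n => (tensorDegreeLT K U n).map (tensorEval μ e f),
      fun _ _ h => Submodule.map_mono (tensorDegreeLT_mono h)⟩
  obtain ⟨N, hN⟩ := monotone_stabilizes_iff_noetherian.mpr ‹IsNoetherian K B› F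
  refine nicholsAlgebra_finite c (N := N) fun n hn x hx => ?_
  have hmem : tensorEval μ e f x ∈ F (n + 1) :=
    ⟨x, tensorDegree_le_tensorDegreeLT n.lt_succ_self hx, rfl⟩
  -- Stabilization replaces `x` by some `y` of degree below `N` with the same image in `B`; the
  -- projected symmetrizer cannot tell them apart, and `Δ_{1ⁿ}` kills `y`.
  rw [← hN (n + 1) (by omega)] at hmem
  obtain ⟨y, hy, hyx⟩ := hmem
  have hle : tensorDegreeLT K U N ≤ LinearMap.eqLocus
      (projSymmetrizer ε p D n ∘ₗ tensorEval μ e f) (symmetrizer c n) := by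
    refine iSup₂_le fun m hm z hz => ?_
    exact projSymmetrizer_tensorEval hone' hε hp hpf hφ
      (by have := Finset.mem_range.mp hm; omega) hz
  have hy' : projSymmetrizer ε p D n (tensorEval μ e f y) = symmetrizer c n y := hle hy
  rw [← projSymmetrizer_tensorEval hone' hε hp hpf hφ le_rfl hx, ← hyx, hy',
    symmetrizer_eq_zero_of_mem_tensorDegreeLT c hn hy]

end Primitive

/-! ### Naturality under maps of braided modules and base change. -/

section Naturality

variable {R K M N : Type*} [CommRing R] [CommRing K] [Algebra R K] [AddCommGroup M] [Module R M]
  [AddCommGroup N] [Module R N] [Module K N] [IsScalarTower R K N]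
  {X Y : Type*} [AddCommGroup X] [Module R X] [AddCommGroup Y] [Module R Y] [Module K Y]
  [IsScalarTower R K Y]

/-- The map `M ⊗_R X → N ⊗_K Y`, `x ⊗ y ↦ f x ⊗ g y`, for `R`-linear maps `f` and `g` into modules
over the `R`-algebra `K`. -/
noncomputable def semiMap (K : Type*) [CommRing K] [Algebra R K] [Module K N]
    [IsScalarTower R K N] [Module K Y] [IsScalarTower R K Y] (f : M →ₗ[R] N) (g : X →ₗ[R] Y) :
    M ⊗[R] X →ₗ[R] N ⊗[K] Y :=
  TensorProduct.lift ((((TensorProduct.mk K N Y).restrictScalars₁₂ R R).compl₂ g) ∘ₗ f)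

@[simp] theorem semiMap_tmul (f : M →ₗ[R] N) (g : X →ₗ[R] Y) (x : M) (y : X) :
    semiMap K f g (x ⊗ₜ y) = f x ⊗ₜ g y := by
  simp [semiMap]

/-- The map of tensor algebras induced by an `R`-linear map into a module over the `R`-algebra
`K`. -/
noncomputable def tensorMap (K : Type*) [CommRing K] [Algebra R K] [Module K N]
    [IsScalarTower R K N] (f : M →ₗ[R] N) : TensorAlgebra R M →ₐ[R] TensorAlgebra K N :=
  TensorAlgebra.lift R ((TensorAlgebra.ι K).restrictScalars R ∘ₗ f)

variable {f : M →ₗ[R] N} {c : M ⊗[R] M →ₗ[R] M ⊗[R] M} {d : N ⊗[K] N →ₗ[K] N ⊗[K] N}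

theorem tensorMap_ι (v : M) :
    tensorMap K f (TensorAlgebra.ι R v) = TensorAlgebra.ι K (f v) := by
  simp [tensorMap]

theorem braidFirst_semiMap (hf : IsBraidedMap f c d) (g : X →ₗ[R] Y) (z : M ⊗[R] (M ⊗[R] X)) :
    braidFirst d Y (semiMap K f (semiMap K f g) z) =
      semiMap K f (semiMap K f g) (braidFirst c X z) := by
  induction z with
  | zero => simp
  | add a b ha hb => simp only [map_add, ha, hb]
  | tmul v z =>
    induction z with
    | zero => simp
    | add a b ha hb => simp only [map_add, TensorProduct.tmul_add, ha, hb]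
    | tmul u x =>
      have := hf (v ⊗ₜ u)
      rw [tensorSq_tmul] at this
      rw [semiMap_tmul, semiMap_tmul, braidFirst_tmul, braidFirst_tmul, this]
      generalize c (v ⊗ₜ u) = p
      induction p with
      | zero => simp
      | add a b ha hb => simp only [map_add, TensorProduct.add_tmul, ha, hb]
      | tmul a b => simp

theorem vecMul_semiMap (z : M ⊗[R] TensorAlgebra R M) :
    vecMul K N (semiMap K f (tensorMap K f).toLinearMap z) = tensorMap K f (vecMul R M z) := by
  induction z with
  | zero => simp
  | add a b ha hb => simp only [map_add, ha, hb]
  | tmul v x => simp [tensorMap_ι]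

theorem letterAct_semiMap (hf : IsBraidedMap f c d) (v : M) (z : M ⊗[R] TensorAlgebra R M) :
    letterAct d (f v) (semiMap K f (tensorMap K f).toLinearMap z) =
      semiMap K f (tensorMap K f).toLinearMap (letterAct c v z) := by
  have h := braidFirst_semiMap hf (tensorMap K f).toLinearMap (v ⊗ₜ z)
  rw [semiMap_tmul] at h
  rw [letterAct_apply, h, letterAct_apply]
  generalize braidFirst c _ (v ⊗ₜ z) = y
  induction y with
  | zero => simp
  | add a b ha hb => simp only [map_add, ha, hb]
  | tmul a y => simp [vecMul_semiMap]

theorem skewDer_tensorMap (hf : IsBraidedMap f c d) (x : TensorAlgebra R M) :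
    skewDer d (tensorMap K f x) = semiMap K f (tensorMap K f).toLinearMap (skewDer c x) := by
  induction x using tensor_induction_left with
  | one => simp
  | smul r x hx => simp only [map_smul, LinearMap.map_smul_of_tower, hx]
  | add x y hx hy => simp only [map_add, hx, hy]
  | mul v x hx =>
    rw [map_mul, tensorMap_ι, skewDer_ι_mul, hx, letterAct_semiMap hf, skewDer_ι_mul, map_add,
      semiMap_tmul]
    rfl

/-- The quantum symmetrizer is natural with respect to maps of braided modules. -/
theorem symmetrizer_tensorMap (hf : IsBraidedMap f c d) (n : ℕ) (x : TensorAlgebra R M) :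
    symmetrizer d n (tensorMap K f x) = tensorMap K f (symmetrizer c n x) := by
  induction n generalizing x with
  | zero =>
    induction x using tensor_induction_left with
    | one => simp [symmetrizer_zero_apply]
    | smul r x hx => simp only [map_smul, LinearMap.map_smul_of_tower, hx]
    | add x y hx hy => simp only [map_add, hx, hy]
    | mul v x _ => simp [symmetrizer_zero_apply, tensorMap_ι, algebraMapInv_ι]
  | succ n ih =>
    rw [symmetrizer_succ_apply, symmetrizer_succ_apply, ← vecMul_semiMap, skewDer_tensorMap hf]
    congr 1
    generalize skewDer c x = z
    induction z with
    | zero => simp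
    | add a b ha hb => simp only [map_add, ha, hb]
    | tmul v y => simp [ih]

variable (f) in
-- The map factors as `M ⊗_R X → M ⊗_R Y`, injective by flatness, followed by the base change
-- isomorphism of `M ⊗_R Y` with `N ⊗_K Y`.
theorem semiMap_injective [Module.Flat R M]
    (hf : Function.Bijective (f.liftBaseChange K)) {g : X →ₗ[R] Y}
    (hg : Function.Injective g) : Function.Injective (semiMap K f g) := by
  let e := LinearEquiv.ofBijective _ hf
  let E : M ⊗[R] Y → N ⊗[K] Y := fun z => TensorProduct.comm K Y N
    (e.lTensor Y ((TensorProduct.AlgebraTensorModule.cancelBaseChange R K K Y M).symm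
      (TensorProduct.comm R M Y z)))
  have hE : Function.Injective E :=
    (TensorProduct.comm K Y N).injective.comp ((e.lTensor Y).injective.comp
      ((TensorProduct.AlgebraTensorModule.cancelBaseChange R K K Y M).symm.injective.comp
        (TensorProduct.comm R M Y).injective))
  have h (z : M ⊗[R] X) : semiMap K f g z = E (g.lTensor M z) := by
    induction z with
    | zero => simp [E]
    | add a b ha hb =>
      rw [map_add, ha, hb]
      simp [E]
    | tmul v x => simp [E, e]
  have : ⇑(semiMap K f g) = E ∘ g.lTensor M := funext h
  rw [this]
  exact hE.comp (Module.Flat.lTensor_preserves_injective_linearMap g hg)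

theorem tensor_components_eq_zero {s : Finset ℕ} {y : ℕ → TensorAlgebra R M}
    (hy : ∀ n, y n ∈ tensorDegree R M n) (h : ∑ n ∈ s, y n = 0) {n : ℕ} (hn : n ∈ s) :
    y n = 0 := by
  classical
  let 𝒜 : ℕ → Submodule R (TensorAlgebra R M) := tensorDegree R M
  let : GradedAlgebra 𝒜 := TensorAlgebra.gradedAlgebra
  have h1 : (DirectSum.decompose 𝒜 (∑ m ∈ s, y m) n : TensorAlgebra R M) = y n := by
    rw [DirectSum.decompose_sum, DFinsupp.finsetSum_apply, AddSubmonoidClass.coe_finsetSum,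
      Finset.sum_eq_single_of_mem n hn]
    · exact DirectSum.decompose_of_mem_same 𝒜 (hy n)
    · exact fun m _ hm => DirectSum.decompose_of_mem_ne 𝒜 (hy m) hm
  rw [← h1, h]
  simp

theorem tensorMap_mem {n : ℕ} {x : TensorAlgebra R M} (hx : x ∈ tensorDegree R M n) :
    tensorMap K f x ∈ tensorDegree K N n := by
  suffices H : tensorDegree R M n ≤
    ((tensorDegree K N n).restrictScalars R).comap (tensorMap K f).toLinearMap from H hx
  clear x hx
  induction n with
  | zero =>
    intro x hx
    obtain ⟨r, rfl⟩ := mem_tensorDegree_zero hx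
    simp only [Algebra.algebraMap_eq_smul_one]
    refine Submodule.smul_mem _ _ ?_
    simpa using one_mem_tensorDegree_zero
  | succ n ih =>
    refine tensorDegree_succ_le fun v x hx => ?_
    have := ι_mul_mem_tensorDegree (f v) (ih hx)
    simpa [tensorMap_ι] using this

variable (f) in
theorem tensorMap_injective [Module.Flat R M]
    (hf : Function.Bijective (f.liftBaseChange K)) (hK : Function.Injective (algebraMap R K)) :
    Function.Injective (tensorMap K f) := by
  have key : ∀ n, ∀ x ∈ tensorDegree R M n, tensorMap K f x = 0 → x = 0 := by
    intro n
    induction n with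
    | zero =>
      intro x hx h
      obtain ⟨r, rfl⟩ := mem_tensorDegree_zero hx
      rw [AlgHom.commutes, IsScalarTower.algebraMap_apply R K,
        TensorAlgebra.algebraMap_eq_zero_iff, map_eq_zero_iff _ hK] at h
      rw [h, map_zero]
    | succ n ih =>
      intro x hx h
      obtain ⟨_, ⟨z, rfl⟩, rfl⟩ := exists_vecMul_eq hx
      -- The inductive hypothesis gives injectivity only on degree `n`, so the tail of the tensor is
      -- restricted to that submodule before `semiMap_injective` is applied.
      have hinj : Function.Injective
          ((tensorMap K f).toLinearMap ∘ₗ (tensorDegree R M n).subtype) := by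
        rw [← LinearMap.ker_eq_bot, LinearMap.ker_eq_bot']
        exact fun y hy => Subtype.ext (ih y y.2 hy)
      have h1 (z : M ⊗[R] tensorDegree R M n) : semiMap K f (tensorMap K f).toLinearMap
          ((tensorDegree R M n).subtype.lTensor M z) = semiMap K f
            ((tensorMap K f).toLinearMap ∘ₗ (tensorDegree R M n).subtype) z := by
        induction z with
        | zero => simp
        | add a b ha hb => simp only [map_add, ha, hb]
        | tmul v y => simp
      rw [← vecMul_semiMap, h1, map_eq_zero_iff _ vecMul_injective,
        map_eq_zero_iff _ (semiMap_injective f hf hinj)] at h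
      rw [h, map_zero, map_zero]
  rw [injective_iff_map_eq_zero]
  intro x hx
  obtain ⟨s, y, hy, -, rfl⟩ := exists_tensor_components x
  rw [map_sum] at hx
  exact Finset.sum_eq_zero fun n hn => key n _ (hy n)
    (tensor_components_eq_zero (fun n => tensorMap_mem (hy n)) hx hn)

theorem IsYangBaxter.of_isBraidedMap [Module.Flat R M]
    (hf : Function.Bijective (f.liftBaseChange K)) (hinj : Function.Injective f)
    (hcd : IsBraidedMap f c d) (hd : IsYangBaxter d) : IsYangBaxter c := by
  intro z
  apply semiMap_injective f hf (semiMap_injective f hf hinj)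
  have h (z : M ⊗[R] (M ⊗[R] M)) : semiMap K f (semiMap K f f) (c.lTensor M z) =
      d.lTensor N (semiMap K f (semiMap K f f) z) := by
    induction z with
    | zero => simp
    | add a b ha hb => simp only [map_add, ha, hb]
    | tmul v p =>
      rw [LinearMap.lTensor_tmul, semiMap_tmul, semiMap_tmul, LinearMap.lTensor_tmul]
      congr 1
      exact (hcd p).symm
  rw [← braidFirst_semiMap hcd, h, ← braidFirst_semiMap hcd, hd, h, ← braidFirst_semiMap hcd, h]

end Naturality

/-! ### Relations and symmetrizers of an order. -/

section Order

variable {k V : Type*} [Field k] [AddCommGroup V] [Module k V] {c : V ⊗[k] V →ₗ[k] V ⊗[k] V}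
  {R : Subring k} {VR : Submodule R V}

theorem IsOrder.flat (h : IsOrder c R VR) : Module.Flat R VR :=
  have := h.projective
  inferInstance

/-- Shows that `orderBraiding` is not the default value: `V_R ⊗ V_R` embeds in `V ⊗ V` by flatness,
and `c` preserves its image. -/
theorem IsOrder.isBraidedMap (h : IsOrder c R VR) :
    IsBraidedMap VR.subtype (orderBraiding c R VR) c := by
  have hflat := h.flat
  have hex : ∃ cR, IsBraidedMap VR.subtype cR c := by
    have hinj : Function.Injective (tensorSq k VR.subtype) :=
      semiMap_injective VR.subtype h.bijective VR.injective_subtype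
    let g : VR ⊗[R] VR →ₗ[R] LinearMap.range (tensorSq k VR.subtype) :=
      (c.restrictScalars R ∘ₗ tensorSq k VR.subtype).codRestrict _
        fun z => h.map_le ⟨_, ⟨z, rfl⟩, rfl⟩
    refine ⟨(LinearEquiv.ofInjective _ hinj).symm.toLinearMap ∘ₗ g, fun z => ?_⟩
    have := LinearEquiv.apply_symm_apply (LinearEquiv.ofInjective _ hinj) (g z)
    exact (congrArg Subtype.val this).symm
  rw [orderBraiding, restrictBraiding, dif_pos hex]
  exact hex.choose_spec

theorem IsOrder.isYangBaxter (h : IsOrder c R VR) (hc : IsYangBaxter c) :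
    IsYangBaxter (orderBraiding c R VR) :=
  have := h.flat
  IsYangBaxter.of_isBraidedMap h.bijective VR.injective_subtype h.isBraidedMap hc

theorem IsOrder.tensorMap_injective (h : IsOrder c R VR) :
    Function.Injective (tensorMap k VR.subtype) :=
  have := h.flat
  Nichols.tensorMap_injective VR.subtype h.bijective Subtype.val_injective

/-- By naturality and injectivity of `T(V_R) → T(V)`, a symmetrizer vanishes on a tensor over `R`
exactly when it vanishes over `k`. The general results on the relations of a finitely generated
projective braided module thus apply to the order. -/
theorem IsOrder.orderIdeal_eq (h : IsOrder c R VR) :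
    orderIdeal c R VR = nicholsIdeal (orderBraiding c R VR) := by
  ext x
  have : x ∈ orderIdeal c R VR ↔ tensorMap k VR.subtype x ∈ nicholsIdeal c := Iff.rfl
  rw [this, mem_nicholsIdeal, mem_nicholsIdeal]
  refine forall_congr' fun n => ?_
  rw [symmetrizer_tensorMap h.isBraidedMap, map_eq_zero_iff _ h.tensorMap_injective]

/-- If the Nichols algebra of `V` is finite-dimensional, then the quantum symmetrizers of an order
vanish in large degrees. -/
theorem IsOrder.exists_symmetrizer_eq_zero (h : IsOrder c R VR)
    (hfin : FiniteDimensional k (NicholsAlgebra c)) :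
    ∃ N, ∀ n ≥ N, ∀ x, symmetrizer (orderBraiding c R VR) n x = 0 := by
  obtain ⟨N, hN⟩ := Nichols.exists_symmetrizer_eq_zero c hfin
  refine ⟨N, fun n hn x => h.tensorMap_injective ?_⟩
  rw [← symmetrizer_tensorMap h.isBraidedMap, hN n hn, map_zero]

end Order

/-! ### The braid equation for Yetter-Drinfeld modules. -/

section YetterDrinfeld

variable {k H V : Type*} [Field k] [Ring H] [Bialgebra k H] [AddCommGroup V] [Module k V]
  [Module H V] [IsScalarTower k H V]

/-- The map `h ⊗ v ↦ h w ⊗ v`. -/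
noncomputable def actFst (k H : Type*) {V : Type*} [Field k] [Ring H] [Bialgebra k H]
    [AddCommGroup V] [Module k V] [Module H V] [IsScalarTower k H V] (w : V) :
    H ⊗[k] V →ₗ[k] V ⊗[k] V :=
  ((Algebra.lsmul k k V : H →ₐ[k] Module.End k V).toLinearMap.flip w).rTensor V

@[simp] theorem actFst_tmul (w : V) (h : H) (v : V) :
    actFst k H w (h ⊗ₜ v) = (h • w) ⊗ₜ v := by
  simp [actFst]

variable [YetterDrinfeld k H V]

local notation "δ" => YetterDrinfeld.coact (k := k) (H := H) (V := V)

theorem ydBraiding_tmul (v w : V) : ydBraiding k H V (v ⊗ₜ w) = actFst k H w (δ v) := by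
  have (y : H ⊗[k] V) :
      (TensorProduct.lift (Algebra.lsmul k k V : H →ₐ[k] Module.End k V).toLinearMap).rTensor V
        (TensorProduct.rightComm k H V V (y ⊗ₜ w)) = actFst k H w y := by
    induction y with
    | zero => simp
    | add a b ha hb => simp only [map_add, TensorProduct.add_tmul, ha, hb]
    | tmul a b => simp
  simp [ydBraiding, this]

theorem ydBraiding_lTensor_assoc (y : H ⊗[k] V) (w x : V) :
    (ydBraiding k H V).lTensor V (TensorProduct.assoc k V V V (actFst k H w y ⊗ₜ x)) =
      TensorProduct.map
        ((Algebra.lsmul k k V : H →ₐ[k] Module.End k V).toLinearMap.flip w) (actFst k H x)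
        (LinearMap.lTensor H δ y) := by
  induction y with
  | zero => simp
  | add a b ha hb => simp only [map_add, TensorProduct.add_tmul, ha, hb]
  | tmul a b => simp [ydBraiding_tmul]

theorem lTensor_coact (v : V) : LinearMap.lTensor H δ (δ v) =
    TensorProduct.assoc k H H V ((Coalgebra.comul (R := k) (A := H)).rTensor V (δ v)) :=
  (LinearMap.congr_fun (YetterDrinfeld.coassoc (k := k) (H := H) (V := V)) v).symm

/-- The left hand side of the Yetter-Drinfeld compatibility, as a function of `h₍₁₎ ⊗ h₍₂₎`. -/
noncomputable def ydCompatLeft (k : Type*) {H V : Type*} [Field k] [Ring H] [Bialgebra k H]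
    [AddCommGroup V] [Module k V] [Module H V] [IsScalarTower k H V] [YetterDrinfeld k H V]
    (w : V) : H ⊗[k] H →ₗ[k] H ⊗[k] V :=
  (LinearMap.mul' k H).rTensor V ∘ₗ (TensorProduct.rightComm k H V H).toLinearMap ∘ₗ
    (YetterDrinfeld.coact ∘ₗ
      (Algebra.lsmul k k V : H →ₐ[k] Module.End k V).toLinearMap.flip w).rTensor H

/-- The right hand side of the Yetter-Drinfeld compatibility, as a function of `h₍₁₎ ⊗ h₍₂₎` and
`v₍₋₁₎ ⊗ v₍₀₎`. -/
noncomputable def ydCompatRight (k H V : Type*) [Field k] [Ring H] [Bialgebra k H]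
    [AddCommGroup V] [Module k V] [Module H V] [IsScalarTower k H V] :
    (H ⊗[k] H) ⊗[k] (H ⊗[k] V) →ₗ[k] H ⊗[k] V :=
  TensorProduct.map (LinearMap.mul' k H)
    (TensorProduct.lift (Algebra.lsmul k k V : H →ₐ[k] Module.End k V).toLinearMap) ∘ₗ
      (TensorProduct.tensorTensorTensorComm k H H H V).toLinearMap

theorem ydCompat (h : H) (w : V) :
    ydCompatLeft k w (Coalgebra.comul (R := k) h) =
      ydCompatRight k H V (Coalgebra.comul (R := k) h ⊗ₜ δ w) :=
  YetterDrinfeld.compat h w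

/-- With `y` the coaction of `v`, coassociativity brings one side of the braid equation on `v ⊗ w ⊗
x` to this form, in which `w` is coacted on after `h₍₁₎` has acted on it. -/
theorem braidFirst_ydBraiding_left (w x : V) (y : H ⊗[k] V) :
    braidFirst (ydBraiding k H V) V (TensorProduct.map
        ((Algebra.lsmul k k V : H →ₐ[k] Module.End k V).toLinearMap.flip w) (actFst k H x)
        (TensorProduct.assoc k H H V ((Coalgebra.comul (R := k) (A := H)).rTensor V y))) =
      TensorProduct.assoc k V V V ((actFst k H x ∘ₗ ydCompatLeft k w ∘ₗ
        Coalgebra.comul (R := k) (A := H)).rTensor V y) := by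
  induction y with
  | zero => simp
  | add a b ha hb => simp only [map_add, ha, hb]
  | tmul h v =>
    simp only [LinearMap.rTensor_tmul, LinearMap.comp_apply]
    generalize Coalgebra.comul (R := k) h = C
    induction C with
    | zero => simp
    | add a b ha hb => simp only [map_add, TensorProduct.add_tmul, ha, hb]
    | tmul h₁ h₂ =>
      simp only [TensorProduct.assoc_tmul, TensorProduct.map_tmul, actFst_tmul, braidFirst_tmul,
        ydBraiding_tmul, ydCompatLeft, LinearMap.comp_apply, LinearMap.rTensor_tmul,
        LinearEquiv.coe_coe]
      simp only [LinearMap.flip_apply, AlgHom.toLinearMap_apply, Algebra.lsmul_coe]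
      congr 2
      generalize (δ (h₁ • w)) = z
      induction z with
      | zero => simp
      | add a b ha hb => simp only [map_add, TensorProduct.add_tmul, ha, hb]
      | tmul a b => simp [mul_smul]

/-- The other side of the braid equation, with `z` the coaction of `w`: here the coaction of `w`
comes before the action. -/
theorem braidFirst_ydBraiding_right (x v : V) (z : H ⊗[k] V) :
    (ydBraiding k H V).lTensor V
        (braidFirst (ydBraiding k H V) V (v ⊗ₜ actFst k H x z)) =
      TensorProduct.assoc k V V V ((actFst k H x ∘ₗ
        (ydCompatRight k H V ∘ₗ (TensorProduct.mk k _ _).flip z) ∘ₗ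
        Coalgebra.comul (R := k) (A := H)).rTensor V (δ v)) := by
  induction z with
  | zero => simp
  | add a b ha hb =>
    simp only [map_add, TensorProduct.tmul_add, ha, hb, LinearMap.comp_add, LinearMap.add_comp,
      LinearMap.rTensor_add, LinearMap.add_apply]
  | tmul g w =>
    rw [actFst_tmul, braidFirst_tmul, ydBraiding_tmul, ydBraiding_lTensor_assoc, lTensor_coact]
    generalize (δ v) = y
    induction y with
    | zero => simp
    | add a b ha hb => simp only [map_add, ha, hb]
    | tmul h v =>
      simp only [LinearMap.rTensor_tmul, LinearMap.comp_apply]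
      generalize Coalgebra.comul (R := k) h = C
      induction C with
      | zero => simp
      | add a b ha hb => simp only [map_add, TensorProduct.add_tmul, ha, hb]
      | tmul h₁ h₂ => simp [ydCompatRight, mul_smul]

/-- The braiding of a Yetter-Drinfeld module satisfies the braid equation. -/
theorem isYangBaxter_ydBraiding : IsYangBaxter (ydBraiding k H V) := by
  intro z
  induction z with
  | zero => simp
  | add a b ha hb => simp only [map_add, ha, hb]
  | tmul v z =>
    induction z with
    | zero => simp
    | add a b ha hb => simp only [map_add, TensorProduct.tmul_add, ha, hb]
    | tmul w x =>
      rw [LinearMap.lTensor_tmul, ydBraiding_tmul w x, braidFirst_ydBraiding_right,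
        braidFirst_tmul, ydBraiding_tmul, ydBraiding_lTensor_assoc, lTensor_coact,
        braidFirst_ydBraiding_left]
      -- The two normal forms differ only in `ydCompatLeft` against `ydCompatRight`, which the
      -- Yetter-Drinfeld condition equates.
      congr 3
      ext h
      simp [ydCompat]

end YetterDrinfeld

/-! ### Quotients of the tensor algebra as braided bialgebras. -/

section Quotient

variable {R K M B U : Type*} [CommRing R] [CommRing K] [Algebra R K] [AddCommGroup M] [Module R M]
  [AddCommGroup B] [Module R B] [Module K B] [IsScalarTower R K B] [AddCommGroup U] [Module K U]
  {c : M ⊗[R] M →ₗ[R] M ⊗[R] M} {d : B ⊗[K] B →ₗ[K] B ⊗[K] B} {q : TensorAlgebra R M →ₗ[R] B}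
  {μ : B →ₗ[K] B →ₗ[K] B}

theorem tensorSq_tensorProd (hμ : ∀ x y, μ (q x) (q y) = q (x * y))
    (hd : IsBraidedMap q (tensorBraiding c) d) (z y : TensorAlgebra R M ⊗[R] TensorAlgebra R M) :
    tensorSq K q (tensorProd c z y) = brProd μ d (tensorSq K q z) (tensorSq K q y) := by
  induction z with
  | zero => simp
  | add a b ha hb => simp only [map_add, LinearMap.add_apply, ha, hb]
  | tmul a b =>
    induction y with
    | zero => simp
    | add a b ha hb => simp only [map_add, ha, hb]
    | tmul s t =>
      have hd' := hd (b ⊗ₜ s)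
      rw [tensorSq_tmul] at hd'
      rw [brProd_tmul, tensorSq_tmul, tensorSq_tmul, brProd_tmul, brRight_tmul, brRight_tmul, hd']
      generalize tensorBraiding c (b ⊗ₜ s) = z
      induction z with
      | zero => simp
      | add a b ha hb => simp only [map_add, ha, hb]
      | tmul x y => simp [hμ]

/-- If a noetherian quotient `B` of the tensor algebra inherits multiplication, braiding and
comultiplication, and contains the braided space `U` as a direct summand complementary to the unit,
consisting of primitive elements, then the Nichols algebra of `U` is finitely generated. -/
theorem nicholsAlgebra_finite_of_quotient [IsNoetherian K B] [Module.Finite K U]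
    (hq : Function.Surjective q) (hμ : ∀ x y, μ (q x) (q y) = q (x * y))
    (hd : IsBraidedMap q (tensorBraiding c) d) {D : B →ₗ[K] B ⊗[K] B}
    (hD : ∀ x, D (q x) = tensorSq K q (comul c x)) {f : U →ₗ[K] B}
    (hprim : ∀ u, D (f u) = f u ⊗ₜ q 1 + q 1 ⊗ₜ f u) {cU : U ⊗[K] U →ₗ[K] U ⊗[K] U}
    (hf : IsBraidedMap f cU d) {ε : B →ₗ[K] K} {p : B →ₗ[K] U} (hε : ε (q 1) = 1)
    (hp : p (q 1) = 0) (hpf : ∀ u, p (f u) = u) : Module.Finite K (NicholsAlgebra cU) := by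
  have hone (a : B) : μ (q 1) a = a := by
    obtain ⟨x, rfl⟩ := hq a
    rw [hμ, one_mul]
  have hone' (a : B) : μ a (q 1) = a := by
    obtain ⟨x, rfl⟩ := hq a
    rw [hμ, mul_one]
  have hd1 (a : B) : d (a ⊗ₜ q 1) = q 1 ⊗ₜ a := by
    obtain ⟨x, rfl⟩ := hq a
    rw [← tensorSq_tmul (K := K), hd, tensorBraiding_one_right, tensorSq_tmul]
  have hd1' (a : B) : d (q 1 ⊗ₜ a) = a ⊗ₜ q 1 := by
    obtain ⟨x, rfl⟩ := hq a
    rw [← tensorSq_tmul (K := K), hd, tensorBraiding_one_left, tensorSq_tmul]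
  -- As `q` is surjective, `comul_mul` descends to `B`, even though only compatibility of `D` with
  -- `q` is assumed.
  have hDmul (a b : B) : D (μ a b) = brProd μ d (D a) (D b) := by
    obtain ⟨x, rfl⟩ := hq a
    obtain ⟨y, rfl⟩ := hq b
    rw [hμ, hD, hD, hD, comul_mul, tensorSq_tensorProd hμ hd]
  refine nicholsAlgebra_finite_of_primitive (μ := μ) (e := q 1) (f := f) (d := d) (D := D)
    (ε := ε) (p := p) ?_ hone hone' hd1 ?_ hf ?_ ?_ hε hp hpf
  · intro a b b'
    obtain ⟨x, rfl⟩ := hq a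
    obtain ⟨y, rfl⟩ := hq b
    obtain ⟨z, rfl⟩ := hq b'
    rw [hμ, hμ, hμ, hμ, mul_assoc]
  · intro a b b'
    obtain ⟨x, rfl⟩ := hq a
    obtain ⟨y, rfl⟩ := hq b
    obtain ⟨z, rfl⟩ := hq b'
    rw [hμ, ← tensorSq_tmul (K := K), hd, tensorBraiding_mul_right, tensorSq_tensorProd hμ hd,
      ← hd, tensorSq_tmul, tensorSq_tmul]
  · rw [hD, comul_one, tensorSq_tmul]
  · intro u b
    have h1 : brRight μ d (q 1) = LinearMap.id := by
      refine TensorProduct.ext' fun s t => ?_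
      rw [brRight_tmul, hd1']
      simp [hone]
    have h2 : μ (q 1) = LinearMap.id := LinearMap.ext hone
    rw [hDmul, hprim, map_add, LinearMap.add_apply, brProd_tmul, brProd_tmul, h1, h2,
      LinearMap.id_apply, LinearMap.rTensor_id, LinearMap.id_apply]

theorem tensorSq_eq_map (f : U →ₗ[K] B) (z : U ⊗[K] U) :
    tensorSq K f z = TensorProduct.map f f z := by
  induction z with
  | zero => simp
  | add a b ha hb => simp only [map_add, ha, hb]
  | tmul a b => simp

/-- A braiding restricts to a direct summand that is stable on both sides. -/
theorem exists_restrictBraiding {f : U →ₗ[K] B} {p : B →ₗ[K] U} (hpf : ∀ u, p (f u) = u)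
    (hl : ∀ u b, d (f u ⊗ₜ b) ∈ LinearMap.range (f.lTensor B))
    (hr : ∀ u b, d (b ⊗ₜ f u) ∈ LinearMap.range (f.rTensor B)) :
    ∃ e, IsBraidedMap (K := K) f e d := by
  have hpf : p ∘ₗ f = LinearMap.id := LinearMap.ext hpf
  -- One stability hypothesis places this element in `B ⊗ f(U)`, the other in `f(U) ⊗ B`. The
  -- idempotent `f ∘ p` therefore fixes it on each leg.
  have key (u u' : U) :
      TensorProduct.map f f (TensorProduct.map p p (d (f u ⊗ₜ f u'))) = d (f u ⊗ₜ f u') := by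
    have h1 : (f ∘ₗ p).lTensor B (d (f u ⊗ₜ f u')) = d (f u ⊗ₜ f u') := by
      obtain ⟨y, hy⟩ := hl u (f u')
      rw [← hy, ← LinearMap.comp_apply, ← LinearMap.lTensor_comp, LinearMap.comp_assoc, hpf,
        LinearMap.comp_id]
    have h2 : (f ∘ₗ p).rTensor B (d (f u ⊗ₜ f u')) = d (f u ⊗ₜ f u') := by
      obtain ⟨y, hy⟩ := hr u' (f u)
      rw [← hy, ← LinearMap.comp_apply, ← LinearMap.rTensor_comp, LinearMap.comp_assoc, hpf,
        LinearMap.comp_id]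
    have h3 : TensorProduct.map f f ∘ₗ TensorProduct.map p p =
        (f ∘ₗ p).rTensor B ∘ₗ (f ∘ₗ p).lTensor B := by
      rw [← TensorProduct.map_comp, LinearMap.rTensor_comp_lTensor]
    rw [← LinearMap.comp_apply, h3, LinearMap.comp_apply, h1, h2]
  refine ⟨TensorProduct.map p p ∘ₗ d ∘ₗ TensorProduct.map f f, fun z => ?_⟩
  rw [tensorSq_eq_map, tensorSq_eq_map]
  induction z with
  | zero => simp
  | add a b ha hb => simp only [map_add, ha, hb]
  | tmul u u' => simpa using (key u u').symm

variable [Module R U] [IsScalarTower R K U]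

/-- On single letters `tensorBraiding` is `c`, and the retraction makes `f ⊗ f` injective, so the
identity may be checked in `B ⊗ B`. -/
theorem IsBraidedMap.of_quotient (hd : IsBraidedMap q (tensorBraiding c) d)
    {f : U →ₗ[K] B} {cU : U ⊗[K] U →ₗ[K] U ⊗[K] U} (hf : IsBraidedMap f cU d)
    {p : B →ₗ[K] U} (hpf : ∀ u, p (f u) = u) {g : M →ₗ[R] U}
    (hg : ∀ v, f (g v) = q (TensorAlgebra.ι R v)) : IsBraidedMap g c cU := by
  have hinj : Function.Injective (tensorSq K f) := by
    refine Function.LeftInverse.injective (g := TensorProduct.map p p) fun z => ?_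
    induction z with
    | zero => simp
    | add a b ha hb => simp only [map_add, ha, hb]
    | tmul a b => rw [tensorSq_tmul, TensorProduct.map_tmul, hpf, hpf]
  have hsq (z : M ⊗[R] M) : tensorSq K f (tensorSq K g z) =
      tensorSq K q ((TensorAlgebra.ι R).lTensor _ ((TensorAlgebra.ι R).rTensor M z)) := by
    induction z with
    | zero => simp
    | add a b ha hb => simp only [map_add, ha, hb]
    | tmul a b =>
      rw [tensorSq_tmul, tensorSq_tmul, hg, hg, LinearMap.rTensor_tmul,
        LinearMap.lTensor_tmul, tensorSq_tmul]
  intro z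
  apply hinj
  rw [← hf, hsq, hsq, hd]
  congr 1
  induction z with
  | zero => simp
  | add a b ha hb => simp only [map_add, ha, hb]
  | tmul a b =>
    rw [LinearMap.rTensor_tmul, LinearMap.lTensor_tmul, tensorBraiding_ι_left, vecBraiding_ι]

theorem tensorMap_surjective (hK : Function.Surjective (algebraMap R K)) {g : M →ₗ[R] U}
    (hg : Function.Surjective g) : Function.Surjective (tensorMap K g) := by
  intro x
  induction x using tensor_induction_left with
  | one => exact ⟨1, map_one _⟩
  | smul a x hx =>
    obtain ⟨y, rfl⟩ := hx
    obtain ⟨r, rfl⟩ := hK a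
    exact ⟨r • y, by rw [map_smul, algebraMap_smul]⟩
  | add x y hx hy =>
    obtain ⟨x, rfl⟩ := hx
    obtain ⟨y, rfl⟩ := hy
    exact ⟨x + y, map_add _ _ _⟩
  | mul u x hx =>
    obtain ⟨y, rfl⟩ := hx
    obtain ⟨v, rfl⟩ := hg u
    exact ⟨TensorAlgebra.ι R v * y, by rw [map_mul, tensorMap_ι]⟩

/-- The functional `ε` separates the line of `e` from the image of `f`, so `U × K → B` is injective
and splits over a field. -/
theorem exists_retraction (hK : IsField K) {f : U →ₗ[K] B} (hf : Function.Injective f) {e : B}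
    {ε : B →ₗ[K] K} (hε : ε e = 1) (hεf : ∀ u, ε (f u) = 0) :
    ∃ p : B →ₗ[K] U, p e = 0 ∧ ∀ u, p (f u) = u := by
  let g : U × K →ₗ[K] B := f.coprod (LinearMap.toSpanSingleton K B e)
  have hg : LinearMap.ker g = ⊥ := by
    rw [LinearMap.ker_eq_bot']
    rintro ⟨u, a⟩ hz
    have hz' : f u + a • e = 0 := by simpa [g] using hz
    have ha : a = 0 := by
      have := congrArg ε hz'
      simpa [hεf, hε] using this
    subst ha
    have hu : f u = 0 := by simpa using hz'
    rw [map_eq_zero_iff f hf] at hu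
    rw [hu]
    rfl
  obtain ⟨g', hg'⟩ : ∃ g' : B →ₗ[K] U × K, g' ∘ₗ g = LinearMap.id := by
    let := hK.toField
    exact LinearMap.exists_leftInverse_of_injective g hg
  refine ⟨LinearMap.fst K _ _ ∘ₗ g', ?_, fun u => ?_⟩
  · have := LinearMap.congr_fun hg' (0, 1)
    simpa [g] using congrArg Prod.fst this
  · have := LinearMap.congr_fun hg' (u, 0)
    simpa [g] using congrArg Prod.fst this

end Quotient

/-! ### The specialized Nichols algebra and the primitive subspace. -/

section Specialized

variable {k V : Type*} [Field k] [AddCommGroup V] [Module k V] {c : V ⊗[k] V →ₗ[k] V ⊗[k] V}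
  {R : Subring k} {VR : Submodule R V} {K : Type*} [CommRing K] [Algebra R K]

local notation "T" => TensorAlgebra R VR
local notation "B" => Specialized c R VR K
local notation "q" => specMk c R VR K
local notation "cR" => orderBraiding c R VR

theorem specMk_surjective (hK : Function.Surjective (algebraMap R K)) :
    Function.Surjective q := by
  intro z
  induction z using TensorProduct.induction_on with
  | zero => exact ⟨0, map_zero _⟩
  | add a b ha hb =>
    obtain ⟨x, rfl⟩ := ha
    obtain ⟨y, rfl⟩ := hb
    exact ⟨x + y, map_add _ _ _⟩
  | tmul a b =>
    obtain ⟨r, rfl⟩ := hK a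
    obtain ⟨x, rfl⟩ := (orderIdeal c R VR).mkQ_surjective b
    refine ⟨r • x, ?_⟩
    rw [map_smul, Algebra.algebraMap_eq_smul_one, ← TensorProduct.smul_tmul']
    rfl

theorem specMk_eq_zero {x : T} (hx : x ∈ orderIdeal c R VR) : q x = 0 := by
  have : (orderIdeal c R VR).mkQ x = 0 := (Submodule.Quotient.mk_eq_zero _).mpr hx
  simp [specMk, this]

section Descent

variable {X : Type*} [AddCommGroup X] [Module R X] [Module K X] [IsScalarTower R K X]

/-- The map on `K ⊗_R B(V_R)` induced by a map on the tensor algebra. -/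
noncomputable def specLift (F : T →ₗ[R] X) (hF : orderIdeal c R VR ≤ LinearMap.ker F) :
    B →ₗ[K] X :=
  ((orderIdeal c R VR).liftQ F hF).liftBaseChange K

theorem specLift_specMk (F : T →ₗ[R] X) (hF : orderIdeal c R VR ≤ LinearMap.ker F) (x : T) :
    specLift (K := K) F hF (q x) = F x := by
  simp [specLift, specMk]

theorem exists_specLift₂ (F : T →ₗ[R] T →ₗ[R] X)
    (h₁ : ∀ x ∈ orderIdeal c R VR, ∀ y, F x y = 0)
    (h₂ : ∀ x, ∀ y ∈ orderIdeal c R VR, F x y = 0) :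
    ∃ G : B →ₗ[K] B →ₗ[K] X, ∀ x y, G (q x) (q y) = F x y := by
  have hF : orderIdeal c R VR ≤ LinearMap.ker F := fun x hx => LinearMap.ext fun y => h₁ x hx y
  let G₁ : B →ₗ[K] T →ₗ[R] X := specLift F hF
  have hG₁ (x : T) : G₁ (q x) = F x := specLift_specMk F hF x
  have hle : orderIdeal c R VR ≤ LinearMap.ker G₁.flip := by
    intro y hy
    rw [LinearMap.mem_ker]
    refine LinearMap.ext fun z => ?_
    induction z using TensorProduct.induction_on with
    | zero => rw [map_zero, map_zero]
    | add a b ha hb => rw [map_add, ha, hb, map_add]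
    | tmul a b =>
      obtain ⟨x, rfl⟩ := (orderIdeal c R VR).mkQ_surjective b
      have hx : a ⊗ₜ (orderIdeal c R VR).mkQ x = a • q x := by
        simp [specMk, TensorProduct.smul_tmul']
      rw [hx, map_smul, LinearMap.flip_apply, hG₁, h₂ x y hy, smul_zero, LinearMap.zero_apply]
  refine ⟨(specLift G₁.flip hle).flip, fun x y => ?_⟩
  rw [LinearMap.flip_apply, specLift_specMk, LinearMap.flip_apply, hG₁]

end Descent

theorem IsOrder.exists_specMul (h : IsOrder c R VR) (hc : IsYangBaxter c) :
    ∃ μ : B →ₗ[K] B →ₗ[K] B, ∀ x y, μ (q x) (q y) = q (x * y) := by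
  have := h.finite
  have := h.projective
  refine exists_specLift₂ (X := B)
    (TensorProduct.curry ((q : T →ₗ[R] B) ∘ₗ LinearMap.mul' R T))
    (fun x hx y => ?_) fun x y hy => ?_
  · refine specMk_eq_zero ?_
    rw [h.orderIdeal_eq] at hx ⊢
    exact mul_mem_nicholsIdeal_right (h.isYangBaxter hc) hx y
  · refine specMk_eq_zero ?_
    rw [h.orderIdeal_eq] at hy ⊢
    exact mul_mem_nicholsIdeal_left x hy

/-- The braiding carries `I ⊗ T` into the image of `T ⊗ I` and `T ⊗ I` into that of `I ⊗ T`, and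
both die in `B ⊗ B`. So the induced braiding exists and `specBraiding` is not the default. -/
theorem IsOrder.isBraidedMap_specBraiding (h : IsOrder c R VR) (hc : IsYangBaxter c) :
    IsBraidedMap q (tensorBraiding cR) (specBraiding c R VR K) := by
  have := h.finite
  have := h.projective
  have h₁ : lTensorRange T (orderIdeal c R VR) ≤ LinearMap.ker (tensorSq K q) :=
    lTensorRange_le fun x y hy => by
      rw [LinearMap.mem_ker, tensorSq_tmul, specMk_eq_zero hy, TensorProduct.tmul_zero]
  have h₂ : rTensorRange T (orderIdeal c R VR) ≤ LinearMap.ker (tensorSq K q) :=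
    rTensorRange_le fun x y hy => by
      rw [LinearMap.mem_ker, tensorSq_tmul, specMk_eq_zero hy, TensorProduct.zero_tmul]
  have hex : ∃ d : B ⊗[K] B →ₗ[K] B ⊗[K] B, IsBraidedMap q (tensorBraiding cR) d := by
    have h₃ : ∀ x ∈ orderIdeal c R VR, ∀ y, tensorSq K q (tensorBraiding cR (x ⊗ₜ y)) = 0 := by
      intro x hx y
      refine h₁ ?_
      rw [h.orderIdeal_eq] at hx ⊢
      exact tensorBraiding_nicholsIdeal_left (h.isYangBaxter hc) hx y
    have h₄ : ∀ x, ∀ y ∈ orderIdeal c R VR, tensorSq K q (tensorBraiding cR (x ⊗ₜ y)) = 0 := by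
      intro x y hy
      refine h₂ ?_
      rw [h.orderIdeal_eq] at hy ⊢
      exact tensorBraiding_nicholsIdeal_right (h.isYangBaxter hc) x hy
    let F : T →ₗ[R] T →ₗ[R] B ⊗[K] B := TensorProduct.curry (tensorSq K q ∘ₗ tensorBraiding cR)
    obtain ⟨G, hG⟩ := exists_specLift₂ (X := B ⊗[K] B) (K := K) (F := F)
      (c := c) (VR := VR) h₃ h₄
    refine ⟨TensorProduct.lift G, fun z => ?_⟩
    induction z with
    | zero => simp only [map_zero]
    | add a b ha hb => simp only [map_add, ha, hb]
    | tmul x y => rw [tensorSq_tmul, TensorProduct.lift.tmul, hG]; rfl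
  rw [specBraiding, inducedBraiding, dif_pos hex]
  exact hex.choose_spec

theorem IsOrder.exists_specCounit (h : IsOrder c R VR) :
    ∃ ε : B →ₗ[K] K, ∀ x, ε (q x) = algebraMap R K (TensorAlgebra.algebraMapInv x) := by
  refine ⟨specLift (Algebra.linearMap R K ∘ₗ TensorAlgebra.algebraMapInv.toLinearMap) ?_,
    fun x => specLift_specMk _ _ x⟩
  intro x hx
  rw [h.orderIdeal_eq] at hx
  simp [algebraMapInv_eq_zero_of_mem_nicholsIdeal _ hx]

theorem IsOrder.exists_specProj (h : IsOrder c R VR) :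
    ∃ π : B →ₗ[K] K ⊗[R] VR, ∀ x, π (q x) = 1 ⊗ₜ TensorAlgebra.ιInv x := by
  refine ⟨specLift (TensorProduct.mk R K VR 1 ∘ₗ TensorAlgebra.ιInv) ?_,
    fun x => specLift_specMk _ _ x⟩
  intro x hx
  rw [h.orderIdeal_eq] at hx
  simp [ιInv_eq_zero_of_mem_nicholsIdeal _ hx]

theorem specVec_tmul (a : K) (v : VR) :
    specVec c R VR K (a ⊗ₜ v) = a • q (TensorAlgebra.ι R v) := by
  simp [specVec, specMk, TensorProduct.smul_tmul']

theorem specDegreeGE_le_ker {X : Type*} [AddCommGroup X] [Module K X] {F : B →ₗ[K] X} {n : ℕ}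
    (hF : ∀ m ≥ n, ∀ x ∈ tensorDegree R VR m, F (q x) = 0) :
    specDegreeGE c R VR K n ≤ LinearMap.ker F := by
  refine iSup₂_le fun m hm => ?_
  rw [Submodule.baseChange_eq_span, Submodule.span_le]
  rintro _ ⟨_, ⟨x, hx, rfl⟩, rfl⟩
  exact hF m hm x hx

/-- The inclusion `(u, w) ↦ u + w` of `V_{R,K} ⊕ W` into `K ⊗_R B(V_R)`. -/
noncomputable def sumIncl (W : Submodule K B) : SumSpace c R VR K W →ₗ[K] B :=
  (specVec c R VR K).coprod W.subtype

theorem sumIncl_apply {W : Submodule K B} (v : K ⊗[R] VR) (w : W) : sumIncl W (v, w) = specVec c R VR K v + w := rfl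

/-- Relations have no components in degrees zero and one, so the counit and the projection to degree
one descend to `B`. Both vanish on `W`, which has degree at least two, and together they show that
`V_{R,K}`, `W` and the unit are independent. -/
theorem IsOrder.exists_sumProj {W : Submodule K B} (h : IsOrder c R VR)
    (hK : IsField K)
    (hW : W ≤ specDegreeGE c R VR K 2) :
    ∃ (ε : B →ₗ[K] K) (p : B →ₗ[K] SumSpace c R VR K W), ε (q 1) = 1 ∧ (∀ w ∈ W, ε w = 0) ∧
      p (q 1) = 0 ∧ ∀ u, p (sumIncl W u) = u := by
  obtain ⟨ε, hε⟩ := h.exists_specCounit (K := K)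
  obtain ⟨π, hπ⟩ := h.exists_specProj (K := K)
  have hε1 : ε (q 1) = 1 := by rw [hε, map_one, map_one]
  have hεW : ∀ w ∈ W, ε w = 0 := by
    have : specDegreeGE c R VR K 2 ≤ LinearMap.ker ε := by
      refine specDegreeGE_le_ker fun m hm x hx => ?_
      obtain ⟨m, rfl⟩ := Nat.exists_eq_succ_of_ne_zero (by omega : m ≠ 0)
      rw [hε, algebraMapInv_eq_zero hx, map_zero]
    exact fun w hw => this (hW hw)
  have hπW : ∀ w ∈ W, π w = 0 := by
    have : specDegreeGE c R VR K 2 ≤ LinearMap.ker π := by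
      refine specDegreeGE_le_ker fun m hm x hx => ?_
      rw [hπ, ιInv_eq_zero (by omega) hx, TensorProduct.tmul_zero]
    exact fun w hw => this (hW hw)
  have hεV (v : K ⊗[R] VR) : ε (specVec c R VR K v) = 0 := by
    induction v with
    | zero => simp only [map_zero]
    | add a b ha hb => simp only [map_add, ha, hb, add_zero]
    | tmul a v => rw [specVec_tmul, map_smul, hε, algebraMapInv_ι, map_zero, smul_zero]
  have hπV (v : K ⊗[R] VR) : π (specVec c R VR K v) = v := by
    induction v with
    | zero => simp only [map_zero]
    | add a b ha hb => simp only [map_add, ha, hb]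
    | tmul a v =>
      rw [specVec_tmul, map_smul, hπ, ιInv_ι, TensorProduct.smul_tmul', smul_eq_mul, mul_one]
  have hinj : Function.Injective (sumIncl W) := by
    rw [injective_iff_map_eq_zero]
    rintro ⟨v, w⟩ hz
    rw [sumIncl_apply] at hz
    have hv := congrArg π hz
    rw [map_add, hπV, hπW w w.2, add_zero, map_zero] at hv
    rw [hv, map_zero, zero_add] at hz
    exact Prod.ext hv (Subtype.ext hz)
  have hεf (u : SumSpace c R VR K W) : ε (sumIncl W u) = 0 := by
    obtain ⟨v, w⟩ := u
    rw [sumIncl_apply, map_add, hεV, hεW w w.2, add_zero]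
  obtain ⟨p, hp, hpf⟩ := exists_retraction (U := SumSpace c R VR K W) (f := sumIncl W) hK hinj hε1 hεf
  exact ⟨ε, p, hε1, hεW, hp, hpf⟩

/-- The braiding moves a letter through a word as a single letter, so stability of the degree one
part is automatic; for `W` it is the categorical hypothesis. -/
theorem IsOrder.specBraiding_specVec_left (h : IsOrder c R VR) (hc : IsYangBaxter c)
    (hK : Function.Surjective (algebraMap R K)) (v : K ⊗[R] VR) (b : B) :
    specBraiding c R VR K (specVec c R VR K v ⊗ₜ b) ∈
      LinearMap.range ((specVec c R VR K).lTensor B) := by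
  obtain ⟨t, rfl⟩ := specMk_surjective hK b
  induction v with
  | zero => rw [map_zero, TensorProduct.zero_tmul, map_zero]; exact Submodule.zero_mem _
  | add a b ha hb =>
    rw [map_add, TensorProduct.add_tmul, map_add]
    exact Submodule.add_mem _ ha hb
  | tmul a v =>
    rw [specVec_tmul, ← TensorProduct.smul_tmul', map_smul]
    refine Submodule.smul_mem _ _ ?_
    rw [← tensorSq_tmul (K := K), h.isBraidedMap_specBraiding hc, tensorBraiding_ι_left]
    generalize vecBraiding cR (v ⊗ₜ t) = z
    induction z with
    | zero => simp only [map_zero]; exact Submodule.zero_mem _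
    | add a b ha hb => simp only [map_add]; exact Submodule.add_mem _ ha hb
    | tmul s u =>
      refine ⟨q s ⊗ₜ (1 ⊗ₜ u), ?_⟩
      rw [LinearMap.lTensor_tmul, LinearMap.lTensor_tmul, tensorSq_tmul, specVec_tmul, one_smul]

theorem IsOrder.specBraiding_specVec_right (h : IsOrder c R VR) (hc : IsYangBaxter c)
    (hK : Function.Surjective (algebraMap R K)) (v : K ⊗[R] VR) (b : B) :
    specBraiding c R VR K (b ⊗ₜ specVec c R VR K v) ∈
      LinearMap.range ((specVec c R VR K).rTensor B) := by
  obtain ⟨t, rfl⟩ := specMk_surjective hK b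
  induction v with
  | zero => rw [map_zero, TensorProduct.tmul_zero, map_zero]; exact Submodule.zero_mem _
  | add a b ha hb =>
    rw [map_add, TensorProduct.tmul_add, map_add]
    exact Submodule.add_mem _ ha hb
  | tmul a v =>
    rw [specVec_tmul, TensorProduct.tmul_smul, map_smul]
    refine Submodule.smul_mem _ _ ?_
    rw [← tensorSq_tmul (K := K), h.isBraidedMap_specBraiding hc, tensorBraiding_ι_right]
    generalize braidingVec cR (t ⊗ₜ v) = z
    induction z with
    | zero => simp only [map_zero]; exact Submodule.zero_mem _
    | add a b ha hb => simp only [map_add]; exact Submodule.add_mem _ ha hb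
    | tmul u s =>
      refine ⟨(1 ⊗ₜ u) ⊗ₜ q s, ?_⟩
      rw [LinearMap.rTensor_tmul, LinearMap.rTensor_tmul, tensorSq_tmul, specVec_tmul, one_smul]

theorem specVec_eq_sumIncl_comp (W : Submodule K B) :
    specVec c R VR K = sumIncl W ∘ₗ LinearMap.inl K (K ⊗[R] VR) W :=
  (LinearMap.coprod_inl _ _).symm

theorem subtype_eq_sumIncl_comp (W : Submodule K B) :
    W.subtype = sumIncl W ∘ₗ LinearMap.inr K (K ⊗[R] VR) W :=
  (LinearMap.coprod_inr _ _).symm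

theorem IsOrder.specBraiding_sumIncl_left {W : Submodule K B} (h : IsOrder c R VR)
    (hc : IsYangBaxter c) (hK : Function.Surjective (algebraMap R K))
    (hW : IsCategorical (specBraiding c R VR K) W) (u : SumSpace c R VR K W) (b : B) :
    specBraiding c R VR K (sumIncl W u ⊗ₜ b) ∈ LinearMap.range ((sumIncl W).lTensor B) := by
  obtain ⟨v, w⟩ := u
  rw [sumIncl_apply, TensorProduct.add_tmul, map_add]
  refine Submodule.add_mem _ ?_ ?_
  · have := h.specBraiding_specVec_left hc hK v b
    rw [congrArg (LinearMap.lTensor B) (specVec_eq_sumIncl_comp W), LinearMap.lTensor_comp] at this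
    exact LinearMap.range_comp_le_range _ _ this
  · have : specBraiding c R VR K ((w : B) ⊗ₜ b) ∈ LinearMap.range (W.subtype.lTensor B) := by
      rw [← hW.1]
      exact ⟨_, ⟨w ⊗ₜ b, rfl⟩, rfl⟩
    rw [subtype_eq_sumIncl_comp, LinearMap.lTensor_comp] at this
    exact LinearMap.range_comp_le_range _ _ this

theorem IsOrder.specBraiding_sumIncl_right {W : Submodule K B} (h : IsOrder c R VR)
    (hc : IsYangBaxter c) (hK : Function.Surjective (algebraMap R K))
    (hW : IsCategorical (specBraiding c R VR K) W) (u : SumSpace c R VR K W) (b : B) :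
    specBraiding c R VR K (b ⊗ₜ sumIncl W u) ∈ LinearMap.range ((sumIncl W).rTensor B) := by
  obtain ⟨v, w⟩ := u
  rw [sumIncl_apply, TensorProduct.tmul_add, map_add]
  refine Submodule.add_mem _ ?_ ?_
  · have := h.specBraiding_specVec_right hc hK v b
    rw [congrArg (LinearMap.rTensor B) (specVec_eq_sumIncl_comp W), LinearMap.rTensor_comp] at this
    exact LinearMap.range_comp_le_range _ _ this
  · have : specBraiding c R VR K (b ⊗ₜ (w : B)) ∈ LinearMap.range (W.subtype.rTensor B) := by
      rw [← hW.2]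
      exact ⟨_, ⟨b ⊗ₜ w, rfl⟩, rfl⟩
    rw [subtype_eq_sumIncl_comp, LinearMap.rTensor_comp] at this
    exact LinearMap.range_comp_le_range _ _ this

theorem isBraidedMap_restrictBraiding {R K M N : Type*} [CommRing R] [CommRing K] [Algebra R K]
    [AddCommGroup M] [Module R M] [AddCommGroup N] [Module R N] [Module K N] [IsScalarTower R K N]
    {f : M →ₗ[R] N} {d : N ⊗[K] N →ₗ[K] N ⊗[K] N} (hex : ∃ e, IsBraidedMap f e d) :
    IsBraidedMap f (restrictBraiding f d) d := by
  rw [restrictBraiding, dif_pos hex]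
  exact hex.choose_spec

theorem IsOrder.isBraidedMap_sumBraiding {W : Submodule K B} (h : IsOrder c R VR)
    (hc : IsYangBaxter c) (hK : Function.Surjective (algebraMap R K))
    (hW : IsCategorical (specBraiding c R VR K) W)
    {p : B →ₗ[K] SumSpace c R VR K W} (hp : ∀ u, p (sumIncl W u) = u) :
    IsBraidedMap (R := K) (K := K) (M := SumSpace c R VR K W) (N := B) (sumIncl W)
      (sumBraiding c R VR K W) (specBraiding c R VR K) := by
  have hl := h.specBraiding_sumIncl_left hc hK hW
  have hr := h.specBraiding_sumIncl_right hc hK hW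
  have hex := exists_restrictBraiding (K := K) (U := SumSpace c R VR K W)
    (d := specBraiding c R VR K) (f := sumIncl W) (p := p) hp
    (by intro u b; with_reducible_and_instances exact hl u b)
    (by intro u b; with_reducible_and_instances exact hr u b)
  exact isBraidedMap_restrictBraiding (K := K) (M := SumSpace c R VR K W) (N := B) hex

theorem specVec_primitive {D : B →ₗ[K] B ⊗[K] B} (hD : IsSpecComul c R VR K D) (v : K ⊗[R] VR) :
    D (specVec c R VR K v) = specVec c R VR K v ⊗ₜ q 1 + q 1 ⊗ₜ specVec c R VR K v := by
  induction v with
  | zero => simp only [map_zero, TensorProduct.zero_tmul, TensorProduct.tmul_zero, add_zero]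
  | add a b ha hb =>
    simp only [map_add, ha, hb, TensorProduct.add_tmul, TensorProduct.tmul_add]; abel
  | tmul a v =>
    rw [specVec_tmul, map_smul, hD, comul_ι, map_add, tensorSq_tmul, tensorSq_tmul,
      ← TensorProduct.smul_tmul', TensorProduct.tmul_smul, smul_add]

/-- No comultiplication on `B` is involved: `T(V_R)` surjects onto `T(V_{R,K})`, and by naturality
the vanishing of symmetrizers in large degrees passes to the quotient. -/
theorem IsOrder.sumNichols_finite_of_eq_bot {W : Submodule K B} [Module.Finite K W]
    (h : IsOrder c R VR)
    (hc : IsYangBaxter c) (hK : Function.Surjective (algebraMap R K)) (hW : W = ⊥)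
    (hsum : IsBraidedMap (R := K) (K := K) (M := SumSpace c R VR K W) (N := B) (sumIncl W)
      (sumBraiding c R VR K W) (specBraiding c R VR K))
    {p : B →ₗ[K] SumSpace c R VR K W} (hpf : ∀ u, p (sumIncl W u) = u)
    {N : ℕ} (hN : ∀ n ≥ N, ∀ x, symmetrizer cR n x = 0) :
    Module.Finite K (SumNichols c R VR K W) := by
  have := h.finite
  let f : VR →ₗ[R] SumSpace c R VR K W :=
    (LinearMap.inl K (K ⊗[R] VR) W).restrictScalars R ∘ₗ TensorProduct.mk R K VR 1
  have hfapp (v : VR) : f v = (1 ⊗ₜ v, 0) := rfl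
  have hf : Function.Surjective f := by
    rintro ⟨v, w⟩
    have hw : w = 0 :=
      Subtype.ext ((Submodule.mem_bot K).mp (hW.le w.2))
    subst hw
    induction v with
    | zero => exact ⟨0, map_zero _⟩
    | add a b ha hb =>
      obtain ⟨x, hx⟩ := ha
      obtain ⟨y, hy⟩ := hb
      refine ⟨x + y, ?_⟩
      rw [map_add, hx, hy, Prod.mk_add_mk, add_zero]
    | tmul a v =>
      obtain ⟨r, rfl⟩ := hK a
      refine ⟨r • v, ?_⟩
      rw [hfapp, Algebra.algebraMap_eq_smul_one, TensorProduct.smul_tmul]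
  have hfq (v : VR) : sumIncl W (f v) = q (TensorAlgebra.ι R v) := by
    rw [hfapp, sumIncl_apply, specVec_tmul, one_smul]
    exact add_zero _
  have hfbr := (h.isBraidedMap_specBraiding hc).of_quotient hsum hpf hfq
  refine nicholsAlgebra_finite _ (N := N) fun n hn x _ => ?_
  obtain ⟨y, rfl⟩ := tensorMap_surjective (U := SumSpace c R VR K W) hK hf x
  rw [symmetrizer_tensorMap hfbr, hN n hn, map_zero]

/-- If the Nichols algebra of `V` is finite-dimensional, then so is the Nichols algebra of
`V_{R,K} ⊕ W`, for a residue field `K` of `R` and a categorical space `W` of primitive elements of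
degree at least two. -/
theorem IsOrder.sumNichols_finite {W : Submodule K B} (h : IsOrder c R VR) (hc : IsYangBaxter c)
    (hfield : IsField K) (hK : Function.Surjective (algebraMap R K))
    (hdeg : W ≤ specDegreeGE c R VR K 2) (hcat : IsCategorical (specBraiding c R VR K) W)
    (hprim : ∀ w ∈ W, IsPrimitive c R VR K w)
    (hfin : FiniteDimensional k (NicholsAlgebra c)) :
    Module.Finite K (SumNichols c R VR K W) := by
  have := h.finite
  obtain ⟨N, hN⟩ := h.exists_symmetrizer_eq_zero hfin
  have hBR : Module.Finite R (OrderNichols c R VR) := by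
    refine finite_quotient_of_tensorDegree_le (N := N) fun n hn x hx => ?_
    rw [h.orderIdeal_eq, mem_nicholsIdeal]
    intro m
    by_cases hm : n = m
    · subst hm; exact hN n hn x
    · exact symmetrizer_eq_zero_of_ne _ hm hx
  have hKn : IsNoetherianRing K := by
    let := hfield.toField
    infer_instance
  have hB : IsNoetherian K B := isNoetherian_of_isNoetherianRing_of_finite K B
  obtain ⟨ε, p, hε, hεW, hp, hpf⟩ := h.exists_sumProj hfield hdeg
  have hsum := h.isBraidedMap_sumBraiding hc hK hcat hpf
  by_cases hex : ∃ D, IsSpecComul c R VR K D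
  · have hD : IsSpecComul c R VR K (specComul c R VR K) := by
      rw [specComul, dif_pos hex]
      exact hex.choose_spec
    obtain ⟨μ, hμ⟩ := h.exists_specMul (K := K) hc
    refine nicholsAlgebra_finite_of_quotient (specMk_surjective hK) hμ
      (h.isBraidedMap_specBraiding hc) hD (fun ⟨v, w⟩ => ?_) hsum hε hp hpf
    rw [sumIncl_apply, map_add, specVec_primitive hD, hprim w w.2, TensorProduct.add_tmul,
      TensorProduct.tmul_add]
    abel
  · refine h.sumNichols_finite_of_eq_bot hc hK ?_ hsum hpf hN
    rw [eq_bot_iff]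
    intro w hw
    have h0 : specComul c R VR K = 0 := by rw [specComul, dif_neg hex]
    have h1 := hprim w hw
    rw [IsPrimitive, h0, LinearMap.zero_apply] at h1
    -- With zero comultiplication, primitivity reads `0 = w ⊗ 1 + 1 ⊗ w`. Applying `ε` to the second
    -- leg leaves `w`, because `ε w = 0`.
    have h2 := congrArg (fun z => TensorProduct.rid K B (ε.lTensor B z)) h1
    simp only [map_zero, map_add, LinearMap.lTensor_tmul, TensorProduct.rid_tmul, hε, hεW w hw,
      one_smul, zero_smul, add_zero] at h2
    exact h2.symm

end Specialized
end Nichols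

theorem lemma3p5 {k H V : Type*} [Field k] [CharZero k] [Ring H] [HopfAlgebra k H]
    (hS : Function.Bijective (HopfAlgebra.antipode k : H →ₗ[k] H))
    [AddCommGroup V] [Module k V] [Module H V] [IsScalarTower k H V]
    [Nichols.YetterDrinfeld k H V] [FiniteDimensional k V]
    (R : Subring k) (VR : Submodule R V)
    (hVR : Nichols.IsOrder (Nichols.ydBraiding k H V) R VR)
    (m : Ideal R) [m.IsMaximal]
    (W : Submodule (R ⧸ m) (Nichols.Specialized (Nichols.ydBraiding k H V) R VR (R ⧸ m)))
    (hW_deg : W ≤ Nichols.specDegreeGE (Nichols.ydBraiding k H V) R VR (R ⧸ m) 2)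
    (hW_cat : Nichols.IsCategorical
      (Nichols.specBraiding (Nichols.ydBraiding k H V) R VR (R ⧸ m)) W)
    (hW_prim : ∀ w ∈ W, Nichols.IsPrimitive (Nichols.ydBraiding k H V) R VR (R ⧸ m) w)
    (hW_inf : ¬ Module.Finite (R ⧸ m)
      (Nichols.SumNichols (Nichols.ydBraiding k H V) R VR (R ⧸ m) W)) :
    ¬ FiniteDimensional k (Nichols.NicholsAlgebra (Nichols.ydBraiding k H V)) :=
  fun hfin => hW_inf <| hVR.sumNichols_finite Nichols.isYangBaxter_ydBraiding
    ((Ideal.Quotient.maximal_ideal_iff_isField_quotient m).mp ‹_›)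
    Ideal.Quotient.mk_surjective hW_deg hW_cat hW_prim hfin
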